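/- **Setting.** Let $(x_i,y_i,s_i)$, $i=1,\dots,n$, be training points with labels $y_i\in\{1,\dots,m\}$ and sensitive attributes $s_i\in\{1,\dots,k\}$. For $\theta\in\mathbb R^d$ let $\ell_i(\theta)=\ell(z_i;\theta)$ be the loss at $z_i=(x_i,y_i)$, and let $F(x_i;\theta)=(F_1,\dots,F_m)(x_i;\theta)$ be a probability vector, where $F_j(x_i;\theta)$ is the probability that the model assigns the label $j$ to $x_i$. Put $P_s(a)=\frac1n\#\{i: s_i=a\}$, $P_{\hat y_\theta}(j)=\frac1n\sum_i F_j(x_i;\theta)$, $P_{\hat y_\theta,s}(j,a)=\frac1n\sum_{i:\,s_i=a}F_j(x_i;\theta)$, and $(Q_\theta)_{ja}=P_{\hat y_\theta,s}(j,a)/\sqrt{P_{\hat y_\theta}(j)P_s(a)}$. For $\lambda\ge 0$ and an uncertainty radius $r\ge 0$, the $L_2$ robust objective is $$G(\theta)=\frac1n\sum_{i=1}^n\ell_i(\theta)+\lambda\max_{Q:\ \|\sigma(Q)-\sigma(Q_\theta)\|_2\le r}\mathrm{Tr}(Q^TQ),$$ where $\sigma(Q)$ is the vector of singular values of $Q\in\mathbb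 R^{m\times k}$ in decreasing order. For $W\in\mathbb R^{k\times m}$ let $$\psi_i(\theta,W)=-\mathrm{Tr}\big(W\,\mathbb E[\hat{\mathbf y}\hat{\mathbf y}^T\mid x_i]\,W^T\big)+2\,\mathrm{Tr}\big(W\,\mathbb E[\hat{\mathbf y}\,\mathbf s_i^T\mid x_i,s_i]\,P_s^{-1/2}\big),$$ where $\hat{\mathbf y}$ is the one-hot vector that equals $e_j$ with probability $F_j(x_i;\theta)$, $\mathbf s_i=e_{s_i}$, and $P_s=\mathrm{diag}(P_s(1),\dots,P_s(k))$. **Algorithm.** Given $(\theta^0,\alpha^0,W^0)$ with $\alpha^0>0$, step sizes $\eta>0$ (for $\theta$ and $\alpha$) and $\eta_W>0$ (for $W$), at each iteration $t\geq 1$ draw, independently of the past, a uniformly random subset $B_t\subseteq\{1,\dots,n\}$ of size $b$, and set $$\begin{aligned}\theta^{t}&=\theta^{t-1}-\frac{\eta}{b}\sum_{i\in B_t}\big[\nabla\ell_i(\theta^{t-1})+\lambda(1+r\alpha^{t-1})\nabla_\theta\psi_i(\theta^{t-1},W^{t-1})\big],\\ \alpha^t&=\alpha^{t-1}-\eta\lambda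 r\Big[\frac1b\sum_{i\in B_t}\psi_i(\theta^{t-1},W^{t-1})-\frac1{(\alpha^{t-1})^2}\Big],\\ W^t&=\Pi_{\mathcal W}\Big[W^{t-1}+\eta_W\lambda(1+r\alpha^{t-1})\frac1b\sum_{i\in B_t}\nabla_W\psi_i(\theta^{t-1},W^{t-1})\Big],\end{aligned}$$ where $\Pi_{\mathcal W}$ is the Euclidean projection onto $\mathcal W=\{W:\|W\|_F\le 2/(\mu\sqrt p)\}$, with $\mu,p$ as below. **Assumptions.** The functions $\ell_i$ and $\theta\mapsto F_j(x_i;\theta)$ are $L$-Lipschitz and differentiable with $\beta$-Lipschitz gradients; $P_s(a)\ge p>0$ for every $a$; $P_{\hat y_\theta}(j)\ge\mu>0$ for every $j$ and every $\theta$; and the empirical risk is bounded below: $\frac1n\sum_i\ell_i(\theta^0)-\inf_\theta\frac1n\sum_i\ell_i(\theta)\le\Delta<\infty$. **Proposition.** There is a constant $C>0$, depending only on $m,k,L,\beta,\mu,p,\lambda,r,\Delta,\alpha^0,W^0$, such that for every $\varepsilon\in(0,1]$ there are step sizes $\eta,\eta_W>0$ and an integer $1\le T\le C\varepsilon^{-5}$,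 depending only on $\varepsilon$ and on the same quantities as $C$, such that for every problem as above $G$ is differentiable, and for every batch size $1\le b\le n$ the iterates of the algorithm satisfy $\alpha^t>0$ almost surely for all $t\le T$ and $$\frac1T\sum_{t=1}^T\mathbb E\,\|\nabla G(\theta^t)\|\le\varepsilon .$$ That is, an iterate drawn uniformly from $\theta^1,\dots,\theta^T$ is an $\varepsilon$-first-order stationary point of $G$ in expectation; in particular there is $1\le t\le T$ such that the output $\theta^t$ of the algorithm run for $t$ iterations satisfies $\mathbb E\|\nabla G(\theta^t)\|\le\varepsilon$. -/

import Mathlib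

open MeasureTheory ProbabilityTheory
open scoped NNReal

/-- Model parameters `θ ∈ ℝ^d`, with the Euclidean norm. -/
abbrev ModelParam (d : ℕ) := EuclideanSpace ℝ (Fin d)

/-- Dual variables `W ∈ ℝ^{k × m}`; the norm of this space is the Frobenius norm. -/
abbrev DualVar (k m : ℕ) := EuclideanSpace ℝ (Fin k × Fin m)

/-- The `k × m` matrix of a dual variable. -/
def DualVar.toMatrix {k m : ℕ} (W : DualVar k m) : Matrix (Fin k) (Fin m) ℝ :=
  Matrix.of fun a j => W (a, j)

noncomputable section

/-- Euclidean projection onto the closed ball of radius `R` around the origin. -/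
def projBall {E : Type*} [NormedAddCommGroup E] [NormedSpace ℝ E] (R : ℝ) (w : E) : E :=
  if ‖w‖ ≤ R then w else (R / ‖w‖) • w

/-- The `ℓ²` norm of the difference of the vectors of (decreasingly ordered) singular values
of two matrices with `k` columns. -/
def singularDist {m k : ℕ} (A B : Matrix (Fin m) (Fin k) ℝ) : ℝ :=
  √(∑ i ∈ Finset.range k,
    ((Matrix.toEuclideanLin A).singularValues i - (Matrix.toEuclideanLin B).singularValues i) ^ 2)

/-- A supervised learning task: `n` training points with features in `X`, labels in `Fin m` and
sensitive attributes in `Fin k`, a loss `ℓ(z; θ)`, and a model whose probabilistic output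
`F_j(x; θ)` is the probability of assigning the label `j` to `x`. -/
structure FairTask (X : Type*) (n m k d : ℕ) where
  feature : Fin n → X
  label : Fin n → Fin m
  sens : Fin n → Fin k
  loss : X → Fin m → ModelParam d → ℝ
  output : X → ModelParam d → Fin m → ℝ

namespace FairTask

variable {X : Type*} {n m k d : ℕ} (P : FairTask X n m k d)

/-- Loss at the `i`-th training point. -/
def lossAt (i : Fin n) (θ : ModelParam d) : ℝ := P.loss (P.feature i) (P.label i) θ

/-- Probability of the label `j` at the `i`-th training point. -/
def outputAt (i : Fin n) (j : Fin m) (θ : ModelParam d) : ℝ := P.output (P.feature i) θ j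

/-- The empirical risk. -/
def risk (θ : ModelParam d) : ℝ := (n : ℝ)⁻¹ * ∑ i, P.lossAt i θ

/-- `P(ŷ_θ = j)` under the training distribution. -/
def probY (θ : ModelParam d) (j : Fin m) : ℝ := (n : ℝ)⁻¹ * ∑ i, P.outputAt i j θ

/-- `P(s = a)` under the training distribution. -/
def probS (a : Fin k) : ℝ := (n : ℝ)⁻¹ * ∑ i, if P.sens i = a then 1 else 0

/-- `P(ŷ_θ = j, s = a)` under the training distribution. -/
def probYS (θ : ModelParam d) (j : Fin m) (a : Fin k) : ℝ :=
  (n : ℝ)⁻¹ * ∑ i, if P.sens i = a then P.outputAt i j θ else 0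

/-- The matrix `Q_θ` of the training distribution. -/
def Q (θ : ModelParam d) : Matrix (Fin m) (Fin k) ℝ :=
  Matrix.of fun j a => P.probYS θ j a / (√(P.probY θ j) * √(P.probS a))

/-- The objective of the distributionally robust problem with the `L₂` uncertainty ball of
radius `r`: empirical risk plus `lam` times the largest value of `Tr(QᵀQ)` over the matrices `Q`
whose vector of singular values is within `ℓ²` distance `r` of that of `Q_θ`. -/
def robustObjective (lam r : ℝ) (θ : ModelParam d) : ℝ :=
  P.risk θ + lam *
    sSup {v | ∃ A : Matrix (Fin m) (Fin k) ℝ,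
      singularDist A (P.Q θ) ≤ r ∧ v = (A.transpose * A).trace}

/-- `E[ŷ ŷᵀ | x_i]`, where `ŷ` is the one-hot vector that equals `e_j` with probability
`F_j(x_i; θ)`. -/
def condYY (i : Fin n) (θ : ModelParam d) : Matrix (Fin m) (Fin m) ℝ :=
  ∑ j, P.outputAt i j θ • Matrix.vecMulVec (Pi.single j 1) (Pi.single j 1)

/-- `E[ŷ s_iᵀ | x_i, s_i]`, where `s_i` is one-hot encoded as well. -/
def condYS (i : Fin n) (θ : ModelParam d) : Matrix (Fin m) (Fin k) ℝ :=
  ∑ j, P.outputAt i j θ • Matrix.vecMulVec (Pi.single j 1) (Pi.single (P.sens i) 1)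

/-- The diagonal matrix `P_s^{-1/2}`. -/
def invSqrtPS : Matrix (Fin k) (Fin k) ℝ := Matrix.diagonal fun a => (√(P.probS a))⁻¹

/-- `ψ(z_i; θ, W) = -Tr(W E[ŷŷᵀ|x_i] Wᵀ) + 2 Tr(W E[ŷ s_iᵀ|x_i, s_i] P_s^{-1/2})`. -/
def psi (i : Fin n) (θ : ModelParam d) (W : DualVar k m) : ℝ :=
  -(W.toMatrix * P.condYY i θ * W.toMatrix.transpose).trace
    + 2 * (W.toMatrix * P.condYS i θ * P.invSqrtPS).trace

end FairTask

/-- The variables of the stochastic gradient descent-ascent algorithm. -/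
structure SGDAState (k m d : ℕ) where
  θ : ModelParam d
  α : ℝ
  W : DualVar k m

namespace FairTask

variable {X : Type*} {n m k d : ℕ} (P : FairTask X n m k d)

/-- One iteration with the mini-batch `B`: a gradient descent step of size `ηx` in `(θ, α)` and a
projected gradient ascent step of size `ηW` in `W`, for the objective
`(1/n) ∑ i, [ℓ(z_i; θ) + lam (1 + r α) ψ(z_i; θ, W)] + lam r / α`. All three updates use
the old state. -/
def sgdaStep (lam r R ηx ηW : ℝ) (B : Finset (Fin n)) (z : SGDAState k m d) :
    SGDAState k m d where
  θ := z.θ - ηx • ((B.card : ℝ)⁻¹ • ∑ i ∈ B,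
    (gradient (P.lossAt i) z.θ
      + (lam * (1 + r * z.α)) • gradient (fun θ' => P.psi i θ' z.W) z.θ))
  α := z.α - ηx * (lam * r) * ((B.card : ℝ)⁻¹ * ∑ i ∈ B, P.psi i z.θ z.W - 1 / z.α ^ 2)
  W := projBall R (z.W + ηW • ((lam * (1 + r * z.α)) •
    ((B.card : ℝ)⁻¹ • ∑ i ∈ B, gradient (P.psi i z.θ) z.W)))

/-- The iterates of the algorithm started at `z₀` with the mini-batches `B 0, B 1, …`. -/
def sgda (lam r R ηx ηW : ℝ) (z₀ : SGDAState k m d) (B : ℕ → Finset (Fin n)) :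
    ℕ → SGDAState k m d
  | 0 => z₀
  | t + 1 => P.sgdaStep lam r R ηx ηW (B t) (sgda lam r R ηx ηW z₀ B t)

end FairTask

/-- `B 0, B 1, …` are independent, and each is a uniformly random subset of `{1, …, n}` with `b`
elements. -/
structure IsUniformBatches {Ω : Type*} [MeasurableSpace Ω] {n : ℕ} (Pr : Measure Ω) (b : ℕ)
    (B : ℕ → Ω → Finset (Fin n)) : Prop where
  measurable : ∀ t (A : Finset (Fin n)), MeasurableSet {ω | B t ω = A}
  uniform : ∀ t (A : Finset (Fin n)), A.card = b → Pr {ω | B t ω = A} = ((n.choose b : ENNReal))⁻¹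
  indep : iIndepFun (m := fun _ => (⊤ : MeasurableSpace (Finset (Fin n)))) B Pr

end

/-!
The matrix `Q_θ` enters the robust objective only through its Frobenius norm: by the triangle
inequality for vectors of singular values, attained at a multiple of `Q_θ`
(`isGreatest_trace_singularDist_le`), the inner maximum equals `(‖Q_θ‖ + r)²`. Here `‖Q_θ‖ ≥ 1`,
since the vectors of square roots of the marginals are a pair of singular vectors with value `1`.
For `q = ‖Q_θ‖²` one has `(√q + r)² + const = min_α [(1 + r α) q + r / α]`, and `q` is the maximum
over `W` of the average of `ψ(z_i; θ, W)`, which is a strongly concave quadratic in `W`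
(`FairTask.meanPsi_eq_sqNorm_sub`) with a maximizer `W*(θ)` that is Lipschitz in `θ`. So the
algorithm performs stochastic gradient descent in `(θ, α)` on the envelope
`Φ(θ, α) = risk(θ) + lam (1 + r α) q(θ) + lam r / α`, with `W` tracking `W*(θ)`.
The envelope is smooth although it is a maximum, because first-order changes of `W*` do not
contribute (`FairTask.IsRegular.abs_sqNorm_sub_sub_inner_le`).

The difficulty is that `α` is not projected: it can grow linearly in time, and both the gradients
and their noise grow with `α`. The Lyapunov function
`Φ + κ lam (1 + r α) ‖W - W*(θ)‖² + s α⁴` copes with this. The quadratic term decreases by strong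
concavity and pays for the errors caused by `W ≠ W*(θ)`. The quartic term has a drift
of order `-s lam r α³`, which pays for the noise of order `η² (1 + r α)³`; the weight `s`, of order `ε²`,
keeps its own bias below the target accuracy and keeps `s α` bounded over the whole run. The
batches being independent and uniform, one iteration decreases the expectation of this function
by `(ηx / 2) ‖∇Φ‖²` up to an error `O(ηx ε²)` (`FairTask.batchAvg_lyapunov_le`). With `ηx`, `ηW` of
orders `ε³`, `ε²`, and `T` of order `ε⁻⁵`, telescoping makes the average of `E ‖∇Φ‖²` of order `ε²`.

The barrier `lam r / α` keeps `α` above a positive constant on every path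
(`FairTask.admissible_sgdaStep`). Finally `‖∇G(θ)‖² ≤ M ‖∇Φ(θ, α)‖²` for every `α > 0`
(`FairTask.DriftBounds.sq_norm_gradient_robustObjective_le`): where `α` is far from its optimal
value `1 / ‖Q_θ‖`, the partial derivative of `Φ` in `α` is bounded below.
-/

noncomputable section

/-! ### Singular values and the inner maximum -/

theorem LinearMap.IsSymmetric.eigenvalues_of_smul {E : Type*} [NormedAddCommGroup E]
    [InnerProductSpace ℝ E] [FiniteDimensional ℝ E] {T T' : E →ₗ[ℝ] E} {N : ℕ}
    (hT : T.IsSymmetric) (hT' : T'.IsSymmetric) (hN : Module.finrank ℝ E = N) {c : ℝ}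
    (hc : 0 ≤ c) (h : T' = c • T) (i : Fin N) :
    hT'.eigenvalues hN i = c * hT.eigenvalues hN i := by
  have key : List.ofFn (hT'.eigenvalues hN) = List.ofFn (fun i => c * hT.eigenvalues hN i) := by
    have hroots : T'.charpoly.roots
        = Multiset.map (fun i => c * hT.eigenvalues hN i) Finset.univ.val := by
      rw [← LinearMap.charpoly_toMatrix _ (hT.eigenvectorBasis hN).toBasis, h, map_smul,
        hT.toMatrix_eigenvectorBasis hN]
      have : c • Matrix.diagonal (RCLike.ofReal (K := ℝ) ∘ hT.eigenvalues hN)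
          = Matrix.diagonal (fun i => c * hT.eigenvalues hN i) := by
        ext i j
        simp [Matrix.diagonal_apply]
      rw [this]
      generalize (fun i => c * hT.eigenvalues hN i) = g
      rw [Matrix.charpoly_diagonal, Polynomial.roots_prod _ _ (by
        simp [Finset.prod_ne_zero_iff, Polynomial.X_sub_C_ne_zero])]
      simp
    rw [← hT'.sort_roots_charpoly_eq_eigenvalues hN, hroots]
    simp only [Fin.univ_val_map, Multiset.map_coe, List.map_ofFn, Function.comp_def,
      RCLike.re_to_real, Multiset.coe_sort]
    apply List.mergeSort_of_pairwise
    simp_rw [decide_eq_true_eq, ← List.sortedGE_iff_pairwise]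
    exact Antitone.sortedGE_ofFn fun i j hij =>
      mul_le_mul_of_nonneg_left (hT.eigenvalues_antitone hN hij) hc
  exact congrFun (List.ofFn_injective key) i

theorem LinearMap.singularValues_smul_of_nonneg {E F : Type*} [NormedAddCommGroup E]
    [InnerProductSpace ℝ E] [FiniteDimensional ℝ E] [NormedAddCommGroup F] [InnerProductSpace ℝ F]
    [FiniteDimensional ℝ F] (T : E →ₗ[ℝ] F) {c : ℝ} (hc : 0 ≤ c) (i : ℕ) :
    (c • T).singularValues i = c * T.singularValues i := by
  by_cases hi : i < Module.finrank ℝ E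
  · rw [singularValues_of_lt _ rfl hi, singularValues_of_lt _ rfl hi,
      IsSymmetric.eigenvalues_of_smul T.isSymmetric_adjoint_comp_self
        (c • T).isSymmetric_adjoint_comp_self rfl (sq_nonneg c), Real.sqrt_mul (sq_nonneg c),
        Real.sqrt_sq hc]
    ext x
    simp [map_smul, smul_smul, sq]
  · rw [singularValues_of_finrank_le _ (not_lt.1 hi), singularValues_of_finrank_le _ (not_lt.1 hi),
      mul_zero]

theorem sum_sq_singularValues_eq_trace {m k : ℕ} (A : Matrix (Fin m) (Fin k) ℝ) :
    ∑ i ∈ Finset.range k, (Matrix.toEuclideanLin A).singularValues i ^ 2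
      = (A.transpose * A).trace := by
  have hfin : Module.finrank ℝ (EuclideanSpace ℝ (Fin k)) = k := by simp
  rw [Finset.sum_range]
  simp_rw [LinearMap.sq_singularValues_fin _ hfin]
  have h1 := (Matrix.toEuclideanLin A).isSymmetric_adjoint_comp_self.trace_eq_sum_eigenvalues hfin
  simp only [RCLike.ofReal_real_eq_id, id] at h1
  rw [← h1]
  have h2 : (Matrix.toEuclideanLin A).adjoint ∘ₗ Matrix.toEuclideanLin A
      = Matrix.toEuclideanLin (A.transpose * A) := by
    rw [← Matrix.toEuclideanLin_conjTranspose_eq_adjoint]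
    ext x
    simp [Matrix.toEuclideanLin, Matrix.toLpLin_apply]
  rw [h2]
  rw [Matrix.toEuclideanLin_eq_toLin_orthonormal, Matrix.trace_toLin_eq]

theorem trace_transpose_mul_self_eq_sum {m k : ℕ} (A : Matrix (Fin m) (Fin k) ℝ) :
    (A.transpose * A).trace = ∑ j, ∑ a, A j a ^ 2 := by
  simp only [Matrix.trace, Matrix.diag, Matrix.mul_apply, Matrix.transpose_apply]
  rw [Finset.sum_comm]
  simp [sq]

theorem sqrt_trace_le_add_singularDist {m k : ℕ} (A B : Matrix (Fin m) (Fin k) ℝ) :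
    √(A.transpose * A).trace ≤ √(B.transpose * B).trace + singularDist A B := by
  let v (M : Matrix (Fin m) (Fin k) ℝ) : EuclideanSpace ℝ (Fin k) :=
    WithLp.toLp 2 fun i => (Matrix.toEuclideanLin M).singularValues i
  have hv : ∀ M, √(M.transpose * M).trace = ‖v M‖ := fun M => by
    rw [EuclideanSpace.norm_eq, ← sum_sq_singularValues_eq_trace, Finset.sum_range]
    simp [v]
  have hd : singularDist A B = ‖v A - v B‖ := by
    rw [EuclideanSpace.norm_eq, singularDist, Finset.sum_range]
    simp [v]
  rw [hv, hv, hd]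
  simpa using norm_add_le (v B) (v A - v B)

/-- The inner maximum over the uncertainty ball: it is attained at the multiple of `B` whose
vector of singular values has norm `‖σ(B)‖ + r`. -/
theorem isGreatest_trace_singularDist_le {m k : ℕ} (B : Matrix (Fin m) (Fin k) ℝ) {r : ℝ}
    (hr : 0 ≤ r) (hB : 0 < (B.transpose * B).trace) :
    IsGreatest {v | ∃ A : Matrix (Fin m) (Fin k) ℝ,
      singularDist A B ≤ r ∧ v = (A.transpose * A).trace} ((√(B.transpose * B).trace + r) ^ 2) := by
  have hs : 0 < √(B.transpose * B).trace := Real.sqrt_pos.2 hB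
  set s := √(B.transpose * B).trace with hsdef
  have hss : s ^ 2 = (B.transpose * B).trace := Real.sq_sqrt hB.le
  constructor
  · have hc : 0 ≤ 1 + r / s := by positivity
    refine ⟨(1 + r / s) • B, ?_, ?_⟩
    · have : singularDist ((1 + r / s) • B) B = √((r / s) ^ 2 * s ^ 2) := by
        rw [singularDist, hss, ← sum_sq_singularValues_eq_trace, Finset.mul_sum]
        congr 1
        refine Finset.sum_congr rfl fun i _ => ?_
        rw [map_smul, LinearMap.singularValues_smul_of_nonneg _ hc]
        ring
      rw [this, ← mul_pow, div_mul_cancel₀ _ hs.ne', Real.sqrt_sq hr]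
    · rw [Matrix.transpose_smul, Matrix.smul_mul, Matrix.mul_smul, Matrix.trace_smul,
        Matrix.trace_smul, ← hss, smul_eq_mul, smul_eq_mul]
      field_simp
  · rintro v ⟨A, hA, rfl⟩
    have h0 : 0 ≤ (A.transpose * A).trace := by
      rw [trace_transpose_mul_self_eq_sum]; positivity
    rw [← Real.sq_sqrt h0]
    have := sqrt_trace_le_add_singularDist A B
    gcongr
    linarith

/-! ### One-step estimates -/

set_option maxHeartbeats 1000000 in
/-- Change of `h + λ(1 + rα)q + λr/α` under a step: the first-order terms are kept, and the
remainder is quadratic in the step size, with a cubic weight in `1 + rα`. -/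
theorem envelope_step_le {C lam r η α α' y N h h' q q' u v : ℝ} (hC : 1 ≤ C) (hl0 : 0 ≤ lam)
    (hl : lam ≤ C) (hr0 : 0 ≤ r) (hr : r ≤ C) (hη : 0 ≤ η) (hα : C⁻¹ ≤ α) (hα' : C⁻¹ ≤ α')
    (hy : α' = α + y) (hN0 : 0 ≤ N) (hN : N ≤ η * (C * (1 + r * α)))
    (hyb : |y| ≤ η * (lam * r) * C) (hh : h' ≤ h + u + C * N ^ 2)
    (hq : q' ≤ q + v + C * N ^ 2) (hqL : |q' - q| ≤ C * N) :
    h' + lam * (1 + r * α') * q' + lam * r / α'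
      ≤ h + lam * (1 + r * α) * q + lam * r / α + (u + lam * (1 + r * α) * v)
        + lam * r * (q - 1 / α ^ 2) * y + 4 * C ^ 11 * η ^ 2 * (1 + r * α) ^ 3 := by
  have hC0 : 0 < C := by linarith
  have hα0 : 0 < α := lt_of_lt_of_le (by positivity) hα
  have hα'0 : 0 < α' := lt_of_lt_of_le (by positivity) hα'
  have ha : 1 ≤ 1 + r * α := by nlinarith
  obtain ⟨a, ha_def⟩ : ∃ a, a = 1 + r * α := ⟨_, rfl⟩
  rw [← ha_def] at ha hN ⊢
  have hρ : lam * r ≤ C ^ 2 := by rw [sq]; gcongr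
  have hρ0 : 0 ≤ lam * r := by positivity
  have hyb' : |y| ≤ η * C ^ 3 := hyb.trans (by
    calc η * (lam * r) * C ≤ η * C ^ 2 * C := by gcongr
      _ = η * C ^ 3 := by ring)
  have e0 : lam * r / α' ≤ lam * r / α - lam * r * (1 / α ^ 2) * y + lam * r * (y ^ 2 * C ^ 3) := by
    have h1 : 1 / α' = 1 / α - 1 / α ^ 2 * y + y ^ 2 * (1 / α * (1 / α) * (1 / α')) := by
      have : y = α' - α := by linarith
      rw [this]
      field_simp
      ring
    have h2 : 1 / α * (1 / α) * (1 / α') ≤ C ^ 3 := by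
      have i1 : 1 / α ≤ C := by rw [one_div]; exact inv_le_of_inv_le₀ hC0 hα
      have i2 : 1 / α' ≤ C := by rw [one_div]; exact inv_le_of_inv_le₀ hC0 hα'
      calc 1 / α * (1 / α) * (1 / α') ≤ C * C * C := by gcongr
        _ = C ^ 3 := by ring
    have h3 := mul_le_mul_of_nonneg_left h2 (sq_nonneg y)
    calc lam * r / α' = lam * r * (1 / α') := by ring
      _ ≤ lam * r * (1 / α - 1 / α ^ 2 * y + y ^ 2 * C ^ 3) := by
          apply mul_le_mul_of_nonneg_left _ hρ0
          linarith
      _ = _ := by ring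
  have e1 : lam * a * q' ≤ lam * a * (q + v + C * N ^ 2) :=
    mul_le_mul_of_nonneg_left hq (by positivity)
  have e2 : lam * r * y * (q' - q) ≤ C ^ 2 * ((η * C ^ 3) * (C * (η * (C * a)))) := by
    calc lam * r * y * (q' - q) ≤ |lam * r * y * (q' - q)| := le_abs_self _
      _ = lam * r * (|y| * |q' - q|) := by rw [abs_mul, abs_mul, abs_of_nonneg hρ0]; ring
      _ ≤ _ := by gcongr; exact hqL.trans (by gcongr)
  have e3 : lam * r * (y ^ 2 * C ^ 3) ≤ C ^ 2 * ((η * C ^ 3) ^ 2 * C ^ 3) := by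
    rw [← sq_abs y]; gcongr
  have e4 : (C + lam * a * C) * N ^ 2 ≤ (C * a + C * a * C) * (η * (C * a)) ^ 2 := by
    gcongr
    nlinarith
  have p1 : a ≤ a ^ 3 := le_self_pow₀ ha (by norm_num)
  have p0 : 1 ≤ a ^ 3 := one_le_pow₀ ha
  have c4 : C ^ 4 ≤ C ^ 11 := pow_le_pow_right₀ hC (by norm_num)
  have c3 : C ^ 3 ≤ C ^ 11 := pow_le_pow_right₀ hC (by norm_num)
  have c7 : C ^ 7 ≤ C ^ 11 := pow_le_pow_right₀ hC (by norm_num)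
  have f2 : C ^ 2 * ((η * C ^ 3) * (C * (η * (C * a)))) ≤ C ^ 11 * η ^ 2 * a ^ 3 := by
    calc _ = C ^ 7 * η ^ 2 * a := by ring
      _ ≤ _ := by gcongr
  have f3 : C ^ 2 * ((η * C ^ 3) ^ 2 * C ^ 3) ≤ C ^ 11 * η ^ 2 * a ^ 3 := by
    calc _ = C ^ 11 * η ^ 2 * 1 := by ring
      _ ≤ _ := by gcongr
  have f4 : (C * a + C * a * C) * (η * (C * a)) ^ 2 ≤ 2 * (C ^ 11 * η ^ 2 * a ^ 3) := by
    calc _ = (C ^ 3 + C ^ 4) * η ^ 2 * a ^ 3 := by ring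
      _ ≤ (C ^ 11 + C ^ 11) * η ^ 2 * a ^ 3 := by gcongr
      _ = _ := by ring
  have e5 : lam * (1 + r * α') * q' = lam * a * q' + lam * r * y * q + lam * r * y * (q' - q) := by
    rw [hy, ha_def]; ring
  have e6 : lam * a * (q + v + C * N ^ 2) + C * N ^ 2
      = lam * a * q + lam * a * v + (C + lam * a * C) * N ^ 2 := by ring
  have e7 : lam * r * (q - 1 / α ^ 2) * y = lam * r * y * q - lam * r * (1 / α ^ 2) * y := by ring
  rw [e5, e7]
  linarith

set_option maxHeartbeats 1000000 in
/-- Change of the weighted squared distance to the optimal dual variable under a step. -/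
theorem dual_step_le {F : Type*} [NormedAddCommGroup F] [InnerProductSpace ℝ F]
    {C μ lam r η ηW α α' y : ℝ} {W W' Ws Ws' v : F} (hC : 1 ≤ C) (hμ : 0 < μ) (hμC : μ⁻¹ ≤ C)
    (hl0 : 0 ≤ lam) (hl : lam ≤ C) (hr0 : 0 ≤ r) (hr : r ≤ C) (hη : 0 ≤ η) (hηW : 0 < ηW)
    (hηle : η ≤ ηW) (hηW1 : ηW ≤ 1) (hα : 0 ≤ α) (hy : α' = α + y)
    (hyb : |y| ≤ η * (lam * r) * C) (hv : ‖v‖ ≤ C)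
    (hW' : ‖W' - Ws‖ ≤ ‖W + ηW • ((lam * (1 + r * α)) • v) - Ws‖)
    (hWs : ‖Ws' - Ws‖ ≤ η * (C ^ 2 * (1 + r * α))) :
    lam * (1 + r * α') * ‖W' - Ws'‖ ^ 2
      ≤ lam * (1 + r * α) * ‖W - Ws‖ ^ 2
        + 2 * ηW * (lam * (1 + r * α)) ^ 2 * inner ℝ (W - Ws) v
        + μ * ηW * (lam * (1 + r * α)) ^ 2 * ‖W - Ws‖ ^ 2
        + 3 * C * r ^ 2 * lam ^ 2 * η * ‖W - Ws‖ ^ 2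
        + 11 * C ^ 9 * (η ^ 2 / ηW + ηW ^ 2) * (1 + r * α) ^ 3 := by
  have hC0 : 0 < C := by linarith
  have ha : 1 ≤ 1 + r * α := by nlinarith [mul_nonneg hr0 hα]
  obtain ⟨a, ha_def⟩ : ∃ a, a = 1 + r * α := ⟨_, rfl⟩
  rw [← ha_def] at ha hW' hWs ⊢
  have hla : 0 ≤ lam * a := by positivity
  set X := ‖W - Ws‖ with hX
  set S := ηW * (lam * a) * ‖v‖ with hS
  set Y := ‖Ws' - Ws‖ with hY
  set J := inner ℝ (W - Ws) v with hJ
  have hS0 : 0 ≤ S := by positivity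
  have hX0 : 0 ≤ X := norm_nonneg _
  have hY0 : 0 ≤ Y := norm_nonneg _
  have hSle : S ≤ ηW * (C * a) * C := by rw [hS]; gcongr
  have hSn : ‖ηW • ((lam * a) • v)‖ = S := by
    rw [norm_smul, norm_smul, Real.norm_of_nonneg hηW.le, Real.norm_of_nonneg hla, hS]; ring
  have hre : W + ηW • ((lam * a) • v) - Ws = (W - Ws) + ηW • ((lam * a) • v) := by abel
  have hP1 : ‖W' - Ws‖ ≤ X + S := by
    refine hW'.trans ?_
    rw [hre, ← hSn]
    exact norm_add_le _ _
  have hP2 : ‖W' - Ws‖ ^ 2 ≤ X ^ 2 + 2 * (ηW * (lam * a) * J) + S ^ 2 := by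
    have : ‖W' - Ws‖ ^ 2 ≤ ‖(W - Ws) + ηW • ((lam * a) • v)‖ ^ 2 := by
      rw [← hre]; gcongr
    rw [norm_add_sq_real, hSn, inner_smul_right, inner_smul_right] at this
    calc _ ≤ _ := this
      _ = _ := by ring
  have hd0 : ‖W' - Ws'‖ ≤ ‖W' - Ws‖ + Y := by
    have : W' - Ws' = (W' - Ws) - (Ws' - Ws) := by abel
    rw [this]; exact norm_sub_le _ _
  have hd1 : ‖W' - Ws'‖ ^ 2 ≤ X ^ 2 + 2 * (ηW * (lam * a) * J) + 2 * S ^ 2 + 2 * Y ^ 2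
      + 2 * X * Y := by
    have h1 : ‖W' - Ws'‖ ^ 2 ≤ (‖W' - Ws‖ + Y) ^ 2 := by gcongr
    have h2 : ‖W' - Ws‖ * Y ≤ (X + S) * Y := by gcongr
    nlinarith [sq_nonneg (S - Y)]
  have hd2 : ‖W' - Ws'‖ ^ 2 ≤ 3 * X ^ 2 + 3 * S ^ 2 + 3 * Y ^ 2 := by
    have h1 : ‖W' - Ws'‖ ^ 2 ≤ (X + S + Y) ^ 2 := by gcongr; linarith
    nlinarith [sq_nonneg (X - S), sq_nonneg (S - Y), sq_nonneg (X - Y)]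
  have hyoung : lam * a * (2 * X * Y) ≤ μ * ηW * (lam * a) ^ 2 * X ^ 2 + C * Y ^ 2 / ηW := by
    have h1 : lam * a * (2 * X * Y) ≤ μ * ηW * (lam * a) ^ 2 * X ^ 2 + Y ^ 2 * (μ⁻¹ / ηW) := by
      have h3 : 0 ≤ μ * ηW * (lam * a * X - Y * (μ⁻¹ / ηW)) ^ 2 := by positivity
      have h4 : μ * ηW * (lam * a * X - Y * (μ⁻¹ / ηW)) ^ 2
          = μ * ηW * (lam * a) ^ 2 * X ^ 2 + Y ^ 2 * (μ⁻¹ / ηW) - lam * a * (2 * X * Y) := by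
        field_simp
        ring
      linarith
    have h2 : Y ^ 2 * (μ⁻¹ / ηW) ≤ C * Y ^ 2 / ηW := by
      rw [mul_div_assoc', mul_comm]; gcongr
    linarith
  have hY2 : Y ^ 2 ≤ C ^ 4 * η ^ 2 * a ^ 2 := by
    calc Y ^ 2 ≤ (η * (C ^ 2 * a)) ^ 2 := by gcongr
      _ = _ := by ring
  have hS2 : S ^ 2 ≤ C ^ 4 * ηW ^ 2 * a ^ 2 := by
    calc S ^ 2 ≤ (ηW * (C * a) * C) ^ 2 := by gcongr
      _ = _ := by ring
  have hY3 : Y ^ 2 ≤ C ^ 4 * ηW ^ 2 * a ^ 2 := hY2.trans (by gcongr)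
  have hyr : lam * r * y ≤ C * r ^ 2 * lam ^ 2 * η := by
    calc lam * r * y ≤ lam * r * (η * (lam * r) * C) := by
          gcongr; exact (le_abs_self _).trans hyb
      _ = _ := by ring
  have hyr5 : C * r ^ 2 * lam ^ 2 * η ≤ C ^ 5 := by
    calc C * r ^ 2 * lam ^ 2 * η ≤ C * C ^ 2 * C ^ 2 * 1 := by gcongr; linarith
      _ = _ := by ring
  have m1 : lam * a * ‖W' - Ws'‖ ^ 2 ≤ lam * a * (X ^ 2 + 2 * (ηW * (lam * a) * J) + 2 * S ^ 2
      + 2 * Y ^ 2 + 2 * X * Y) := mul_le_mul_of_nonneg_left hd1 hla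
  have m2 : lam * r * y * ‖W' - Ws'‖ ^ 2
      ≤ C * r ^ 2 * lam ^ 2 * η * (3 * X ^ 2 + 3 * S ^ 2 + 3 * Y ^ 2) := by
    calc _ ≤ C * r ^ 2 * lam ^ 2 * η * ‖W' - Ws'‖ ^ 2 := by gcongr
      _ ≤ _ := by gcongr
  have p2 : a ^ 2 ≤ a ^ 3 := pow_le_pow_right₀ ha (by norm_num)
  have c5 : C ^ 5 ≤ C ^ 9 := pow_le_pow_right₀ hC (by norm_num)
  have g1 : C * Y ^ 2 / ηW ≤ C ^ 9 * (η ^ 2 / ηW) * a ^ 3 := by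
    calc C * Y ^ 2 / ηW ≤ C * (C ^ 4 * η ^ 2 * a ^ 2) / ηW := by gcongr
      _ = C ^ 5 * (η ^ 2 / ηW) * a ^ 2 := by ring
      _ ≤ _ := by gcongr
  have g2 : lam * a * (2 * S ^ 2 + 2 * Y ^ 2) ≤ 4 * (C ^ 9 * ηW ^ 2 * a ^ 3) := by
    calc lam * a * (2 * S ^ 2 + 2 * Y ^ 2)
        ≤ C * a * (2 * (C ^ 4 * ηW ^ 2 * a ^ 2) + 2 * (C ^ 4 * ηW ^ 2 * a ^ 2)) := by gcongr
      _ = 4 * (C ^ 5 * ηW ^ 2 * a ^ 3) := by ring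
      _ ≤ _ := by gcongr
  have g3 : C * r ^ 2 * lam ^ 2 * η * (3 * S ^ 2 + 3 * Y ^ 2) ≤ 6 * (C ^ 9 * ηW ^ 2 * a ^ 3) := by
    calc C * r ^ 2 * lam ^ 2 * η * (3 * S ^ 2 + 3 * Y ^ 2)
        ≤ C ^ 5 * (3 * (C ^ 4 * ηW ^ 2 * a ^ 2) + 3 * (C ^ 4 * ηW ^ 2 * a ^ 2)) := by gcongr
      _ = 6 * (C ^ 9 * ηW ^ 2 * a ^ 2) := by ring
      _ ≤ _ := by gcongr
  have g4 : 0 ≤ C ^ 9 * (η ^ 2 / ηW) * a ^ 3 := by positivity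
  have g5 : 0 ≤ C ^ 9 * ηW ^ 2 * a ^ 3 := by positivity
  have e : lam * (1 + r * α') * ‖W' - Ws'‖ ^ 2
      = lam * a * ‖W' - Ws'‖ ^ 2 + lam * r * y * ‖W' - Ws'‖ ^ 2 := by
    rw [hy, ha_def]; ring
  rw [e]
  have t1 : lam * a * (X ^ 2 + 2 * (ηW * (lam * a) * J) + 2 * S ^ 2 + 2 * Y ^ 2 + 2 * X * Y)
      = lam * a * X ^ 2 + 2 * ηW * (lam * a) ^ 2 * J + lam * a * (2 * S ^ 2 + 2 * Y ^ 2)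
        + lam * a * (2 * X * Y) := by ring
  have t2 : C * r ^ 2 * lam ^ 2 * η * (3 * X ^ 2 + 3 * S ^ 2 + 3 * Y ^ 2)
      = 3 * C * r ^ 2 * lam ^ 2 * η * X ^ 2
        + C * r ^ 2 * lam ^ 2 * η * (3 * S ^ 2 + 3 * Y ^ 2) := by ring
  have t3 : 11 * C ^ 9 * (η ^ 2 / ηW + ηW ^ 2) * a ^ 3
      = 11 * (C ^ 9 * (η ^ 2 / ηW) * a ^ 3) + 11 * (C ^ 9 * ηW ^ 2 * a ^ 3) := by ring
  rw [t3]
  linarith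

/-- Change of `α⁴` under a step. -/
theorem fourth_power_step_le {C lam r η α y : ℝ} (hC : 1 ≤ C) (hl0 : 0 ≤ lam)
    (hr0 : 0 ≤ r) (hη : 0 ≤ η) (hη1 : η * (lam * r * C) ≤ 1)
    (hyb : |y| ≤ η * (lam * r) * C) :
    (α + y) ^ 4 ≤ α ^ 4 + 4 * α ^ 3 * y + η * (lam * r) * C * (8 * α ^ 2 + 3) := by
  have hb : 0 ≤ η * (lam * r) * C := by positivity
  have hy1 : |y| ≤ 1 := hyb.trans (by linarith)
  have hy2 : y ^ 2 ≤ η * (lam * r) * C := by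
    rw [← sq_abs]
    nlinarith [abs_nonneg y]
  have hy3 : y ^ 2 ≤ 1 := by rw [← sq_abs]; nlinarith [abs_nonneg y]
  have h1 : 4 * α * y ≤ 2 * α ^ 2 + 2 := by nlinarith [sq_nonneg (α - y)]
  have h2 : (α + y) ^ 4 = α ^ 4 + 4 * α ^ 3 * y + y ^ 2 * (6 * α ^ 2 + 4 * α * y + y ^ 2) := by ring
  have h3 : y ^ 2 * (6 * α ^ 2 + 4 * α * y + y ^ 2) ≤ y ^ 2 * (8 * α ^ 2 + 3) :=
    mul_le_mul_of_nonneg_left (by linarith) (sq_nonneg y)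
  have h4 : y ^ 2 * (8 * α ^ 2 + 3) ≤ η * (lam * r) * C * (8 * α ^ 2 + 3) := by gcongr
  linarith

/-- The cubic dissipation of `α⁴` dominates the lower-order terms. -/
theorem quartic_drift_le {C α : ℝ} (hC : 1 ≤ C) (hα : 0 ≤ α) :
    -4 * α ^ 3 + 4 * α + C * (8 * α ^ 2 + 3) ≤ -2 * α ^ 3 + 523 * C ^ 3 := by
  have h1 : 8 * C * α ^ 2 ≤ α ^ 3 + 512 * C ^ 3 := by
    by_cases h : 8 * C ≤ α
    · nlinarith [mul_le_mul_of_nonneg_right h (sq_nonneg α), pow_pos (by linarith : 0 < C) 3]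
    · have : α ^ 2 ≤ (8 * C) ^ 2 := by gcongr; linarith
      nlinarith [mul_le_mul_of_nonneg_left this (by linarith : 0 ≤ 8 * C), pow_nonneg hα 3]
  have h2 : 4 * α ≤ α ^ 3 + 8 := by nlinarith [sq_nonneg (α - 2), mul_nonneg hα (sq_nonneg (α - 2))]
  have h3 : C ≤ C ^ 3 := le_self_pow₀ hC (by norm_num)
  have h4 : 1 ≤ C ^ 3 := one_le_pow₀ hC
  nlinarith

set_option maxHeartbeats 1000000 in
/-- Expected drift of the Lyapunov function in terms of averaged quantities. Here `X` is the
distance of the dual variable to the optimal one; the terms `X²` caused by its inexactness are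
absorbed by the contraction of the dual step, and the terms `(1 + rα)³` caused by the noise are
absorbed by the cubic dissipation of `α⁴`. -/
theorem drift_le {C C₃ C₄ C₅ A K μ ν lam r s₀ ε s η ηW α a ρ q Ψ X G₂ I J : ℝ} (hC : 1 ≤ C)
    (hμ : 0 < μ) (hl0 : 0 ≤ lam) (hρ0 : 0 ≤ ρ)
    (hρC : ρ ≤ C ^ 2) (hρl : ρ ≤ C * (lam * a)) (ha : 1 ≤ a) (hη : 0 < η)
    (hηW : 0 < ηW) (hα : 0 < α) (hs₀ : 0 ≤ s₀) (hs : s = s₀ * ε ^ 2)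
    (hI : G₂ / 2 - (lam * a * (C * X)) ^ 2 / 2 ≤ I) (hJ : J ≤ -2 * μ * X ^ 2)
    (hΨ : q - X ^ 2 ≤ Ψ) (hΨq : Ψ ≤ q) (hX : X ^ 2 ≤ C) (hq : 1 ≤ q)
    (hA0 : 0 ≤ A) (hsα : s * α ≤ A)
    (hα2 : ρ * α ^ 2 ≤ C₃ * (lam * a) ^ 2)
    (hK0 : 0 ≤ K) (hK : C ^ 3 + 4 * A * C₃ ≤ 2 * μ * K)
    (hratio : 3 * C * r ^ 2 * η ≤ μ * ηW)
    (hν : 4 * C ^ 11 * η + 11 * K * C ^ 9 * (η ^ 2 / ηW ^ 2 + ηW) ≤ ν * ε ^ 2)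
    (ha3 : a ^ 3 ≤ C₄ + C₅ * (ρ * α ^ 3)) (hν0 : 0 ≤ ν)
    (hν4 : ν * C₄ ≤ s₀) (hν5 : ν * C₅ ≤ 2 * s₀) :
    -η * I - η * ρ * (ρ * (q - 1 / α ^ 2) + 4 * s * α ^ 3) * (Ψ - 1 / α ^ 2)
      + K * η / ηW * (2 * ηW * (lam * a) ^ 2 * J
        + μ * ηW * (lam * a) ^ 2 * X ^ 2 + 3 * C * r ^ 2 * lam ^ 2 * η * X ^ 2
        + 11 * C ^ 9 * (η ^ 2 / ηW + ηW ^ 2) * a ^ 3)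
      + 4 * C ^ 11 * η ^ 2 * a ^ 3 + s * (η * ρ * C * (8 * α ^ 2 + 3))
      ≤ -(η / 2) * (G₂ + (ρ * (q - 1 / α ^ 2)) ^ 2) + η * ε ^ 2 * (524 * s₀ * C ^ 5) := by
  have hC0 : 0 < C := by linarith
  have hs0 : 0 ≤ s := by rw [hs]; positivity
  have hla : 0 ≤ lam * a := by positivity
  have hρl2 : ρ ^ 2 ≤ C ^ 2 * (lam * a) ^ 2 := by
    rw [← mul_pow]
    gcongr
  obtain ⟨M, hM⟩ : ∃ M, M = (lam * a) ^ 2 * X ^ 2 := ⟨_, rfl⟩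
  have hM0 : 0 ≤ M := by rw [hM]; positivity
  obtain ⟨τ, hτ⟩ : ∃ τ, τ = 1 / α ^ 2 := ⟨_, rfl⟩
  rw [← hτ]
  -- the `θ`-part
  have i1 : -η * I ≤ -(η / 2) * G₂ + η / 2 * C ^ 2 * M := by
    have h1 := mul_le_mul_of_nonneg_left hI hη.le
    have h2 : η * (G₂ / 2 - (lam * a * (C * X)) ^ 2 / 2) = η / 2 * G₂ - η / 2 * C ^ 2 * M := by
      rw [hM]; ring
    linarith
  -- the `α`-part
  have i2 : -η * ρ * (ρ * (q - τ)) * (Ψ - τ)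
      ≤ -(η / 2) * (ρ * (q - τ)) ^ 2 + η / 2 * C ^ 3 * M := by
    have h1 : (q - Ψ) ^ 2 ≤ C * X ^ 2 := by
      have h0 : 0 ≤ q - Ψ := by linarith
      have h00 : q - Ψ ≤ X ^ 2 := by linarith
      calc (q - Ψ) ^ 2 ≤ (X ^ 2) ^ 2 := by gcongr
        _ = X ^ 2 * X ^ 2 := by ring
        _ ≤ C * X ^ 2 := by gcongr
    have h2 : ρ ^ 2 * (q - Ψ) ^ 2 ≤ C ^ 3 * M := by
      calc ρ ^ 2 * (q - Ψ) ^ 2 ≤ (C ^ 2 * (lam * a) ^ 2) * (C * X ^ 2) := by gcongr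
        _ = _ := by rw [hM]; ring
    have h3 : 0 ≤ ρ ^ 2 * (Ψ - τ) ^ 2 := by positivity
    have h4 : -η * ρ * (ρ * (q - τ)) * (Ψ - τ) = -(η / 2) * (ρ * (q - τ)) ^ 2
        + η / 2 * (ρ ^ 2 * (q - Ψ) ^ 2) - η / 2 * (ρ ^ 2 * (Ψ - τ) ^ 2) := by ring
    rw [h4]
    have h5 := mul_le_mul_of_nonneg_left h2 (by positivity : 0 ≤ η / 2)
    have h6 := mul_nonneg (by positivity : 0 ≤ η / 2) h3
    linarith
  have i3 : -η * ρ * (4 * s * α ^ 3) * (Ψ - τ)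
      ≤ s * (η * ρ * (-4 * α ^ 3 + 4 * α)) + 4 * A * C₃ * η * M := by
    have h1 : α ^ 3 * τ = α := by rw [hτ]; field_simp
    have h2 : 1 - X ^ 2 ≤ Ψ := by linarith
    have h3 : -η * ρ * (4 * s * α ^ 3) * (Ψ - τ)
        = -(4 * s * η * ρ * α ^ 3) * Ψ + 4 * s * η * ρ * (α ^ 3 * τ) := by ring
    have h4 := mul_le_mul_of_nonneg_left h2 (by positivity : 0 ≤ 4 * s * η * ρ * α ^ 3)
    have h5 : s * α * (ρ * α ^ 2) * X ^ 2 ≤ A * (C₃ * (lam * a) ^ 2) * X ^ 2 :=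
      mul_le_mul_of_nonneg_right (mul_le_mul hsα hα2 (by positivity) hA0) (sq_nonneg X)
    have h6 := mul_le_mul_of_nonneg_left h5 (by positivity : 0 ≤ 4 * η)
    have h7 : 4 * η * (A * (C₃ * (lam * a) ^ 2) * X ^ 2) = 4 * A * C₃ * η * M := by rw [hM]; ring
    rw [h3, h1]
    linarith
  -- the dual part
  have i4 : K * η / ηW * (2 * ηW * (lam * a) ^ 2 * J + μ * ηW * (lam * a) ^ 2 * X ^ 2
        + 3 * C * r ^ 2 * lam ^ 2 * η * X ^ 2 + 11 * C ^ 9 * (η ^ 2 / ηW + ηW ^ 2) * a ^ 3)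
      ≤ -(2 * μ * K * η) * M + η * a ^ 3 * (11 * K * C ^ 9 * (η ^ 2 / ηW ^ 2 + ηW)) := by
    have h1 : 2 * ηW * (lam * a) ^ 2 * J ≤ -4 * μ * ηW * M := by
      have := mul_le_mul_of_nonneg_left hJ (by positivity : 0 ≤ 2 * ηW * (lam * a) ^ 2)
      rw [hM]
      linarith
    have h2 : 3 * C * r ^ 2 * lam ^ 2 * η * X ^ 2 ≤ μ * ηW * M := by
      have h3 : lam ^ 2 ≤ (lam * a) ^ 2 := by
        gcongr
        exact le_mul_of_one_le_right hl0 ha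
      calc 3 * C * r ^ 2 * lam ^ 2 * η * X ^ 2 = (3 * C * r ^ 2 * η) * lam ^ 2 * X ^ 2 := by ring
        _ ≤ (μ * ηW) * (lam * a) ^ 2 * X ^ 2 := by gcongr
        _ = _ := by rw [hM]; ring
    have h4 : 2 * ηW * (lam * a) ^ 2 * J + μ * ηW * (lam * a) ^ 2 * X ^ 2
        + 3 * C * r ^ 2 * lam ^ 2 * η * X ^ 2 + 11 * C ^ 9 * (η ^ 2 / ηW + ηW ^ 2) * a ^ 3
        ≤ -2 * μ * ηW * M + 11 * C ^ 9 * (η ^ 2 / ηW + ηW ^ 2) * a ^ 3 := by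
      have : μ * ηW * (lam * a) ^ 2 * X ^ 2 = μ * ηW * M := by rw [hM]; ring
      linarith
    refine (mul_le_mul_of_nonneg_left h4 (by positivity : 0 ≤ K * η / ηW)).trans_eq ?_
    field_simp
  have i5 : η * a ^ 3 * (4 * C ^ 11 * η + 11 * K * C ^ 9 * (η ^ 2 / ηW ^ 2 + ηW))
      ≤ η * ε ^ 2 * s₀ + s * (η * ρ * (2 * α ^ 3)) := by
    have h1 : a ^ 3 * (ν * ε ^ 2) ≤ (C₄ + C₅ * (ρ * α ^ 3)) * (ν * ε ^ 2) :=
      mul_le_mul_of_nonneg_right ha3 (by positivity)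
    have h2 : ν * C₄ * ε ^ 2 ≤ s₀ * ε ^ 2 := by gcongr
    have h3 : ν * C₅ * (ρ * α ^ 3 * ε ^ 2) ≤ 2 * s₀ * (ρ * α ^ 3 * ε ^ 2) := by gcongr
    calc η * a ^ 3 * (4 * C ^ 11 * η + 11 * K * C ^ 9 * (η ^ 2 / ηW ^ 2 + ηW))
        ≤ η * a ^ 3 * (ν * ε ^ 2) := mul_le_mul_of_nonneg_left hν (by positivity)
      _ = η * (a ^ 3 * (ν * ε ^ 2)) := by ring
      _ ≤ η * (s₀ * ε ^ 2 + 2 * s₀ * (ρ * α ^ 3 * ε ^ 2)) := by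
          gcongr
          linarith
      _ = _ := by rw [hs]; ring
  have i6 : s * (η * ρ * (-4 * α ^ 3 + 4 * α + C * (8 * α ^ 2 + 3)))
      ≤ s * (η * ρ * (-2 * α ^ 3)) + η * ε ^ 2 * (523 * s₀ * C ^ 5) := by
    have h1 : s * (η * ρ * (-4 * α ^ 3 + 4 * α + C * (8 * α ^ 2 + 3)))
        ≤ s * (η * ρ * (-2 * α ^ 3 + 523 * C ^ 3)) := by
      exact mul_le_mul_of_nonneg_left (mul_le_mul_of_nonneg_left (quartic_drift_le hC hα.le)
        (by positivity)) hs0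
    have h2 : s * (η * ρ * (523 * C ^ 3)) ≤ s * (η * C ^ 2 * (523 * C ^ 3)) := by gcongr
    have h3 : s * (η * C ^ 2 * (523 * C ^ 3)) = η * ε ^ 2 * (523 * s₀ * C ^ 5) := by rw [hs]; ring
    have h4 : s * (η * ρ * (-2 * α ^ 3 + 523 * C ^ 3))
        = s * (η * ρ * (-2 * α ^ 3)) + s * (η * ρ * (523 * C ^ 3)) := by ring
    linarith
  have i7 : η / 2 * C ^ 2 * M + η / 2 * C ^ 3 * M + 4 * A * C₃ * η * M ≤ 2 * μ * K * η * M := by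
    have h1 : C ^ 2 ≤ C ^ 3 := pow_le_pow_right₀ hC (by norm_num)
    have h2 : C ^ 2 / 2 + C ^ 3 / 2 + 4 * A * C₃ ≤ 2 * μ * K := by linarith
    have := mul_le_mul_of_nonneg_right h2 (by positivity : 0 ≤ η * M)
    linarith
  have i8 : η * ε ^ 2 * s₀ ≤ η * ε ^ 2 * (s₀ * C ^ 5) := by
    gcongr
    exact le_mul_of_one_le_right hs₀ (one_le_pow₀ hC)
  have e1 : -η * I - η * ρ * (ρ * (q - τ) + 4 * s * α ^ 3) * (Ψ - τ)
      = -η * I + -η * ρ * (ρ * (q - τ)) * (Ψ - τ) + -η * ρ * (4 * s * α ^ 3) * (Ψ - τ) := by ring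
  have e2 : 4 * C ^ 11 * η ^ 2 * a ^ 3
      + η * a ^ 3 * (11 * K * C ^ 9 * (η ^ 2 / ηW ^ 2 + ηW))
      = η * a ^ 3 * (4 * C ^ 11 * η + 11 * K * C ^ 9 * (η ^ 2 / ηW ^ 2 + ηW)) := by ring
  have e3 : s * (η * ρ * (-4 * α ^ 3 + 4 * α)) + s * (η * ρ * C * (8 * α ^ 2 + 3))
      = s * (η * ρ * (-4 * α ^ 3 + 4 * α + C * (8 * α ^ 2 + 3))) := by ring
  have e4 : s * (η * ρ * (-2 * α ^ 3)) = -(s * (η * ρ * (2 * α ^ 3))) := by ring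
  have e5 : η * ε ^ 2 * (524 * s₀ * C ^ 5)
      = η * ε ^ 2 * (523 * s₀ * C ^ 5) + η * ε ^ 2 * (s₀ * C ^ 5) := by ring
  rw [e1, e5]
  linarith

/-! ### Calculus of functions with Lipschitz gradient -/

section Calculus

variable {E : Type*} [NormedAddCommGroup E] [InnerProductSpace ℝ E] [CompleteSpace E]

theorem hasGradientAt_of_abs_sub_le_sq {f : E → ℝ} {g x : E} {c : ℝ}
    (h : ∀ y, |f y - f x - inner ℝ g (y - x)| ≤ c * ‖y - x‖ ^ 2) : HasGradientAt f g x := by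
  rw [hasGradientAt_iff_isLittleO]
  have h1 : (fun y => f y - f x - inner ℝ g (y - x)) =O[nhds x] fun y => ‖y - x‖ ^ 2 :=
    Asymptotics.IsBigO.of_bound c (Filter.Eventually.of_forall fun y => by
      rw [Real.norm_eq_abs, Real.norm_of_nonneg (by positivity)]; exact h y)
  refine h1.trans_isLittleO ?_
  have h2 : Filter.Tendsto (fun y => ‖y - x‖) (nhds x) (nhds 0) :=
    tendsto_iff_norm_sub_tendsto_zero.1 Filter.tendsto_id
  have h3 := (Asymptotics.isLittleO_pow_id (𝕜 := ℝ) (n := 2) (by norm_num)).comp_tendsto h2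
  refine (h3.congr_left fun _ => rfl).trans_isBigO ?_
  exact (Asymptotics.isBigO_refl _ _).norm_left

theorem abs_sub_sub_inner_gradient_le {f : E → ℝ} {β : ℝ≥0} (hf : Differentiable ℝ f)
    (hβ : LipschitzWith β (gradient f)) (x y : E) :
    |f y - f x - inner ℝ (gradient f x) (y - x)| ≤ β * ‖y - x‖ ^ 2 := by
  have h := (convex_segment x y).norm_image_sub_le_of_norm_fderiv_le' (𝕜 := ℝ) (f := f)
    (φ := fderiv ℝ f x) (C := β * ‖y - x‖) (fun z _ => hf z) (fun z hz => by
      rw [← toDual_gradient, ← toDual_gradient, ← map_sub, LinearIsometryEquiv.norm_map]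
      refine (hβ.norm_sub_le z x).trans ?_
      gcongr
      rw [segment_eq_image'] at hz
      obtain ⟨t, ht, rfl⟩ := hz
      rw [add_sub_cancel_left, norm_smul, Real.norm_of_nonneg ht.1]
      exact mul_le_of_le_one_left (norm_nonneg _) ht.2)
    (left_mem_segment ℝ x y) (right_mem_segment ℝ x y)
  rw [← inner_gradient_left, Real.norm_eq_abs] at h
  rw [sq, ← mul_assoc]
  exact h

theorem norm_gradient_le_of_lipschitz {f : E → ℝ} {L : ℝ≥0} (hf : LipschitzWith L f) (x : E) :
    ‖gradient f x‖ ≤ L := by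
  rw [← LinearIsometryEquiv.norm_map (InnerProductSpace.toDual ℝ E), toDual_gradient]
  exact norm_fderiv_le_of_lipschitz ℝ hf

end Calculus

theorem EuclideanSpace.norm_le_of_abs_le {ι : Type*} [Fintype ι] (v : EuclideanSpace ℝ ι) {c : ℝ}
    (hc : 0 ≤ c) (h : ∀ x, |v x| ≤ c) : ‖v‖ ≤ √(Fintype.card ι) * c := by
  rw [EuclideanSpace.norm_eq, ← Real.sqrt_sq hc, ← Real.sqrt_mul (by positivity)]
  apply Real.sqrt_le_sqrt
  calc ∑ x, ‖v x‖ ^ 2 ≤ ∑ _x : ι, c ^ 2 := by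
        gcongr with x
        exact h x
    _ = _ := by simp

theorem EuclideanSpace.abs_apply_le_norm {ι : Type*} [Fintype ι] (v : EuclideanSpace ℝ ι) (x : ι) :
    |v x| ≤ ‖v‖ := PiLp.norm_apply_le v x

/-! ### Mini-batch averages -/


/-- The average of `f` over the mini-batch `B`. -/
def batchMean {n : ℕ} {M : Type*} [AddCommMonoid M] [Module ℝ M] (B : Finset (Fin n))
    (f : Fin n → M) : M := (B.card : ℝ)⁻¹ • ∑ i ∈ B, f i

theorem norm_batchMean_le {n : ℕ} {M : Type*} [NormedAddCommGroup M] [NormedSpace ℝ M]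
    {B : Finset (Fin n)} (hB : B.Nonempty) {f : Fin n → M} {c : ℝ} (h : ∀ i, ‖f i‖ ≤ c) :
    ‖batchMean B f‖ ≤ c := by
  have hc : (0 : ℝ) < B.card := by exact_mod_cast hB.card_pos
  rw [batchMean, norm_smul, Real.norm_of_nonneg (by positivity), inv_mul_le_iff₀ hc]
  refine (norm_sum_le _ _).trans ((Finset.sum_le_sum fun i _ => h i).trans ?_)
  simp

/-- The average of the batch averages over all batches of `b` elements is the full average. -/
theorem sum_powersetCard_batchMean {n b : ℕ} (hb : 1 ≤ b) (hbn : b ≤ n) {M : Type*}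
    [AddCommGroup M] [Module ℝ M] (f : Fin n → M) :
    ∑ B ∈ Finset.powersetCard b Finset.univ, ((n.choose b : ℕ) : ℝ)⁻¹ • batchMean B f
      = batchMean Finset.univ f := by
  have h1 : ∀ B ∈ Finset.powersetCard b (Finset.univ : Finset (Fin n)),
      ((n.choose b : ℕ) : ℝ)⁻¹ • batchMean B f
        = (((n.choose b : ℕ) : ℝ)⁻¹ * (b : ℝ)⁻¹) • ∑ i, if i ∈ B then f i else 0 := by
    intro B hB
    rw [batchMean, (Finset.mem_powersetCard.1 hB).2, smul_smul]
    congr 1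
    rw [← Finset.sum_filter]
    simp
  have hcount : ∀ i : Fin n, ((Finset.powersetCard b Finset.univ).filter (i ∈ ·)).card
      = (n - 1).choose (b - 1) := by
    intro i
    have h2 : ((Finset.powersetCard b Finset.univ).filter (i ∈ ·))
        = (Finset.powersetCard (b - 1) (Finset.univ.erase i)).image (insert i) := by
      ext B
      simp only [Finset.mem_filter, Finset.mem_image, Finset.mem_powersetCard]
      constructor
      · rintro ⟨⟨-, hB⟩, hi⟩
        exact ⟨B.erase i, ⟨Finset.erase_subset_erase _ (Finset.subset_univ _), by
          rw [Finset.card_erase_of_mem hi, hB]⟩, Finset.insert_erase hi⟩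
      · rintro ⟨S, ⟨hS, hc⟩, rfl⟩
        have hiS : i ∉ S := fun h => by simpa using hS h
        exact ⟨⟨Finset.subset_univ _, by rw [Finset.card_insert_of_notMem hiS, hc]; omega⟩,
          Finset.mem_insert_self _ _⟩
    rw [h2, Finset.card_image_of_injOn, Finset.card_powersetCard, Finset.card_erase_of_mem
      (Finset.mem_univ i), Finset.card_univ, Fintype.card_fin]
    intro S hS S' hS' hSS
    have hiS : i ∉ S := fun h => by simpa using (Finset.mem_powersetCard.1 hS).1 h
    have hiS' : i ∉ S' := fun h => by simpa using (Finset.mem_powersetCard.1 hS').1 h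
    rw [← Finset.erase_insert hiS, ← Finset.erase_insert hiS']
    exact congrArg (fun U => Finset.erase U i) hSS
  rw [Finset.sum_congr rfl h1, ← Finset.smul_sum, Finset.sum_comm]
  have h3 : ∀ i : Fin n, ∑ B ∈ Finset.powersetCard b (Finset.univ : Finset (Fin n)),
      (if i ∈ B then f i else 0) = (((n - 1).choose (b - 1) : ℕ) : ℝ) • f i := by
    intro i
    rw [← Finset.sum_filter, Finset.sum_const, hcount, Nat.cast_smul_eq_nsmul]
  rw [Finset.sum_congr rfl fun i _ => h3 i, ← Finset.smul_sum, smul_smul, batchMean]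
  congr 1
  have h4 : n * (n - 1).choose (b - 1) = n.choose b * b := by
    obtain ⟨n', rfl⟩ : ∃ n', n = n' + 1 := ⟨n - 1, by omega⟩
    obtain ⟨b', rfl⟩ : ∃ b', b = b' + 1 := ⟨b - 1, by omega⟩
    exact Nat.add_one_mul_choose_eq n' b'
  have h5 : (n : ℝ) * ((n - 1).choose (b - 1) : ℕ) = (n.choose b : ℕ) * b := by exact_mod_cast h4
  have hn : (n : ℝ) ≠ 0 := by norm_cast; omega
  have hb0 : (b : ℝ) ≠ 0 := by norm_cast; omega
  have hch : ((n.choose b : ℕ) : ℝ) ≠ 0 := by exact_mod_cast (Nat.choose_pos hbn).ne'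
  rw [Finset.card_univ, Fintype.card_fin]
  field_simp
  linarith

/-! ### The bilinear-quadratic representation of the regularizer -/

namespace FairTask

variable {X : Type*} {n m k d : ℕ} (P : FairTask X n m k d)

/-- The standing assumptions: probabilistic output, Lipschitz and smooth loss and output, and
marginals bounded away from zero. -/
structure IsRegular (L β : ℝ≥0) (μ p : ℝ) : Prop where
  output_nonneg : ∀ i j θ, 0 ≤ P.outputAt i j θ
  output_sum : ∀ i θ, ∑ j, P.outputAt i j θ = 1
  loss_lip : ∀ i, LipschitzWith L (P.lossAt i)
  loss_diff : ∀ i, Differentiable ℝ (P.lossAt i)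
  loss_smooth : ∀ i, LipschitzWith β (gradient (P.lossAt i))
  output_lip : ∀ i j, LipschitzWith L (P.outputAt i j)
  output_diff : ∀ i j, Differentiable ℝ (P.outputAt i j)
  output_smooth : ∀ i j, LipschitzWith β (gradient (P.outputAt i j))
  le_probS : ∀ a, p ≤ P.probS a
  le_probY : ∀ θ j, μ ≤ P.probY θ j

/-- `‖Q_θ‖_F² = Tr(Q_θᵀ Q_θ)`. -/
def sqNorm (θ : ModelParam d) : ℝ := ((P.Q θ).transpose * P.Q θ).trace

/-- The maximizer of `W ↦ (1/n) ∑ i, ψ(z_i; θ, W)`. -/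
def dualOpt (θ : ModelParam d) : DualVar k m :=
  WithLp.toLp 2 fun x => P.probYS θ x.2 x.1 / (P.probY θ x.2 * √(P.probS x.1))

/-- The coefficient of `F_j(x_i; θ)` in `ψ(z_i; θ, W)`. -/
def coef (i : Fin n) (j : Fin m) (W : DualVar k m) : ℝ :=
  -∑ a, W (a, j) ^ 2 + 2 * (W (P.sens i, j) / √(P.probS (P.sens i)))

/-- The gradient of `ψ(z_i; ·, W)` in the model parameters. -/
def gradPsi (i : Fin n) (θ : ModelParam d) (W : DualVar k m) : ModelParam d :=
  ∑ j, P.coef i j W • gradient (P.outputAt i j) θ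

/-- The gradient of `ψ(z_i; θ, ·)` in the dual variable. -/
def gradDual (i : Fin n) (θ : ModelParam d) (W : DualVar k m) : DualVar k m :=
  WithLp.toLp 2 fun x => P.outputAt i x.2 θ *
    (-2 * W x + if P.sens i = x.1 then 2 / √(P.probS x.1) else 0)

/-- `(1/n) ∑ i, ψ(z_i; θ, W)`. -/
def meanPsi (θ : ModelParam d) (W : DualVar k m) : ℝ :=
  batchMean Finset.univ fun i => P.psi i θ W

/-- The gradient of the empirical risk. -/
def gradRisk (θ : ModelParam d) : ModelParam d :=
  batchMean Finset.univ fun i => gradient (P.lossAt i) θ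

/-- The gradient of `‖Q_θ‖_F²`. -/
def gradSqNorm (θ : ModelParam d) : ModelParam d :=
  batchMean Finset.univ fun i => P.gradPsi i θ (P.dualOpt θ)

theorem psi_eq (i : Fin n) (θ : ModelParam d) (W : DualVar k m) :
    P.psi i θ W = ∑ j, P.outputAt i j θ * P.coef i j W := by
  have hYY : P.condYY i θ = Matrix.diagonal fun j => P.outputAt i j θ := by
    ext j j'
    simp only [condYY, Matrix.sum_apply, Matrix.smul_apply, Matrix.vecMulVec_apply,
      Pi.single_apply, Matrix.diagonal_apply, smul_eq_mul]
    by_cases h : j = j'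
    · subst h; simp
    · simp [h]
  have hYS : ∀ j a, P.condYS i θ j a = if a = P.sens i then P.outputAt i j θ else 0 := by
    intro j a
    simp [condYS, Matrix.sum_apply, Matrix.vecMulVec_apply, Pi.single_apply]
  have h1 : (W.toMatrix * P.condYY i θ * W.toMatrix.transpose).trace
      = ∑ j, P.outputAt i j θ * ∑ a, W (a, j) ^ 2 := by
    simp only [Matrix.trace, Matrix.diag, hYY, Matrix.mul_apply, Matrix.diagonal_apply,
      Matrix.transpose_apply, DualVar.toMatrix, Matrix.of_apply, mul_ite, mul_zero,
      Finset.sum_ite_eq', Finset.mem_univ, if_true]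
    rw [Finset.sum_comm]
    refine Finset.sum_congr rfl fun j _ => ?_
    rw [Finset.mul_sum]
    exact Finset.sum_congr rfl fun a _ => by ring
  have h2 : (W.toMatrix * P.condYS i θ * P.invSqrtPS).trace
      = ∑ j, P.outputAt i j θ * (W (P.sens i, j) / √(P.probS (P.sens i))) := by
    simp only [Matrix.trace, Matrix.diag, invSqrtPS, Matrix.mul_diagonal]
    simp only [Matrix.mul_apply, hYS, DualVar.toMatrix, Matrix.of_apply]
    rw [Finset.sum_eq_single (P.sens i)]
    · simp only [if_true, Finset.sum_mul]
      exact Finset.sum_congr rfl fun j _ => by rw [div_eq_mul_inv]; ring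
    · intro a _ ha; simp [ha]
    · simp
  rw [psi, h1, h2, Finset.mul_sum, ← Finset.sum_neg_distrib, ← Finset.sum_add_distrib]
  exact Finset.sum_congr rfl fun j _ => by rw [coef]; ring

theorem batchMean_univ_eq {M : Type*} [AddCommMonoid M] [Module ℝ M] (f : Fin n → M) :
    batchMean Finset.univ f = (n : ℝ)⁻¹ • ∑ i, f i := by simp [batchMean]

theorem meanPsi_eq (θ : ModelParam d) (W : DualVar k m) :
    P.meanPsi θ W = ∑ x : Fin k × Fin m, (-(P.probY θ x.2 * W x ^ 2)
      + 2 * (P.probYS θ x.2 x.1 * (W x / √(P.probS x.1)))) := by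
  have h1 : ∀ i, P.psi i θ W = ∑ x : Fin k × Fin m, (-(P.outputAt i x.2 θ * W x ^ 2)
      + 2 * ((if P.sens i = x.1 then P.outputAt i x.2 θ else 0) * (W x / √(P.probS x.1)))) := by
    intro i
    rw [psi_eq, Fintype.sum_prod_type_right]
    refine Finset.sum_congr rfl fun j _ => ?_
    rw [Finset.sum_add_distrib, Finset.sum_neg_distrib, ← Finset.mul_sum, coef]
    simp only [ite_mul, zero_mul]
    rw [Finset.sum_ite_eq, ← Finset.mul_sum]
    simp only [Finset.mem_univ, if_true]
    ring
  rw [meanPsi, batchMean_univ_eq, Finset.sum_congr rfl fun i _ => h1 i, Finset.sum_comm,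
    smul_eq_mul, Finset.mul_sum]
  refine Finset.sum_congr rfl fun x _ => ?_
  rw [Finset.sum_add_distrib, Finset.sum_neg_distrib, ← Finset.mul_sum, ← Finset.sum_mul,
    ← Finset.sum_mul, probY, probYS]
  ring

theorem sqNorm_eq {θ : ModelParam d} (hY : ∀ j, 0 ≤ P.probY θ j) (hS : ∀ a, 0 ≤ P.probS a) :
    P.sqNorm θ = ∑ x : Fin k × Fin m, P.probYS θ x.2 x.1 ^ 2 / (P.probY θ x.2 * P.probS x.1) := by
  rw [sqNorm, trace_transpose_mul_self_eq_sum, Fintype.sum_prod_type_right]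
  refine Finset.sum_congr rfl fun j _ => Finset.sum_congr rfl fun a _ => ?_
  rw [Q, Matrix.of_apply, div_pow, mul_pow, Real.sq_sqrt (hY j), Real.sq_sqrt (hS a)]

/-- Completing the square in the dual variable. -/
theorem meanPsi_eq_sqNorm_sub {θ : ModelParam d} (hY : ∀ j, 0 < P.probY θ j)
    (hS : ∀ a, 0 < P.probS a) (W : DualVar k m) :
    P.meanPsi θ W = P.sqNorm θ
      - ∑ x : Fin k × Fin m, P.probY θ x.2 * (W x - P.dualOpt θ x) ^ 2 := by
  rw [meanPsi_eq, P.sqNorm_eq (fun j => (hY j).le) fun a => (hS a).le, ← Finset.sum_sub_distrib]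
  refine Finset.sum_congr rfl fun x _ => ?_
  have h1 := (hY x.2).ne'
  have h2 : √(P.probS x.1) ≠ 0 := (Real.sqrt_pos.2 (hS x.1)).ne'
  have h3 : P.probS x.1 = √(P.probS x.1) ^ 2 := (Real.sq_sqrt (hS x.1).le).symm
  simp only [dualOpt]
  rw [show P.probY θ x.2 * P.probS x.1 = P.probY θ x.2 * √(P.probS x.1) ^ 2 by rw [← h3]]
  field_simp
  ring

end FairTask

namespace FairTask

variable {X : Type*} {n m k d : ℕ} (P : FairTask X n m k d)

/-! ### Gradients of the regularizer -/

theorem gradient_psi_param {i : Fin n} (hF : ∀ j, Differentiable ℝ (P.outputAt i j))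
    (θ : ModelParam d) (W : DualVar k m) :
    gradient (fun θ' => P.psi i θ' W) θ = P.gradPsi i θ W := by
  apply HasGradientAt.gradient
  rw [hasGradientAt_iff_hasFDerivAt, gradPsi, map_sum]
  have h : (fun θ' => P.psi i θ' W) = fun θ' => ∑ j, P.outputAt i j θ' * P.coef i j W :=
    funext fun θ' => P.psi_eq i θ' W
  rw [h]
  refine HasFDerivAt.fun_sum fun j _ => ?_
  have := ((hF j θ).hasGradientAt.hasFDerivAt).mul_const (P.coef i j W)
  rw [map_smul]
  exact this

theorem gradient_psi_dual (i : Fin n) (θ : ModelParam d) (W : DualVar k m) :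
    gradient (P.psi i θ) W = P.gradDual i θ W := by
  have hpsi : ∀ V : DualVar k m, P.psi i θ V = ∑ x : Fin k × Fin m,
      (-(P.outputAt i x.2 θ * V x ^ 2) + P.outputAt i x.2 θ *
        ((if P.sens i = x.1 then 2 / √(P.probS x.1) else 0) * V x)) := by
    intro V
    rw [psi_eq, Fintype.sum_prod_type_right]
    refine Finset.sum_congr rfl fun j _ => ?_
    rw [Finset.sum_add_distrib, Finset.sum_neg_distrib, coef]
    simp only [ite_mul, zero_mul, ← Finset.mul_sum, Finset.sum_ite_eq, Finset.mem_univ, if_true]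
    ring
  apply HasGradientAt.gradient
  refine hasGradientAt_of_abs_sub_le_sq (c := ∑ j, |P.outputAt i j θ|) fun V => ?_
  have h : P.psi i θ V - P.psi i θ W - inner ℝ (P.gradDual i θ W) (V - W)
      = -∑ x : Fin k × Fin m, P.outputAt i x.2 θ * ((V - W) x) ^ 2 := by
    rw [hpsi, hpsi, PiLp.inner_apply, ← Finset.sum_sub_distrib, ← Finset.sum_sub_distrib,
      ← Finset.sum_neg_distrib]
    refine Finset.sum_congr rfl fun x _ => ?_
    simp only [gradDual, PiLp.sub_apply, RCLike.inner_apply, conj_trivial]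
    ring
  rw [h, abs_neg, EuclideanSpace.real_norm_sq_eq, Finset.mul_sum]
  refine (Finset.abs_sum_le_sum_abs _ _).trans (Finset.sum_le_sum fun x _ => ?_)
  rw [abs_mul, abs_of_nonneg (sq_nonneg ((V - W) x))]
  gcongr
  exact Finset.single_le_sum (f := fun j => |P.outputAt i j θ|) (fun j _ => abs_nonneg _)
    (Finset.mem_univ x.2)

/-! ### Bounds that hold uniformly over all tasks -/

variable {P} {L β : ℝ≥0} {μ p : ℝ}

namespace IsRegular

variable (hP : P.IsRegular L β μ p)
include hP

theorem output_le_one (i : Fin n) (j : Fin m) (θ : ModelParam d) : P.outputAt i j θ ≤ 1 := by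
  rw [← hP.output_sum i θ]
  exact Finset.single_le_sum (f := fun j => P.outputAt i j θ)
    (fun j _ => hP.output_nonneg i j θ) (Finset.mem_univ j)

theorem probYS_nonneg (θ : ModelParam d) (j : Fin m) (a : Fin k) : 0 ≤ P.probYS θ j a := by
  refine mul_nonneg (by positivity) (Finset.sum_nonneg fun i _ => ?_)
  split_ifs
  exacts [hP.output_nonneg i j θ, le_rfl]

theorem probYS_le_probY (θ : ModelParam d) (j : Fin m) (a : Fin k) :
    P.probYS θ j a ≤ P.probY θ j := by
  refine mul_le_mul_of_nonneg_left (Finset.sum_le_sum fun i _ => ?_) (by positivity)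
  split_ifs
  exacts [le_rfl, hP.output_nonneg i j θ]

theorem sum_probY (hn : 0 < n) (θ : ModelParam d) : ∑ j, P.probY θ j = 1 := by
  simp only [probY, ← Finset.mul_sum]
  rw [Finset.sum_comm, Finset.sum_congr rfl fun i _ => hP.output_sum i θ]
  have : (n : ℝ) ≠ 0 := by positivity
  simp [this]

theorem probY_le_one (hn : 0 < n) (θ : ModelParam d) (j : Fin m) (hμ : 0 ≤ μ) :
    P.probY θ j ≤ 1 := by
  rw [← hP.sum_probY hn θ]
  exact Finset.single_le_sum (f := fun j => P.probY θ j)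
    (fun j _ => hμ.trans (hP.le_probY θ j)) (Finset.mem_univ j)

omit hP in
theorem sum_probS (P : FairTask X n m k d) (hn : 0 < n) : ∑ a, P.probS a = 1 := by
  simp only [probS, ← Finset.mul_sum]
  rw [Finset.sum_comm]
  have : (n : ℝ) ≠ 0 := by positivity
  simp [this]

theorem sum_probYS (hn : 0 < n) (θ : ModelParam d) :
    ∑ x : Fin k × Fin m, P.probYS θ x.2 x.1 = 1 := by
  rw [← hP.sum_probY hn θ, Fintype.sum_prod_type_right]
  refine Finset.sum_congr rfl fun j _ => ?_
  simp only [probYS, probY, ← Finset.mul_sum]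
  rw [Finset.sum_comm]
  simp

theorem abs_probYS_sub_le (hn : 0 < n) (θ θ' : ModelParam d) (j : Fin m) (a : Fin k) :
    |P.probYS θ' j a - P.probYS θ j a| ≤ L * ‖θ' - θ‖ := by
  have h1 : P.probYS θ' j a - P.probYS θ j a = batchMean Finset.univ fun i =>
      if P.sens i = a then P.outputAt i j θ' - P.outputAt i j θ else 0 := by
    rw [batchMean_univ_eq, probYS, probYS, smul_eq_mul, ← mul_sub, ← Finset.sum_sub_distrib]
    congr 1
    exact Finset.sum_congr rfl fun i _ => by split_ifs <;> simp
  rw [h1, ← Real.norm_eq_abs]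
  have : NeZero n := ⟨hn.ne'⟩
  refine norm_batchMean_le Finset.univ_nonempty fun i => ?_
  split_ifs
  · exact (hP.output_lip i j).norm_sub_le θ' θ
  · simp only [norm_zero]; positivity

theorem abs_probY_sub_le (hn : 0 < n) (θ θ' : ModelParam d) (j : Fin m) :
    |P.probY θ' j - P.probY θ j| ≤ L * ‖θ' - θ‖ := by
  have h1 : P.probY θ' j - P.probY θ j = batchMean Finset.univ fun i =>
      P.outputAt i j θ' - P.outputAt i j θ := by
    rw [batchMean_univ_eq, probY, probY, smul_eq_mul, ← mul_sub, ← Finset.sum_sub_distrib]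
  rw [h1, ← Real.norm_eq_abs]
  have : NeZero n := ⟨hn.ne'⟩
  exact norm_batchMean_le Finset.univ_nonempty fun i => (hP.output_lip i j).norm_sub_le θ' θ

theorem norm_dualOpt_le (hn : 0 < n) (hμ : 0 < μ) (hp : 0 < p) (θ : ModelParam d) :
    ‖P.dualOpt θ‖ ≤ 1 / (μ * √p) := by
  have hsp : 0 < √p := Real.sqrt_pos.2 hp
  apply le_of_sq_le_sq _ (by positivity)
  have hsum : (1 / (μ * √p)) ^ 2
      = ∑ x : Fin k × Fin m, (1 / (μ * √p)) ^ 2 * P.probYS θ x.2 x.1 := by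
    rw [← Finset.mul_sum, hP.sum_probYS hn, mul_one]
  rw [EuclideanSpace.real_norm_sq_eq, hsum]
  refine Finset.sum_le_sum fun x _ => ?_
  have h0 := hP.probYS_nonneg θ x.2 x.1
  have h1 : P.probYS θ x.2 x.1 ≤ 1 :=
    (hP.probYS_le_probY θ x.2 x.1).trans (hP.probY_le_one hn θ x.2 hμ.le)
  have h2 : P.dualOpt θ x ≤ 1 / (μ * √p) * P.probYS θ x.2 x.1 := by
    rw [one_div_mul_eq_div]
    simp only [dualOpt]
    gcongr
    · exact hμ.le.trans (hP.le_probY θ x.2)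
    · exact hP.le_probY θ x.2
    · exact hP.le_probS x.1
  have h3 : 0 ≤ P.dualOpt θ x :=
    div_nonneg h0 (mul_nonneg (hμ.le.trans (hP.le_probY θ x.2)) (Real.sqrt_nonneg _))
  calc P.dualOpt θ x ^ 2 ≤ (1 / (μ * √p) * P.probYS θ x.2 x.1) ^ 2 := by gcongr
    _ = (1 / (μ * √p)) ^ 2 * (P.probYS θ x.2 x.1 * P.probYS θ x.2 x.1) := by ring
    _ ≤ (1 / (μ * √p)) ^ 2 * (P.probYS θ x.2 x.1 * 1) := by gcongr
    _ = _ := by ring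

theorem norm_dualOpt_sub_le (hn : 0 < n) (hμ : 0 < μ) (hp : 0 < p) (θ θ' : ModelParam d) :
    ‖P.dualOpt θ' - P.dualOpt θ‖ ≤ √(k * m : ℕ) * (2 * L / (μ * √p)) * ‖θ' - θ‖ := by
  have hsp : 0 < √p := Real.sqrt_pos.2 hp
  have hcard : k * m = Fintype.card (Fin k × Fin m) := by simp
  rw [mul_assoc, hcard]
  refine EuclideanSpace.norm_le_of_abs_le _ (by positivity) fun x => ?_
  have hY := hμ.trans_le (hP.le_probY θ x.2)
  have hY' := hμ.trans_le (hP.le_probY θ' x.2)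
  have hS : √p ≤ √(P.probS x.1) := Real.sqrt_le_sqrt (hP.le_probS x.1)
  have hS0 := hsp.trans_le hS
  set u := P.probYS θ x.2 x.1 with hu
  set u' := P.probYS θ' x.2 x.1 with hu'
  set v := P.probY θ x.2 with hv
  set v' := P.probY θ' x.2 with hv'
  have e : (P.dualOpt θ' - P.dualOpt θ) x
      = ((u' - u) - u / v * (v' - v)) / (v' * √(P.probS x.1)) := by
    simp only [dualOpt, PiLp.sub_apply]
    rw [← hu, ← hu', ← hv, ← hv']
    field_simp
    ring
  have h1 : |u / v| ≤ 1 := by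
    rw [abs_div, abs_of_nonneg (hP.probYS_nonneg θ x.2 x.1), abs_of_pos hY]
    exact (div_le_one hY).2 (hP.probYS_le_probY θ x.2 x.1)
  have h2 : |(u' - u) - u / v * (v' - v)| ≤ 2 * (L * ‖θ' - θ‖) := by
    calc |(u' - u) - u / v * (v' - v)| ≤ |u' - u| + |u / v * (v' - v)| := abs_sub _ _
      _ ≤ L * ‖θ' - θ‖ + 1 * (L * ‖θ' - θ‖) := by
          rw [abs_mul]
          gcongr
          · exact hP.abs_probYS_sub_le hn θ θ' x.2 x.1
          · exact hP.abs_probY_sub_le hn θ θ' x.2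
      _ = _ := by ring
  rw [e, abs_div, abs_of_pos (mul_pos hY' hS0)]
  calc _ ≤ 2 * (L * ‖θ' - θ‖) / (μ * √p) := by
        gcongr
        exact hP.le_probY θ' x.2
    _ = _ := by ring

end IsRegular

/-- A bound for the coefficients `coef` on the ball of radius `R`. -/
theorem abs_coef_le (hp : 0 < p) (hS : ∀ a, p ≤ P.probS a) {R : ℝ} {W : DualVar k m} (hW : ‖W‖ ≤ R)
    (i : Fin n) (j : Fin m) : |P.coef i j W| ≤ k * R ^ 2 + 2 * (R / √p) := by
  have hsp : 0 < √p := Real.sqrt_pos.2 hp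
  have hS : √p ≤ √(P.probS (P.sens i)) := Real.sqrt_le_sqrt (hS _)
  have hx : ∀ x, |W x| ≤ R := fun x => (EuclideanSpace.abs_apply_le_norm W x).trans hW
  rw [coef]
  refine (abs_add_le _ _).trans ?_
  gcongr
  · rw [abs_neg, abs_of_nonneg (by positivity)]
    calc ∑ a, W (a, j) ^ 2 ≤ ∑ _a : Fin k, R ^ 2 :=
          Finset.sum_le_sum fun a _ => sq_le_sq' (abs_le.1 (hx _)).1 (abs_le.1 (hx _)).2
      _ = _ := by simp
  · rw [abs_mul, abs_div, abs_of_pos (hsp.trans_le hS), abs_of_nonneg (by norm_num : (0 : ℝ) ≤ 2)]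
    have := (abs_nonneg _).trans (hx (P.sens i, j))
    gcongr
    exact hx _

theorem abs_coef_sub_le (hp : 0 < p) (hS : ∀ a, p ≤ P.probS a) {R : ℝ} {W W' : DualVar k m}
    (hW : ‖W‖ ≤ R) (hW' : ‖W'‖ ≤ R) (i : Fin n) (j : Fin m) :
    |P.coef i j W - P.coef i j W'| ≤ (k * (2 * R) + 2 / √p) * ‖W - W'‖ := by
  have hsp : 0 < √p := Real.sqrt_pos.2 hp
  have hS : √p ≤ √(P.probS (P.sens i)) := Real.sqrt_le_sqrt (hS _)
  have hx : ∀ x, |W x| ≤ R := fun x => (EuclideanSpace.abs_apply_le_norm W x).trans hW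
  have hx' : ∀ x, |W' x| ≤ R := fun x => (EuclideanSpace.abs_apply_le_norm W' x).trans hW'
  have hd : ∀ x, |W x - W' x| ≤ ‖W - W'‖ := fun x => EuclideanSpace.abs_apply_le_norm (W - W') x
  have e : P.coef i j W - P.coef i j W' = -∑ a, (W (a, j) + W' (a, j)) * (W (a, j) - W' (a, j))
      + 2 * (W (P.sens i, j) - W' (P.sens i, j)) / √(P.probS (P.sens i)) := by
    have : ∑ a, (W (a, j) + W' (a, j)) * (W (a, j) - W' (a, j))
        = ∑ a, W (a, j) ^ 2 - ∑ a, W' (a, j) ^ 2 := by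
      rw [← Finset.sum_sub_distrib]
      exact Finset.sum_congr rfl fun a _ => by ring
    rw [this, coef, coef]
    ring
  rw [e, add_mul]
  refine (abs_add_le _ _).trans ?_
  gcongr
  · rw [abs_neg]
    refine (Finset.abs_sum_le_sum_abs _ _).trans ?_
    calc ∑ a, |(W (a, j) + W' (a, j)) * (W (a, j) - W' (a, j))|
        ≤ ∑ _a : Fin k, 2 * R * ‖W - W'‖ := by
          refine Finset.sum_le_sum fun a _ => ?_
          rw [abs_mul]
          have h1 : |W (a, j) + W' (a, j)| ≤ 2 * R :=
            (abs_add_le _ _).trans (by linarith [hx (a, j), hx' (a, j)])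
          have h2 := (abs_nonneg _).trans h1
          gcongr
          exact hd _
      _ = _ := by simp; ring
  · rw [abs_div, abs_mul, abs_of_pos (hsp.trans_le hS), abs_of_nonneg (by norm_num : (0 : ℝ) ≤ 2),
      div_mul_eq_mul_div]
    gcongr
    exact hd _

end FairTask

theorem batchMean_sub {n : ℕ} {M : Type*} [AddCommGroup M] [Module ℝ M] (B : Finset (Fin n))
    (f g : Fin n → M) : batchMean B f - batchMean B g = batchMean B fun i => f i - g i := by
  rw [batchMean, batchMean, batchMean, ← smul_sub, Finset.sum_sub_distrib]

theorem inner_batchMean_left {n : ℕ} {E : Type*} [NormedAddCommGroup E] [InnerProductSpace ℝ E]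
    (B : Finset (Fin n)) (f : Fin n → E) (v : E) :
    inner ℝ (batchMean B f) v = batchMean B fun i => inner ℝ (f i) v := by
  rw [batchMean, batchMean, real_inner_smul_left, sum_inner, smul_eq_mul]

namespace FairTask

variable {X : Type*} {n m k d : ℕ} (P : FairTask X n m k d)

/-- The properties of a task on which the convergence analysis rests: `C` bounds all Lipschitz,
smoothness and size constants as long as the dual variable stays in the ball of radius `R`, and
`W ↦ (1/n) ∑ i, ψ(z_i; θ, W)` is strongly concave with parameter `2μ`. -/
structure DriftBounds (C R μ : ℝ) : Prop where
  risk_le : ∀ θ θ', P.risk θ' ≤ P.risk θ + inner ℝ (P.gradRisk θ) (θ' - θ) + C * ‖θ' - θ‖ ^ 2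
  hasGradientAt_risk : ∀ θ, HasGradientAt P.risk (P.gradRisk θ) θ
  sqNorm_le : ∀ θ θ',
    P.sqNorm θ' ≤ P.sqNorm θ + inner ℝ (P.gradSqNorm θ) (θ' - θ) + C * ‖θ' - θ‖ ^ 2
  hasGradientAt_sqNorm : ∀ θ, HasGradientAt P.sqNorm (P.gradSqNorm θ) θ
  abs_sqNorm_sub_le : ∀ θ θ', |P.sqNorm θ' - P.sqNorm θ| ≤ C * ‖θ' - θ‖
  one_le_sqNorm : ∀ θ, 1 ≤ P.sqNorm θ
  norm_dualOpt_sub_le : ∀ θ θ', ‖P.dualOpt θ' - P.dualOpt θ‖ ≤ C * ‖θ' - θ‖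
  norm_gradLoss_le : ∀ i θ, ‖gradient (P.lossAt i) θ‖ ≤ C
  abs_psi_le : ∀ i θ W, ‖W‖ ≤ R → |P.psi i θ W| ≤ C
  norm_gradPsi_le : ∀ i θ W, ‖W‖ ≤ R → ‖P.gradPsi i θ W‖ ≤ C
  norm_gradDual_le : ∀ i θ W, ‖W‖ ≤ R → ‖P.gradDual i θ W‖ ≤ C
  norm_sub_dualOpt_sq_le : ∀ θ W, ‖W‖ ≤ R → ‖W - P.dualOpt θ‖ ^ 2 ≤ C
  le_meanPsi : ∀ θ W, P.sqNorm θ - ‖W - P.dualOpt θ‖ ^ 2 ≤ P.meanPsi θ W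
  meanPsi_le : ∀ θ W, P.meanPsi θ W ≤ P.sqNorm θ
  norm_gradPsi_sub_le : ∀ θ W, ‖W‖ ≤ R →
    ‖(batchMean Finset.univ fun i => P.gradPsi i θ W) - P.gradSqNorm θ‖ ≤ C * ‖W - P.dualOpt θ‖
  inner_gradDual_le : ∀ θ W, inner ℝ (W - P.dualOpt θ)
    (batchMean Finset.univ fun i => P.gradDual i θ W) ≤ -2 * μ * ‖W - P.dualOpt θ‖ ^ 2

variable {P} {L β : ℝ≥0} {μ p R : ℝ}

namespace IsRegular

variable (hP : P.IsRegular L β μ p)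
include hP

theorem abs_psi_le (hp : 0 < p) (i : Fin n) (θ : ModelParam d) {W : DualVar k m} (hW : ‖W‖ ≤ R) :
    |P.psi i θ W| ≤ k * R ^ 2 + 2 * (R / √p) := by
  rw [psi_eq]
  refine (Finset.abs_sum_le_sum_abs _ _).trans ?_
  calc ∑ j, |P.outputAt i j θ * P.coef i j W|
      ≤ ∑ j, P.outputAt i j θ * (k * R ^ 2 + 2 * (R / √p)) := by
        refine Finset.sum_le_sum fun j _ => ?_
        rw [abs_mul, abs_of_nonneg (hP.output_nonneg i j θ)]
        exact mul_le_mul_of_nonneg_left (abs_coef_le hp hP.le_probS hW i j)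
          (hP.output_nonneg i j θ)
    _ = _ := by rw [← Finset.sum_mul, hP.output_sum, one_mul]

theorem norm_gradPsi_le (hp : 0 < p) (i : Fin n) (θ : ModelParam d) {W : DualVar k m}
    (hW : ‖W‖ ≤ R) : ‖P.gradPsi i θ W‖ ≤ m * ((k * R ^ 2 + 2 * (R / √p)) * L) := by
  refine (norm_sum_le _ _).trans ?_
  calc ∑ j, ‖P.coef i j W • gradient (P.outputAt i j) θ‖
      ≤ ∑ _j : Fin m, (k * R ^ 2 + 2 * (R / √p)) * L := by
        refine Finset.sum_le_sum fun j _ => ?_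
        rw [norm_smul]
        have h := abs_coef_le hp hP.le_probS hW i j
        have h0 := (abs_nonneg _).trans h
        exact mul_le_mul h (norm_gradient_le_of_lipschitz (hP.output_lip i j) θ)
          (norm_nonneg _) h0
    _ = _ := by simp

theorem norm_gradPsi_sub_le (hp : 0 < p) (i : Fin n) (θ : ModelParam d) {W W' : DualVar k m}
    (hW : ‖W‖ ≤ R) (hW' : ‖W'‖ ≤ R) : ‖P.gradPsi i θ W - P.gradPsi i θ W'‖
      ≤ m * ((k * (2 * R) + 2 / √p) * L) * ‖W - W'‖ := by
  rw [gradPsi, gradPsi, ← Finset.sum_sub_distrib]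
  refine (norm_sum_le _ _).trans ?_
  calc ∑ j, ‖P.coef i j W • gradient (P.outputAt i j) θ
        - P.coef i j W' • gradient (P.outputAt i j) θ‖
      ≤ ∑ _j : Fin m, (k * (2 * R) + 2 / √p) * ‖W - W'‖ * L := by
        refine Finset.sum_le_sum fun j _ => ?_
        rw [← sub_smul, norm_smul]
        have h := abs_coef_sub_le hp hP.le_probS hW hW' i j
        have h0 := (abs_nonneg _).trans h
        exact mul_le_mul h (norm_gradient_le_of_lipschitz (hP.output_lip i j) θ)
          (norm_nonneg _) h0
    _ = _ := by simp; ring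

theorem abs_psi_sub_sub_inner_le (hp : 0 < p) (i : Fin n) (θ θ' : ModelParam d) {W : DualVar k m}
    (hW : ‖W‖ ≤ R) : |P.psi i θ' W - P.psi i θ W - inner ℝ (P.gradPsi i θ W) (θ' - θ)|
      ≤ m * ((k * R ^ 2 + 2 * (R / √p)) * β) * ‖θ' - θ‖ ^ 2 := by
  have e : P.psi i θ' W - P.psi i θ W - inner ℝ (P.gradPsi i θ W) (θ' - θ)
      = ∑ j, P.coef i j W * (P.outputAt i j θ' - P.outputAt i j θ
        - inner ℝ (gradient (P.outputAt i j) θ) (θ' - θ)) := by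
    rw [psi_eq, psi_eq, gradPsi, sum_inner, ← Finset.sum_sub_distrib, ← Finset.sum_sub_distrib]
    refine Finset.sum_congr rfl fun j _ => ?_
    rw [real_inner_smul_left]
    ring
  rw [e]
  refine (Finset.abs_sum_le_sum_abs _ _).trans ?_
  calc _ ≤ ∑ _j : Fin m, (k * R ^ 2 + 2 * (R / √p)) * (β * ‖θ' - θ‖ ^ 2) := by
        refine Finset.sum_le_sum fun j _ => ?_
        rw [abs_mul]
        have h := abs_coef_le hp hP.le_probS hW i j
        have h0 := (abs_nonneg _).trans h
        exact mul_le_mul h (abs_sub_sub_inner_gradient_le (hP.output_diff i j)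
          (hP.output_smooth i j) θ θ') (abs_nonneg _) h0
    _ = _ := by simp; ring

theorem norm_gradDual_le (hp : 0 < p) (i : Fin n) (θ : ModelParam d) {W : DualVar k m}
    (hW : ‖W‖ ≤ R) : ‖P.gradDual i θ W‖ ≤ √(k * m : ℕ) * (2 * R + 2 / √p) := by
  have hsp : 0 < √p := Real.sqrt_pos.2 hp
  have hR := (norm_nonneg _).trans hW
  have hcard : k * m = Fintype.card (Fin k × Fin m) := by simp
  rw [hcard]
  refine EuclideanSpace.norm_le_of_abs_le _ (by positivity) fun x => ?_
  simp only [gradDual]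
  rw [abs_mul, abs_of_nonneg (hP.output_nonneg i x.2 θ)]
  have hx : |-2 * W x + if P.sens i = x.1 then 2 / √(P.probS x.1) else 0|
      ≤ 2 * R + 2 / √p := by
    refine (abs_add_le _ _).trans ?_
    gcongr
    · rw [abs_mul, abs_neg, abs_of_nonneg (by norm_num : (0 : ℝ) ≤ 2)]
      gcongr
      exact (EuclideanSpace.abs_apply_le_norm W x).trans hW
    · split_ifs
      · have : √p ≤ √(P.probS x.1) := Real.sqrt_le_sqrt (hP.le_probS _)
        rw [abs_of_nonneg (by positivity)]
        gcongr
      · rw [abs_zero]; positivity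
  calc _ ≤ 1 * (2 * R + 2 / √p) := by
        gcongr
        exact hP.output_le_one i x.2 θ
    _ = _ := one_mul _

theorem meanPsi_eq_sub (hμ : 0 < μ) (hp : 0 < p) (θ : ModelParam d) (W : DualVar k m) :
    P.meanPsi θ W = P.sqNorm θ
      - ∑ x : Fin k × Fin m, P.probY θ x.2 * (W x - P.dualOpt θ x) ^ 2 :=
  P.meanPsi_eq_sqNorm_sub (fun j => hμ.trans_le (hP.le_probY θ j))
    (fun a => hp.trans_le (hP.le_probS a)) W

theorem meanPsi_dualOpt (hμ : 0 < μ) (hp : 0 < p) (θ : ModelParam d) :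
    P.meanPsi θ (P.dualOpt θ) = P.sqNorm θ := by
  rw [hP.meanPsi_eq_sub hμ hp]
  simp

theorem meanPsi_le_sqNorm (hμ : 0 < μ) (hp : 0 < p) (θ : ModelParam d) (W : DualVar k m) :
    P.meanPsi θ W ≤ P.sqNorm θ := by
  rw [hP.meanPsi_eq_sub hμ hp]
  exact sub_le_self _ (Finset.sum_nonneg fun x _ =>
    mul_nonneg (hμ.le.trans (hP.le_probY θ x.2)) (sq_nonneg _))

theorem sqNorm_sub_le_meanPsi (hn : 0 < n) (hμ : 0 < μ) (hp : 0 < p) (θ : ModelParam d)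
    (W : DualVar k m) : P.sqNorm θ - ‖W - P.dualOpt θ‖ ^ 2 ≤ P.meanPsi θ W := by
  rw [hP.meanPsi_eq_sub hμ hp, EuclideanSpace.real_norm_sq_eq]
  refine sub_le_sub_left (Finset.sum_le_sum fun x _ => ?_) _
  rw [PiLp.sub_apply]
  exact mul_le_of_le_one_left (sq_nonneg _) (hP.probY_le_one hn θ x.2 hμ.le)

/-- The largest singular value of `Q_θ` is at least `1`; here this shows as the value `1` of
`(1/n) ∑ i, ψ(z_i; θ, W)` at `W_{aj} = √P_s(a)`. -/
theorem one_le_sqNorm (hn : 0 < n) (hμ : 0 < μ) (hp : 0 < p) (θ : ModelParam d) :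
    1 ≤ P.sqNorm θ := by
  refine le_trans (le_of_eq ?_)
    (hP.meanPsi_le_sqNorm hμ hp θ (WithLp.toLp 2 fun x => √(P.probS x.1)))
  rw [meanPsi_eq]
  have h : ∀ x : Fin k × Fin m, (-(P.probY θ x.2 * √(P.probS x.1) ^ 2)
      + 2 * (P.probYS θ x.2 x.1 * (√(P.probS x.1) / √(P.probS x.1))))
      = -(P.probY θ x.2 * P.probS x.1) + 2 * P.probYS θ x.2 x.1 := by
    intro x
    have h1 : 0 < P.probS x.1 := hp.trans_le (hP.le_probS _)
    rw [Real.sq_sqrt h1.le, div_self (Real.sqrt_pos.2 h1).ne', mul_one]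
  rw [Finset.sum_congr rfl fun x _ => h x, Finset.sum_add_distrib, ← Finset.mul_sum,
    hP.sum_probYS hn, Finset.sum_neg_distrib, Fintype.sum_prod_type_right]
  simp only [← Finset.mul_sum, sum_probS P hn, mul_one, hP.sum_probY hn]
  norm_num

theorem inner_gradDual_le (hμ : 0 < μ) (hp : 0 < p) (θ : ModelParam d) (W : DualVar k m) :
    inner ℝ (W - P.dualOpt θ) (batchMean Finset.univ fun i => P.gradDual i θ W)
      ≤ -2 * μ * ‖W - P.dualOpt θ‖ ^ 2 := by
  have hx : ∀ x : Fin k × Fin m, (batchMean Finset.univ fun i => P.gradDual i θ W) x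
      = -2 * P.probY θ x.2 * (W x - P.dualOpt θ x) := by
    intro x
    have h1 : 0 < √(P.probS x.1) := Real.sqrt_pos.2 (hp.trans_le (hP.le_probS _))
    have h2 := hμ.trans_le (hP.le_probY θ x.2)
    have e : (batchMean Finset.univ fun i => P.gradDual i θ W) x
        = -2 * P.probY θ x.2 * W x + P.probYS θ x.2 x.1 * (2 / √(P.probS x.1)) := by
      rw [batchMean_univ_eq, PiLp.smul_apply, WithLp.ofLp_sum, Finset.sum_apply, probY, probYS,
        smul_eq_mul, mul_assoc ((n : ℝ)⁻¹), Finset.sum_mul, Finset.mul_sum, Finset.mul_sum,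
        Finset.mul_sum, Finset.mul_sum, Finset.sum_mul, ← Finset.sum_add_distrib]
      refine Finset.sum_congr rfl fun i _ => ?_
      simp only [gradDual]
      split_ifs <;> ring
    rw [e]
    simp only [dualOpt]
    field_simp
    ring
  rw [PiLp.inner_apply, EuclideanSpace.real_norm_sq_eq, Finset.mul_sum]
  refine Finset.sum_le_sum fun x _ => ?_
  rw [hx, PiLp.sub_apply, RCLike.inner_apply, conj_trivial]
  have := mul_le_mul_of_nonneg_right (hP.le_probY θ x.2) (sq_nonneg (W x - P.dualOpt θ x))
  nlinarith

theorem abs_risk_sub_sub_inner_le (hn : 0 < n) (θ θ' : ModelParam d) :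
    |P.risk θ' - P.risk θ - inner ℝ (P.gradRisk θ) (θ' - θ)| ≤ β * ‖θ' - θ‖ ^ 2 := by
  have hr : ∀ θ, P.risk θ = batchMean Finset.univ fun i => P.lossAt i θ := fun θ => by
    rw [batchMean_univ_eq, risk, smul_eq_mul]
  have : NeZero n := ⟨hn.ne'⟩
  rw [hr, hr, gradRisk, inner_batchMean_left, batchMean_sub, batchMean_sub, ← Real.norm_eq_abs]
  exact norm_batchMean_le Finset.univ_nonempty fun i =>
    abs_sub_sub_inner_gradient_le (hP.loss_diff i) (hP.loss_smooth i) θ θ'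

theorem abs_meanPsi_sub_sub_inner_le (hn : 0 < n) (hp : 0 < p) (θ θ' : ModelParam d)
    {W : DualVar k m} (hW : ‖W‖ ≤ R) :
    |P.meanPsi θ' W - P.meanPsi θ W
      - inner ℝ (batchMean Finset.univ fun i => P.gradPsi i θ W) (θ' - θ)|
      ≤ m * ((k * R ^ 2 + 2 * (R / √p)) * β) * ‖θ' - θ‖ ^ 2 := by
  have : NeZero n := ⟨hn.ne'⟩
  rw [meanPsi, meanPsi, inner_batchMean_left, batchMean_sub, batchMean_sub, ← Real.norm_eq_abs]
  exact norm_batchMean_le Finset.univ_nonempty fun i => hP.abs_psi_sub_sub_inner_le hp i θ θ' hW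

theorem abs_meanPsi_sub_le (hn : 0 < n) (hp : 0 < p) (θ θ' : ModelParam d)
    {W : DualVar k m} (hW : ‖W‖ ≤ R) :
    |P.meanPsi θ' W - P.meanPsi θ W| ≤ m * ((k * R ^ 2 + 2 * (R / √p)) * L) * ‖θ' - θ‖ := by
  have : NeZero n := ⟨hn.ne'⟩
  rw [meanPsi, meanPsi, batchMean_sub, ← Real.norm_eq_abs]
  refine norm_batchMean_le Finset.univ_nonempty fun i => ?_
  rw [psi_eq, psi_eq, ← Finset.sum_sub_distrib]
  refine (norm_sum_le _ _).trans ?_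
  calc _ ≤ ∑ _j : Fin m, (L * ‖θ' - θ‖) * (k * R ^ 2 + 2 * (R / √p)) := by
        refine Finset.sum_le_sum fun j _ => ?_
        rw [← sub_mul, norm_mul]
        exact mul_le_mul ((hP.output_lip i j).norm_sub_le θ' θ) (abs_coef_le hp hP.le_probS hW i j)
          (norm_nonneg _) (by positivity)
    _ = _ := by simp; ring

/-- First-order expansion of `‖Q_θ‖²`: because `dualOpt` is a maximizer that depends Lipschitz
continuously on `θ`, only the explicit dependence on `θ` contributes to first order. -/
theorem abs_sqNorm_sub_sub_inner_le (hn : 0 < n) (hμ : 0 < μ) (hp : 0 < p)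
    (hR : 1 / (μ * √p) ≤ R) (θ θ' : ModelParam d) :
    |P.sqNorm θ' - P.sqNorm θ - inner ℝ (P.gradSqNorm θ) (θ' - θ)|
      ≤ (m * ((k * R ^ 2 + 2 * (R / √p)) * β) + (√(k * m : ℕ) * (2 * L / (μ * √p))) ^ 2)
        * ‖θ' - θ‖ ^ 2 := by
  have hW : ‖P.dualOpt θ‖ ≤ R := (hP.norm_dualOpt_le hn hμ hp θ).trans hR
  have h1 := hP.abs_meanPsi_sub_sub_inner_le hn hp θ θ' hW
  rw [hP.meanPsi_dualOpt hμ hp, ← gradSqNorm] at h1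
  have h2 := hP.sqNorm_sub_le_meanPsi hn hμ hp θ' (P.dualOpt θ)
  have h3 := hP.meanPsi_le_sqNorm hμ hp θ' (P.dualOpt θ)
  have h4 : ‖P.dualOpt θ - P.dualOpt θ'‖ ^ 2
      ≤ (√(k * m : ℕ) * (2 * L / (μ * √p))) ^ 2 * ‖θ' - θ‖ ^ 2 := by
    rw [← mul_pow, norm_sub_rev]
    gcongr
    exact hP.norm_dualOpt_sub_le hn hμ hp θ θ'
  have h5 := abs_le.1 h1
  rw [abs_le, add_mul]
  constructor <;> linarith [sq_nonneg ‖P.dualOpt θ - P.dualOpt θ'‖, h5.1, h5.2]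

theorem sqNorm_sub_le (hn : 0 < n) (hμ : 0 < μ) (hp : 0 < p)
    (hR : 1 / (μ * √p) ≤ R) (θ θ' : ModelParam d) :
    P.sqNorm θ' - P.sqNorm θ ≤ m * ((k * R ^ 2 + 2 * (R / √p)) * L) * ‖θ' - θ‖ := by
  have hW : ‖P.dualOpt θ'‖ ≤ R := (hP.norm_dualOpt_le hn hμ hp θ').trans hR
  have h1 := (abs_le.1 (hP.abs_meanPsi_sub_le hn hp θ θ' hW)).2
  rw [hP.meanPsi_dualOpt hμ hp] at h1
  linarith [hP.meanPsi_le_sqNorm hμ hp θ (P.dualOpt θ')]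

end IsRegular

/-- One constant serves all regular tasks with the same parameters. -/
theorem exists_driftBounds (m k : ℕ) (L β : ℝ≥0) {μ p R : ℝ} (hμ : 0 < μ) (hp : 0 < p)
    (hR : 1 / (μ * √p) ≤ R) : ∃ C : ℝ, 1 ≤ C ∧
      ∀ (X : Type*) (n d : ℕ) (P : FairTask X n m k d), 0 < n → P.IsRegular L β μ p →
        P.DriftBounds C R μ := by
  have hsp : 0 < √p := Real.sqrt_pos.2 hp
  have hR0 : 0 ≤ R := le_trans (by positivity) hR
  obtain ⟨c₁, h₁⟩ : ∃ c : ℝ, c = k * R ^ 2 + 2 * (R / √p) := ⟨_, rfl⟩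
  obtain ⟨c₂, h₂⟩ : ∃ c : ℝ, c = √(k * m : ℕ) * (2 * L / (μ * √p)) := ⟨_, rfl⟩
  obtain ⟨c₃, h₃⟩ : ∃ c : ℝ, c = m * ((k * (2 * R) + 2 / √p) * L) := ⟨_, rfl⟩
  obtain ⟨c₄, h₄⟩ : ∃ c : ℝ, c = √(k * m : ℕ) * (2 * R + 2 / √p) := ⟨_, rfl⟩
  have p₁ : 0 ≤ c₁ := by rw [h₁]; positivity
  have p₂ : 0 ≤ c₂ := by rw [h₂]; positivity
  have p₃ : 0 ≤ c₃ := by rw [h₃]; positivity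
  have p₄ : 0 ≤ c₄ := by rw [h₄]; positivity
  have p₅ : 0 ≤ m * (c₁ * L) := by positivity
  have p₆ : 0 ≤ m * (c₁ * β) + c₂ ^ 2 := by positivity
  obtain ⟨C, hC⟩ : ∃ C : ℝ, C = 1 + c₁ + c₂ + c₃ + c₄ + m * (c₁ * L) + (m * (c₁ * β) + c₂ ^ 2)
    + L + β + 4 * R ^ 2 := ⟨_, rfl⟩
  have pL : 0 ≤ (L : ℝ) := L.2
  have pβ : 0 ≤ (β : ℝ) := β.2
  have pR : 0 ≤ 4 * R ^ 2 := by positivity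
  refine ⟨C, by linarith, fun X n d P hn hP => ?_⟩
  have : NeZero n := ⟨hn.ne'⟩
  have hrisk := hP.abs_risk_sub_sub_inner_le hn
  have hsq := hP.abs_sqNorm_sub_sub_inner_le hn hμ hp hR
  have hWR : ∀ θ, ‖P.dualOpt θ‖ ≤ R := fun θ => (hP.norm_dualOpt_le hn hμ hp θ).trans hR
  rw [← h₁, ← h₂] at hsq
  refine ⟨fun θ θ' => ?_, fun θ => hasGradientAt_of_abs_sub_le_sq (hrisk θ), fun θ θ' => ?_,
    fun θ => hasGradientAt_of_abs_sub_le_sq (hsq θ), fun θ θ' => ?_, hP.one_le_sqNorm hn hμ hp,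
    fun θ θ' => ?_, fun i θ => ?_, fun i θ W hW => ?_, fun i θ W hW => ?_, fun i θ W hW => ?_,
    fun θ W hW => ?_, hP.sqNorm_sub_le_meanPsi hn hμ hp, hP.meanPsi_le_sqNorm hμ hp,
    fun θ W hW => ?_, hP.inner_gradDual_le hμ hp⟩
  · have h := (abs_le.1 (hrisk θ θ')).2
    have : β * ‖θ' - θ‖ ^ 2 ≤ C * ‖θ' - θ‖ ^ 2 := by gcongr; linarith
    linarith
  · have h := (abs_le.1 (hsq θ θ')).2
    have : (m * (c₁ * β) + c₂ ^ 2) * ‖θ' - θ‖ ^ 2 ≤ C * ‖θ' - θ‖ ^ 2 := by gcongr; linarith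
    linarith
  · have a1 := hP.sqNorm_sub_le hn hμ hp hR θ θ'
    have a2 := hP.sqNorm_sub_le hn hμ hp hR θ' θ
    rw [norm_sub_rev] at a2
    rw [← h₁] at a1 a2
    have : m * (c₁ * L) * ‖θ' - θ‖ ≤ C * ‖θ' - θ‖ := by gcongr; linarith
    rw [abs_le]
    constructor <;> linarith
  · refine (hP.norm_dualOpt_sub_le hn hμ hp θ θ').trans ?_
    rw [← h₂]
    gcongr
    linarith
  · exact (norm_gradient_le_of_lipschitz (hP.loss_lip i) θ).trans (by linarith)
  · exact (hP.abs_psi_le hp i θ hW).trans (by linarith)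
  · exact (hP.norm_gradPsi_le hp i θ hW).trans (by rw [← h₁]; linarith)
  · exact (hP.norm_gradDual_le hp i θ hW).trans (by linarith)
  · have h := (norm_sub_le W (P.dualOpt θ)).trans (add_le_add hW (hWR θ))
    calc ‖W - P.dualOpt θ‖ ^ 2 ≤ (R + R) ^ 2 := by gcongr
      _ = 4 * R ^ 2 := by ring
      _ ≤ C := by linarith
  · rw [gradSqNorm, batchMean_sub]
    refine norm_batchMean_le Finset.univ_nonempty fun i => ?_
    refine (hP.norm_gradPsi_sub_le hp i θ hW (hWR θ)).trans ?_
    rw [← h₃]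
    gcongr
    linarith

end FairTask

/-! ### The projection onto a ball -/

theorem norm_projBall_le {E : Type*} [NormedAddCommGroup E] [NormedSpace ℝ E] {R : ℝ} (hR : 0 ≤ R)
    (w : E) : ‖projBall R w‖ ≤ R := by
  rw [projBall]
  split_ifs with h
  · exact h
  · have hw : 0 < ‖w‖ := lt_of_le_of_lt hR (not_le.1 h)
    rw [norm_smul, Real.norm_of_nonneg (by positivity), div_mul_cancel₀ _ hw.ne']

/-- The projection onto a ball does not increase the distance to points of the ball. -/
theorem norm_projBall_sub_le {E : Type*} [NormedAddCommGroup E] [InnerProductSpace ℝ E] {R : ℝ}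
    {u : E} (hu : ‖u‖ ≤ R) (w : E) : ‖projBall R w - u‖ ≤ ‖w - u‖ := by
  have hR : 0 ≤ R := (norm_nonneg u).trans hu
  rw [projBall]
  split_ifs with h
  · exact le_rfl
  · have h' := not_le.1 h
    have hw : 0 < ‖w‖ := lt_of_le_of_lt hR h'
    apply le_of_sq_le_sq _ (norm_nonneg _)
    rw [norm_sub_sq_real, norm_sub_sq_real, norm_smul, real_inner_smul_left,
      Real.norm_of_nonneg (by positivity), div_mul_cancel₀ _ hw.ne']
    have h1 : inner ℝ w u ≤ ‖w‖ * R := (real_inner_le_norm w u).trans (by gcongr)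
    have h2 : 0 ≤ 1 - R / ‖w‖ := by
      rw [sub_nonneg, div_le_one hw]; exact h'.le
    have h3 := mul_le_mul_of_nonneg_left h1 h2
    have h4 : (1 - R / ‖w‖) * (‖w‖ * R) = (‖w‖ - R) * R := by field_simp
    nlinarith [sq_nonneg (‖w‖ - R)]

namespace FairTask

variable {X : Type*} {n m k d : ℕ} {P : FairTask X n m k d}

/-! ### The gradient of the robust objective -/

theorem robustObjective_eq {lam r : ℝ} (hr : 0 ≤ r) {θ : ModelParam d} (hq : 0 < P.sqNorm θ) :
    P.robustObjective lam r θ = P.risk θ + lam * (√(P.sqNorm θ) + r) ^ 2 := by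
  rw [robustObjective, (isGreatest_trace_singularDist_le (P.Q θ) hr hq).csSup_eq, sqNorm]

/-- The gradient of `risk + lam (1 + r α) ‖Q_θ‖² + lam r / α` in `θ`. -/
def gradEnvelope (P : FairTask X n m k d) (lam r : ℝ) (z : SGDAState k m d) : ModelParam d :=
  P.gradRisk z.θ + (lam * (1 + r * z.α)) • P.gradSqNorm z.θ

/-- The squared norm of the gradient of `risk + lam (1 + r α) ‖Q_θ‖² + lam r / α` in `(θ, α)`. -/
def stationarity (P : FairTask X n m k d) (lam r : ℝ) (z : SGDAState k m d) : ℝ :=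
  ‖P.gradEnvelope lam r z‖ ^ 2 + (lam * r * (P.sqNorm z.θ - 1 / z.α ^ 2)) ^ 2

theorem stationarity_nonneg (lam r : ℝ) (z : SGDAState k m d) : 0 ≤ P.stationarity lam r z := by
  unfold stationarity; positivity

variable {C R μ lam r : ℝ}

theorem DriftBounds.hasGradientAt_robustObjective (hb : P.DriftBounds C R μ) (hr : 0 ≤ r)
    (θ : ModelParam d) : HasGradientAt (P.robustObjective lam r)
      (P.gradRisk θ + (lam * (1 + r / √(P.sqNorm θ))) • P.gradSqNorm θ) θ := by
  have hpos : ∀ θ, 0 < P.sqNorm θ := fun θ => one_pos.trans_le (hb.one_le_sqNorm θ)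
  have hf : P.robustObjective lam r = fun θ => P.risk θ + lam * (√(P.sqNorm θ) + r) ^ 2 :=
    funext fun θ => robustObjective_eq hr (hpos θ)
  have hs : √(P.sqNorm θ) ≠ 0 := (Real.sqrt_pos.2 (hpos θ)).ne'
  rw [hf, hasGradientAt_iff_hasFDerivAt, map_add, map_smul]
  have h1 := (hb.hasGradientAt_sqNorm θ).hasFDerivAt
  have h2 := ((((h1.sqrt (hpos θ).ne').add_const r).pow 2).const_mul lam)
  refine ((hb.hasGradientAt_risk θ).hasFDerivAt.add h2).congr_fderiv ?_
  congr 1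
  simp only [Nat.add_one_sub_one, pow_one, smul_smul, nsmul_eq_mul]
  congr 1
  field_simp
  push_cast
  ring

theorem DriftBounds.norm_gradRisk_le (hb : P.DriftBounds C R μ) (hn : 0 < n) (θ : ModelParam d) :
    ‖P.gradRisk θ‖ ≤ C := by
  have : NeZero n := ⟨hn.ne'⟩
  exact norm_batchMean_le Finset.univ_nonempty fun i => hb.norm_gradLoss_le i θ

theorem DriftBounds.norm_gradSqNorm_le (hb : P.DriftBounds C R μ) (hn : 0 < n)
    (hd : ∀ θ, ‖P.dualOpt θ‖ ≤ R) (θ : ModelParam d) : ‖P.gradSqNorm θ‖ ≤ C := by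
  have : NeZero n := ⟨hn.ne'⟩
  exact norm_batchMean_le Finset.univ_nonempty fun i => hb.norm_gradPsi_le i θ _ (hd θ)

/-- The gradient of the robust objective is controlled by the gradient of the envelope function,
at every `α > 0`: for `α ≤ 2` the distance of `α` to its optimal value `1 / ‖Q_θ‖` is controlled
by the partial derivative in `α`; for `α > 2` this partial derivative is bounded below. If
`lam r = 0`, then `α` does not matter, and the division by zero is harmless. -/
theorem DriftBounds.sq_norm_gradient_robustObjective_le (hb : P.DriftBounds C R μ) (hC : 0 ≤ C)
    (hn : 0 < n) (hd : ∀ θ, ‖P.dualOpt θ‖ ≤ R) (hl : 0 ≤ lam) (hr : 0 ≤ r) {z : SGDAState k m d}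
    (hα : 0 < z.α) : ‖gradient (P.robustObjective lam r) z.θ‖ ^ 2
      ≤ 2 * (1 + (2 * C + (C + lam * (1 + r) * C) * (2 / (lam * r))) ^ 2)
        * P.stationarity lam r z := by
  rw [(hb.hasGradientAt_robustObjective hr z.θ).gradient, stationarity]
  have hgr := hb.norm_gradRisk_le hn z.θ
  have hgs := hb.norm_gradSqNorm_le hn hd z.θ
  have hq := hb.one_le_sqNorm z.θ
  obtain ⟨t, ht⟩ : ∃ t, t = √(P.sqNorm z.θ) := ⟨_, rfl⟩
  have ht1 : 1 ≤ t := by rw [ht]; exact Real.one_le_sqrt.2 hq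
  have ht2 : P.sqNorm z.θ = t ^ 2 := by rw [ht, Real.sq_sqrt (by linarith)]
  rw [← ht, ht2]
  obtain ⟨α, hα'⟩ : ∃ α, α = z.α := ⟨_, rfl⟩
  rw [← hα'] at hα ⊢
  obtain ⟨ρ, hρ⟩ : ∃ ρ, ρ = lam * r := ⟨_, rfl⟩
  have hρ0 : 0 ≤ ρ := by rw [hρ]; positivity
  set g := P.gradRisk z.θ + (lam * (1 + r / t)) • P.gradSqNorm z.θ with hg
  set x := ‖P.gradEnvelope lam r z‖ with hx
  rw [← hρ]
  set y := |ρ * (t ^ 2 - 1 / α ^ 2)| with hy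
  have hM : 0 ≤ (C + lam * (1 + r) * C) * (2 / ρ) := by positivity
  suffices h : ‖g‖ ≤ x + (2 * C + (C + lam * (1 + r) * C) * (2 / ρ)) * y by
    have h1 : ‖g‖ ^ 2 ≤ (x + (2 * C + (C + lam * (1 + r) * C) * (2 / ρ)) * y) ^ 2 := by gcongr
    have h2 : (ρ * (t ^ 2 - 1 / α ^ 2)) ^ 2 = y ^ 2 := by rw [hy, sq_abs]
    rw [h2]
    generalize 2 * C + (C + lam * (1 + r) * C) * (2 / ρ) = M at h1
    nlinarith [sq_nonneg (x - M * y), sq_nonneg (M * x), sq_nonneg y]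
  have hx0 : 0 ≤ x := norm_nonneg _
  have hy0 : 0 ≤ y := abs_nonneg _
  have hnear : (ρ = 0 ∨ α ≤ 2) → ‖g‖ ≤ x + 2 * C * y := by
    intro hcase
    have e : g = P.gradEnvelope lam r z + (ρ * (1 / t - α)) • P.gradSqNorm z.θ := by
      rw [hg, gradEnvelope, add_assoc, ← add_smul, ← hα']
      congr 2
      rw [hρ]
      ring
    have h1 : |ρ * (1 / t - α)| ≤ 2 * y := by
      rcases hcase with h0 | h2
      · rw [h0]; simpa using hy0
      · rw [hy, abs_mul, abs_mul, abs_of_nonneg hρ0, mul_left_comm]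
        apply mul_le_mul_of_nonneg_left _ hρ0
        have e1 : 1 / t - α = -((t * α - 1) * (1 / t)) := by field_simp; ring
        have e2 : t ^ 2 - 1 / α ^ 2 = (t * α - 1) * ((t * α + 1) / α ^ 2) := by field_simp; ring
        rw [e1, e2, abs_neg, abs_mul, abs_mul, abs_of_pos (by positivity : 0 < 1 / t),
          abs_of_pos (by positivity : 0 < (t * α + 1) / α ^ 2), mul_left_comm]
        apply mul_le_mul_of_nonneg_left _ (abs_nonneg _)
        rw [← mul_div_assoc, div_le_div_iff₀ (by positivity) (by positivity)]
        nlinarith [mul_nonneg hα.le (by linarith : 0 ≤ 2 - α),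
          mul_nonneg hα.le (by nlinarith : 0 ≤ t ^ 2 - 1)]
    rw [e]
    refine (norm_add_le _ _).trans ?_
    rw [norm_smul, Real.norm_eq_abs]
    have : |ρ * (1 / t - α)| * ‖P.gradSqNorm z.θ‖ ≤ 2 * y * C := by gcongr
    linarith
  by_cases hcase : ρ = 0 ∨ α ≤ 2
  · have := mul_nonneg hM hy0
    linarith [hnear hcase]
  · push Not at hcase
    obtain ⟨h0, h2⟩ := hcase
    have hρ1 : 0 < ρ := lt_of_le_of_ne hρ0 (Ne.symm h0)
    have h3 : ‖g‖ ≤ C + lam * (1 + r) * C := by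
      refine (norm_add_le _ _).trans ?_
      rw [norm_smul, Real.norm_of_nonneg (by positivity)]
      gcongr
      rw [div_le_iff₀ (by positivity)]
      nlinarith
    have h4 : 1 ≤ 2 / ρ * y := by
      have h5 : 1 / α ^ 2 ≤ 1 / 4 := by
        gcongr
        nlinarith
      have h6 : ρ * (1 / 2) ≤ y := by
        refine le_trans ?_ (le_abs_self _)
        gcongr
        nlinarith
      calc (1 : ℝ) = 2 / ρ * (ρ * (1 / 2)) := by field_simp
        _ ≤ _ := by gcongr
    have h7 : C + lam * (1 + r) * C ≤ (C + lam * (1 + r) * C) * (2 / ρ * y) :=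
      le_mul_of_one_le_right (by positivity) h4
    have h8 : 0 ≤ 2 * C * y := by positivity
    linarith

end FairTask

namespace FairTask

variable {X : Type*} {n m k d : ℕ} {P : FairTask X n m k d}

/-! ### One iteration of the algorithm -/

/-- The mini-batch gradient in `θ`. -/
def batchGradParam (P : FairTask X n m k d) (lam r : ℝ) (B : Finset (Fin n))
    (z : SGDAState k m d) : ModelParam d :=
  batchMean B fun i => gradient (P.lossAt i) z.θ + (lam * (1 + r * z.α)) • P.gradPsi i z.θ z.W

/-- The mini-batch average of `ψ(z_i; θ, W)`. -/
def batchPsi (P : FairTask X n m k d) (B : Finset (Fin n)) (z : SGDAState k m d) : ℝ :=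
  batchMean B fun i => P.psi i z.θ z.W

/-- The mini-batch gradient in `W`, without the factor `lam (1 + r α)`. -/
def batchGradDual (P : FairTask X n m k d) (B : Finset (Fin n)) (z : SGDAState k m d) :
    DualVar k m :=
  batchMean B fun i => P.gradDual i z.θ z.W

theorem sgdaStep_θ (hF : ∀ i j, Differentiable ℝ (P.outputAt i j)) (lam r R ηx ηW : ℝ)
    (B : Finset (Fin n)) (z : SGDAState k m d) :
    (P.sgdaStep lam r R ηx ηW B z).θ = z.θ - ηx • P.batchGradParam lam r B z := by
  simp only [sgdaStep, batchGradParam, batchMean, gradient_psi_param P (hF _)]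

theorem sgdaStep_α (lam r R ηx ηW : ℝ) (B : Finset (Fin n)) (z : SGDAState k m d) :
    (P.sgdaStep lam r R ηx ηW B z).α
      = z.α + -(ηx * (lam * r) * (P.batchPsi B z - 1 / z.α ^ 2)) := by
  simp only [sgdaStep, batchPsi, batchMean, smul_eq_mul]
  ring

theorem sgdaStep_W (lam r R ηx ηW : ℝ) (B : Finset (Fin n)) (z : SGDAState k m d) :
    (P.sgdaStep lam r R ηx ηW B z).W
      = projBall R (z.W + ηW • ((lam * (1 + r * z.α)) • P.batchGradDual B z)) := by
  simp only [sgdaStep, batchGradDual, batchMean, gradient_psi_dual]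

/-- Relations between the parameters of the problem and the constants of the analysis: `c` is the
constant of `DriftBounds`, `lo` is the lower bound that the iterates keep `α` above, and `C`
dominates everything else. -/
structure StepConstants (c lo C μ lam r R R' : ℝ) : Prop where
  one_le : 1 ≤ c
  mu_pos : 0 < μ
  lo_pos : 0 < lo
  lam_nonneg : 0 ≤ lam
  r_nonneg : 0 ≤ r
  radius_nonneg : 0 ≤ R
  radius_le : R ≤ R'
  lo_small : c * (4 * lo ^ 2) ≤ 1
  inv_lo_le : lo⁻¹ ≤ C
  grad_le : c * (1 + lam) ≤ C
  dual_le : c + 1 / lo ^ 2 ≤ C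
  lam_le : lam ≤ C
  r_le : r ≤ C
  inv_mu_le : μ⁻¹ ≤ C

/-- The almost sure constraints on the iterates. `R'` may exceed the radius of the ball that the
algorithm projects to, because the initial dual variable need not lie in that ball. -/
structure Admissible (lo hi R' : ℝ) (z : SGDAState k m d) : Prop where
  lo_le : lo ≤ z.α
  le_hi : z.α ≤ hi
  norm_le : ‖z.W‖ ≤ R'

variable {c lo hi C μ lam r R R' ηx ηW κ s : ℝ}

theorem StepConstants.le_C (hc : StepConstants c lo C μ lam r R R') : c ≤ C := by
  have := hc.grad_le
  nlinarith [hc.one_le, hc.lam_nonneg]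

theorem abs_batchPsi_le (hb : P.DriftBounds c R' μ) {B : Finset (Fin n)} (hB : B.Nonempty)
    {z : SGDAState k m d} (hz : ‖z.W‖ ≤ R') : |P.batchPsi B z| ≤ c := by
  rw [← Real.norm_eq_abs]
  exact norm_batchMean_le hB fun i => hb.abs_psi_le i z.θ z.W hz

theorem abs_alpha_step_le (hc : StepConstants c lo C μ lam r R R') (hb : P.DriftBounds c R' μ)
    (hη : 0 ≤ ηx) {B : Finset (Fin n)} (hB : B.Nonempty) {z : SGDAState k m d}
    (hz : Admissible lo hi R' z) :
    |-(ηx * (lam * r) * (P.batchPsi B z - 1 / z.α ^ 2))| ≤ ηx * (lam * r) * C := by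
  have hl := hc.lam_nonneg
  have hr := hc.r_nonneg
  have hlo := hc.lo_pos
  have hα : 0 < z.α := hlo.trans_le hz.lo_le
  rw [abs_neg, abs_mul, abs_of_nonneg (by positivity)]
  gcongr
  refine le_trans ?_ hc.dual_le
  refine (abs_sub _ _).trans (add_le_add (abs_batchPsi_le hb hB hz.norm_le) ?_)
  rw [abs_of_nonneg (by positivity)]
  have := hz.lo_le
  gcongr

/-- The constraints are kept by one step, up to a small increase of the upper bound for `α`: the
barrier `1 / α²` prevents `α` from falling below `lo`. -/
theorem admissible_sgdaStep (hc : StepConstants c lo C μ lam r R R') (hb : P.DriftBounds c R' μ)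
    (hη : 0 ≤ ηx) (hη1 : ηx * (lam * r) * c ≤ lo) {B : Finset (Fin n)} (hB : B.Nonempty)
    {z : SGDAState k m d} (hz : Admissible lo hi R' z) :
    Admissible lo (hi + ηx * (lam * r) * C) R' (P.sgdaStep lam r R ηx ηW B z) := by
  have hl := hc.lam_nonneg
  have hr := hc.r_nonneg
  have hlo := hc.lo_pos
  have hα : 0 < z.α := hlo.trans_le hz.lo_le
  refine ⟨?_, ?_, ?_⟩
  · rw [sgdaStep_α]
    have h1 := (abs_le.1 (abs_batchPsi_le hb hB hz.norm_le)).2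
    have hρ : 0 ≤ ηx * (lam * r) := by positivity
    by_cases h : z.α ≤ 2 * lo
    · -- the barrier `1 / α²` dominates
      have h2 : c ≤ 1 / z.α ^ 2 := by
        rw [le_div_iff₀ (by positivity)]
        have : z.α ^ 2 ≤ 4 * lo ^ 2 := by nlinarith
        nlinarith [hc.lo_small, hc.one_le]
      have h3 : ηx * (lam * r) * (P.batchPsi B z - 1 / z.α ^ 2) ≤ 0 :=
        mul_nonpos_of_nonneg_of_nonpos hρ (by linarith)
      linarith [hz.lo_le]
    · have h2 : 0 ≤ 1 / z.α ^ 2 := by positivity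
      have h3 : ηx * (lam * r) * (P.batchPsi B z - 1 / z.α ^ 2) ≤ ηx * (lam * r) * c :=
        mul_le_mul_of_nonneg_left (by linarith) hρ
      linarith
  · rw [sgdaStep_α]
    have := (abs_le.1 (abs_alpha_step_le hc hb hη hB hz)).2
    linarith [hz.le_hi]
  · rw [sgdaStep_W]
    exact (norm_projBall_le hc.radius_nonneg _).trans hc.radius_le

/-- The Lyapunov function: the envelope function, the squared distance to the optimal dual
variable, and a small multiple of `α⁴` whose dissipation compensates the growth of the noise
with `α`. -/
def lyapunov (P : FairTask X n m k d) (lam r κ s : ℝ) (z : SGDAState k m d) : ℝ :=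
  P.risk z.θ + lam * (1 + r * z.α) * P.sqNorm z.θ + lam * r / z.α
    + κ * (lam * (1 + r * z.α) * ‖z.W - P.dualOpt z.θ‖ ^ 2) + s * z.α ^ 4

/-- Change of the Lyapunov function under one step with a fixed batch. -/
theorem lyapunov_sgdaStep_le (hc : StepConstants c lo C μ lam r R R') (hb : P.DriftBounds c R' μ)
    (hF : ∀ i j, Differentiable ℝ (P.outputAt i j)) (hd : ∀ θ, ‖P.dualOpt θ‖ ≤ R)
    (hη : 0 ≤ ηx) (hηW : 0 < ηW) (hηle : ηx ≤ ηW) (hηW1 : ηW ≤ 1)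
    (hη1 : ηx * (lam * r) * c ≤ lo) (hη2 : ηx * (lam * r * C) ≤ 1) (hκ : 0 ≤ κ) (hs : 0 ≤ s)
    {B : Finset (Fin n)} (hB : B.Nonempty)
    {z : SGDAState k m d} (hz : Admissible lo hi R' z) :
    P.lyapunov lam r κ s (P.sgdaStep lam r R ηx ηW B z)
      ≤ P.lyapunov lam r κ s z
        - ηx * inner ℝ (P.gradEnvelope lam r z) (P.batchGradParam lam r B z)
        - ηx * (lam * r) * (lam * r * (P.sqNorm z.θ - 1 / z.α ^ 2) + 4 * s * z.α ^ 3)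
          * (P.batchPsi B z - 1 / z.α ^ 2)
        + κ * (2 * ηW * (lam * (1 + r * z.α)) ^ 2
            * inner ℝ (z.W - P.dualOpt z.θ) (P.batchGradDual B z)
          + μ * ηW * (lam * (1 + r * z.α)) ^ 2 * ‖z.W - P.dualOpt z.θ‖ ^ 2
          + 3 * C * r ^ 2 * lam ^ 2 * ηx * ‖z.W - P.dualOpt z.θ‖ ^ 2
          + 11 * C ^ 9 * (ηx ^ 2 / ηW + ηW ^ 2) * (1 + r * z.α) ^ 3)
        + 4 * C ^ 11 * ηx ^ 2 * (1 + r * z.α) ^ 3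
        + s * (ηx * (lam * r) * C * (8 * z.α ^ 2 + 3)) := by
  have hl := hc.lam_nonneg
  have hr := hc.r_nonneg
  have hlo := hc.lo_pos
  have hα : 0 < z.α := hlo.trans_le hz.lo_le
  have hcC := hc.le_C
  have hc0 : 0 ≤ c := by linarith [hc.one_le]
  have hC : 1 ≤ C := hc.one_le.trans hcC
  have hC0 : 0 < C := by linarith
  have ha : 1 ≤ 1 + r * z.α := by nlinarith [mul_nonneg hr hα.le]
  have hz' := admissible_sgdaStep (ηW := ηW) hc hb hη hη1 hB hz
  have hCα : ∀ {α : ℝ}, lo ≤ α → C⁻¹ ≤ α := fun h =>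
    (inv_le_of_inv_le₀ hlo hc.inv_lo_le).trans h
  have hθ := sgdaStep_θ hF lam r R ηx ηW B z
  have hα' := sgdaStep_α (P := P) lam r R ηx ηW B z
  have hW' := sgdaStep_W (P := P) lam r R ηx ηW B z
  have hy := abs_alpha_step_le hc hb hη hB hz
  set z' := P.sgdaStep lam r R ηx ηW B z with hz'def
  set y := -(ηx * (lam * r) * (P.batchPsi B z - 1 / z.α ^ 2)) with hydef
  have hdθ : z'.θ - z.θ = -(ηx • P.batchGradParam lam r B z) := by rw [hθ]; abel
  have hg : ‖P.batchGradParam lam r B z‖ ≤ C * (1 + r * z.α) := by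
    have h1 : ‖P.batchGradParam lam r B z‖ ≤ c + lam * (1 + r * z.α) * c := by
      refine norm_batchMean_le hB fun i => (norm_add_le _ _).trans ?_
      rw [norm_smul, Real.norm_of_nonneg (by positivity)]
      gcongr
      · exact hb.norm_gradLoss_le i z.θ
      · exact hb.norm_gradPsi_le i z.θ z.W hz.norm_le
    calc _ ≤ c + lam * (1 + r * z.α) * c := h1
      _ ≤ c * (1 + r * z.α) + lam * (1 + r * z.α) * c := by
          gcongr
          exact le_mul_of_one_le_right hc0 ha
      _ = c * (1 + lam) * (1 + r * z.α) := by ring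
      _ ≤ _ := by gcongr; exact hc.grad_le
  have hN : ‖z'.θ - z.θ‖ ≤ ηx * (C * (1 + r * z.α)) := by
    rw [hdθ, norm_neg, norm_smul, Real.norm_of_nonneg hη]
    gcongr
  have hN0 := norm_nonneg (z'.θ - z.θ)
  have henv := envelope_step_le (h := P.risk z.θ) (h' := P.risk z'.θ) (q := P.sqNorm z.θ)
    (q' := P.sqNorm z'.θ) (u := inner ℝ (P.gradRisk z.θ) (z'.θ - z.θ))
    (v := inner ℝ (P.gradSqNorm z.θ) (z'.θ - z.θ)) hC hl hc.lam_le hr hc.r_le hη (hCα hz.lo_le)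
    (hCα hz'.lo_le) hα' hN0 hN hy
    ((hb.risk_le z.θ z'.θ).trans (by gcongr)) ((hb.sqNorm_le z.θ z'.θ).trans (by gcongr))
    ((hb.abs_sqNorm_sub_le z.θ z'.θ).trans (by gcongr))
  have hdual := dual_step_le (W := z.W) (W' := z'.W) (Ws := P.dualOpt z.θ)
    (Ws' := P.dualOpt z'.θ) (v := P.batchGradDual B z) hC hc.mu_pos hc.inv_mu_le hl hc.lam_le hr
    hc.r_le hη hηW hηle hηW1 hα.le hα' hy
    ((norm_batchMean_le hB fun i => hb.norm_gradDual_le i z.θ z.W hz.norm_le).trans hcC)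
    (by rw [hW']; exact norm_projBall_sub_le (hd z.θ) _)
    ((hb.norm_dualOpt_sub_le z.θ z'.θ).trans (by
      calc c * ‖z'.θ - z.θ‖ ≤ C * (ηx * (C * (1 + r * z.α))) := by gcongr
        _ = _ := by ring))
  have hquart := fourth_power_step_le (α := z.α) hC hl hr hη hη2 hy
  have e1 : inner ℝ (P.gradRisk z.θ) (z'.θ - z.θ)
      + lam * (1 + r * z.α) * inner ℝ (P.gradSqNorm z.θ) (z'.θ - z.θ)
      = -(ηx * inner ℝ (P.gradEnvelope lam r z) (P.batchGradParam lam r B z)) := by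
    rw [gradEnvelope, hdθ, inner_neg_right, inner_neg_right, inner_smul_right, inner_smul_right,
      inner_add_left, real_inner_smul_left]
    ring
  have e2 : lam * r * (P.sqNorm z.θ - 1 / z.α ^ 2) * y + 4 * s * z.α ^ 3 * y
      = -(ηx * (lam * r) * (lam * r * (P.sqNorm z.θ - 1 / z.α ^ 2) + 4 * s * z.α ^ 3)
          * (P.batchPsi B z - 1 / z.α ^ 2)) := by
    rw [hydef]; ring
  have hκd := mul_le_mul_of_nonneg_left hdual hκ
  have hsq := mul_le_mul_of_nonneg_left hquart hs
  rw [← hα'] at hsq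
  rw [e1] at henv
  unfold lyapunov
  have e3 : s * (z.α ^ 4 + 4 * z.α ^ 3 * y + ηx * (lam * r) * C * (8 * z.α ^ 2 + 3))
      = s * z.α ^ 4 + 4 * s * z.α ^ 3 * y + s * (ηx * (lam * r) * C * (8 * z.α ^ 2 + 3)) := by ring
  rw [e3] at hsq
  linarith

end FairTask

/-! ### Averages over batches and the expected decrease -/

/-- The average of `f` over all batches of `b` elements. -/
def batchAvg {n : ℕ} (b : ℕ) (f : Finset (Fin n) → ℝ) : ℝ :=
  ∑ B ∈ Finset.powersetCard b Finset.univ, ((n.choose b : ℕ) : ℝ)⁻¹ * f B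

theorem batchAvg_add {n b : ℕ} (f g : Finset (Fin n) → ℝ) :
    batchAvg b (fun B => f B + g B) = batchAvg b f + batchAvg b g := by
  simp only [batchAvg, mul_add, Finset.sum_add_distrib]

theorem batchAvg_const_mul {n b : ℕ} (c : ℝ) (f : Finset (Fin n) → ℝ) :
    batchAvg b (fun B => c * f B) = c * batchAvg b f := by
  simp only [batchAvg, Finset.mul_sum]
  exact Finset.sum_congr rfl fun B _ => by ring

theorem batchAvg_const {n b : ℕ} (hbn : b ≤ n) (c : ℝ) :
    batchAvg b (fun _ : Finset (Fin n) => c) = c := by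
  have : ((n.choose b : ℕ) : ℝ) ≠ 0 := by exact_mod_cast (Nat.choose_pos hbn).ne'
  simp [batchAvg, Finset.card_powersetCard, this]

theorem batchAvg_mono {n b : ℕ} {f g : Finset (Fin n) → ℝ} (h : ∀ B, B.card = b → f B ≤ g B) :
    batchAvg b f ≤ batchAvg b g :=
  Finset.sum_le_sum fun B hB =>
    mul_le_mul_of_nonneg_left (h B (Finset.mem_powersetCard.1 hB).2) (by positivity)

theorem batchAvg_batchMean {n b : ℕ} (hb : 1 ≤ b) (hbn : b ≤ n) (f : Fin n → ℝ) :
    batchAvg b (fun B => batchMean B f) = batchMean Finset.univ f :=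
  sum_powersetCard_batchMean hb hbn f

theorem batchAvg_inner_batchMean {n b : ℕ} {E : Type*} [NormedAddCommGroup E]
    [InnerProductSpace ℝ E] (hb : 1 ≤ b) (hbn : b ≤ n) (v : E) (f : Fin n → E) :
    batchAvg b (fun B => inner ℝ v (batchMean B f)) = inner ℝ v (batchMean Finset.univ f) := by
  rw [← sum_powersetCard_batchMean hb hbn f, inner_sum]
  exact Finset.sum_congr rfl fun B _ => by rw [inner_smul_right]

namespace FairTask

variable {X : Type*} {n m k d : ℕ} {P : FairTask X n m k d}
variable {c lo hi C μ lam r R R' ηx ηW κ s : ℝ}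

/-- The choice of step sizes and weights under which the expected Lyapunov function decreases.
`K`, `s₀`, `ν` are independent of the accuracy `ε`. -/
structure StepSizes (c lo hi C μ lam r : ℝ) (K A C₃ C₄ C₅ ν s₀ ε ηx ηW : ℝ) : Prop where
  ηx_pos : 0 < ηx
  ηW_pos : 0 < ηW
  ηx_le : ηx ≤ ηW
  ηW_le : ηW ≤ 1
  ηx_lo : ηx * (lam * r) * c ≤ lo
  ηx_C : ηx * (lam * r * C) ≤ 1
  K_nonneg : 0 ≤ K
  A_nonneg : 0 ≤ A
  s₀_nonneg : 0 ≤ s₀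
  ν_nonneg : 0 ≤ ν
  s_hi : s₀ * ε ^ 2 * hi ≤ A
  le_K : C ^ 3 + 4 * A * C₃ ≤ 2 * μ * K
  ratio : 3 * C * r ^ 2 * ηx ≤ μ * ηW
  noise : 4 * C ^ 11 * ηx + 11 * K * C ^ 9 * (ηx ^ 2 / ηW ^ 2 + ηW) ≤ ν * ε ^ 2
  ν_C₄ : ν * C₄ ≤ s₀
  ν_C₅ : ν * C₅ ≤ 2 * s₀

/-- Expected decrease of the Lyapunov function in one iteration. -/
theorem batchAvg_lyapunov_le {K A C₃ C₄ C₅ ν s₀ ε : ℝ}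
    (hc : StepConstants c lo C μ lam r R R') (hb : P.DriftBounds c R' μ)
    (hF : ∀ i j, Differentiable ℝ (P.outputAt i j)) (hd : ∀ θ, ‖P.dualOpt θ‖ ≤ R)
    (hst : StepSizes c lo hi C μ lam r K A C₃ C₄ C₅ ν s₀ ε ηx ηW)
    {b : ℕ} (hb1 : 1 ≤ b) (hbn : b ≤ n) {z : SGDAState k m d} (hz : Admissible lo hi R' z)
    (hα2 : lam * r * z.α ^ 2 ≤ C₃ * (lam * (1 + r * z.α)) ^ 2)
    (ha3 : (1 + r * z.α) ^ 3 ≤ C₄ + C₅ * (lam * r * z.α ^ 3)) :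
    batchAvg b (fun B => P.lyapunov lam r (K * ηx / ηW) (s₀ * ε ^ 2)
        (P.sgdaStep lam r R ηx ηW B z))
      ≤ P.lyapunov lam r (K * ηx / ηW) (s₀ * ε ^ 2) z
        - ηx / 2 * P.stationarity lam r z + ηx * ε ^ 2 * (524 * s₀ * C ^ 5) := by
  have hl := hc.lam_nonneg
  have hr := hc.r_nonneg
  have hlo := hc.lo_pos
  have hα : 0 < z.α := hlo.trans_le hz.lo_le
  have hcC := hc.le_C
  have hc0 : 0 ≤ c := by linarith [hc.one_le]
  have hC : 1 ≤ C := hc.one_le.trans hcC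
  have hC0 : 0 < C := by linarith
  have ha : 1 ≤ 1 + r * z.α := by nlinarith [mul_nonneg hr hα.le]
  have hη := hst.ηx_pos
  have hηW := hst.ηW_pos
  have hs₀ := hst.s₀_nonneg
  have hs : 0 ≤ s₀ * ε ^ 2 := by positivity
  have hκ : 0 ≤ K * ηx / ηW := by have := hst.K_nonneg; positivity
  set κ := K * ηx / ηW with hκdef
  set s := s₀ * ε ^ 2 with hsdef
  -- the averaged mini-batch quantities
  have hmean : (batchMean Finset.univ fun i =>
      gradient (P.lossAt i) z.θ + (lam * (1 + r * z.α)) • P.gradPsi i z.θ z.W)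
      = P.gradRisk z.θ + (lam * (1 + r * z.α)) •
        batchMean Finset.univ fun i => P.gradPsi i z.θ z.W := by
    rw [gradRisk, batchMean, batchMean, batchMean, Finset.sum_add_distrib, smul_add,
      ← Finset.smul_sum, smul_comm]
  set G := P.gradEnvelope lam r z with hG
  set T := batchMean Finset.univ fun i => P.gradPsi i z.θ z.W with hT
  set W₀ := z.W - P.dualOpt z.θ with hW₀
  have hI : ‖G‖ ^ 2 / 2 - (lam * (1 + r * z.α) * (c * ‖W₀‖)) ^ 2 / 2
      ≤ inner ℝ G (P.gradRisk z.θ + (lam * (1 + r * z.α)) • T) := by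
    set g := P.gradRisk z.θ + (lam * (1 + r * z.α)) • T with hg
    have h1 : ‖g - G‖ ≤ lam * (1 + r * z.α) * (c * ‖W₀‖) := by
      have : g - G = (lam * (1 + r * z.α)) • (T - P.gradSqNorm z.θ) := by
        rw [hg, hG, gradEnvelope, smul_sub]; abel
      rw [this, norm_smul, Real.norm_of_nonneg (by positivity)]
      gcongr
      exact hb.norm_gradPsi_sub_le z.θ z.W hz.norm_le
    have h2 : ‖g - G‖ ^ 2 ≤ (lam * (1 + r * z.α) * (c * ‖W₀‖)) ^ 2 := by gcongr
    rw [norm_sub_sq_real, real_inner_comm] at h2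
    nlinarith [sq_nonneg ‖g‖]
  have hI' : ‖G‖ ^ 2 / 2 - (lam * (1 + r * z.α) * (C * ‖W₀‖)) ^ 2 / 2
      ≤ inner ℝ G (P.gradRisk z.θ + (lam * (1 + r * z.α)) • T) := by
    refine le_trans ?_ hI
    gcongr
  have hJ := hb.inner_gradDual_le z.θ z.W
  rw [← hW₀] at hJ
  have hρ0 : 0 ≤ lam * r := by positivity
  have hρC : lam * r ≤ C ^ 2 := by
    rw [sq]
    exact mul_le_mul hc.lam_le hc.r_le hr hC0.le
  have hρl : lam * r ≤ C * (lam * (1 + r * z.α)) := by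
    calc lam * r ≤ lam * C := by gcongr; exact hc.r_le
      _ = C * (lam * 1) := by ring
      _ ≤ _ := by gcongr
  have hdrift := drift_le (C₃ := C₃) (C₄ := C₄) (C₅ := C₅) (A := A) (ν := ν) (r := r)
    (a := 1 + r * z.α) (ρ := lam * r)
    (s := s) (q := P.sqNorm z.θ) (Ψ := P.meanPsi z.θ z.W) (X := ‖W₀‖) hC hc.mu_pos hl
    hρ0 hρC hρl ha hη hηW hα hs₀ hsdef hI' hJ (hb.le_meanPsi z.θ z.W) (hb.meanPsi_le z.θ z.W)
    ((hb.norm_sub_dualOpt_sq_le z.θ z.W hz.norm_le).trans hcC) (hb.one_le_sqNorm z.θ)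
    hst.A_nonneg ((mul_le_mul_of_nonneg_left hz.le_hi hs).trans hst.s_hi) hα2 hst.K_nonneg
    hst.le_K hst.ratio hst.noise ha3 hst.ν_nonneg hst.ν_C₄ hst.ν_C₅
  -- average the single-batch estimate
  set E₁ := μ * ηW * (lam * (1 + r * z.α)) ^ 2 * ‖W₀‖ ^ 2
    + 3 * C * r ^ 2 * lam ^ 2 * ηx * ‖W₀‖ ^ 2
    + 11 * C ^ 9 * (ηx ^ 2 / ηW + ηW ^ 2) * (1 + r * z.α) ^ 3 with hE₁
  set E₂ := 4 * C ^ 11 * ηx ^ 2 * (1 + r * z.α) ^ 3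
    + s * (ηx * (lam * r) * C * (8 * z.α ^ 2 + 3)) with hE₂
  set D₁ := ηx * (lam * r) * (lam * r * (P.sqNorm z.θ - 1 / z.α ^ 2) + 4 * s * z.α ^ 3) with hD₁
  set D₂ := κ * (2 * ηW * (lam * (1 + r * z.α)) ^ 2) with hD₂
  have hstep : ∀ B : Finset (Fin n), B.card = b →
      P.lyapunov lam r κ s (P.sgdaStep lam r R ηx ηW B z)
        ≤ (P.lyapunov lam r κ s z + D₁ * (1 / z.α ^ 2) + κ * E₁ + E₂)
          + (-ηx * inner ℝ G (P.batchGradParam lam r B z)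
            + (-D₁ * P.batchPsi B z + D₂ * inner ℝ W₀ (P.batchGradDual B z))) := by
    intro B hB
    have hBne : B.Nonempty := Finset.card_pos.1 (by omega)
    refine (lyapunov_sgdaStep_le hc hb hF hd hη.le hηW hst.ηx_le hst.ηW_le hst.ηx_lo hst.ηx_C
      hκ hs hBne hz).trans (le_of_eq ?_)
    rw [hE₁, hE₂, hD₁, hD₂, ← hG, ← hW₀]
    ring
  obtain ⟨M, hM⟩ : ∃ M, M = P.lyapunov lam r κ s z + D₁ * (1 / z.α ^ 2) + κ * E₁ + E₂ := ⟨_, rfl⟩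
  rw [← hM] at hstep
  refine (batchAvg_mono hstep).trans ?_
  rw [batchAvg_add, batchAvg_add, batchAvg_add, batchAvg_const hbn, batchAvg_const_mul,
    batchAvg_const_mul, batchAvg_const_mul, hM]
  simp only [batchGradParam, batchPsi, batchGradDual]
  rw [batchAvg_inner_batchMean hb1 hbn, batchAvg_inner_batchMean hb1 hbn,
    batchAvg_batchMean hb1 hbn, hmean, ← meanPsi, stationarity, ← hG]
  set I := inner ℝ G (P.gradRisk z.θ + (lam * (1 + r * z.α)) • T) with hIdef
  set J := inner ℝ W₀ (batchMean Finset.univ fun i => P.gradDual i z.θ z.W) with hJdef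
  have e : K * ηx / ηW * (2 * ηW * (lam * (1 + r * z.α)) ^ 2 * J
        + μ * ηW * (lam * (1 + r * z.α)) ^ 2 * ‖W₀‖ ^ 2
        + 3 * C * r ^ 2 * lam ^ 2 * ηx * ‖W₀‖ ^ 2
        + 11 * C ^ 9 * (ηx ^ 2 / ηW + ηW ^ 2) * (1 + r * z.α) ^ 3)
      = D₂ * J + κ * E₁ := by
    rw [hD₂, hE₁, hκdef]; ring
  rw [e] at hdrift
  linarith

end FairTask

/-! ### Expectations along the random iterates -/

namespace IsUniformBatches

variable {Ω : Type*} [MeasurableSpace Ω] {n b : ℕ} {Pr : Measure Ω}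
  {B : ℕ → Ω → Finset (Fin n)}

theorem measurable_batch (hB : IsUniformBatches Pr b B) (t : ℕ) :
    Measurable[_, (⊤ : MeasurableSpace (Finset (Fin n)))] (B t) := by
  let _ : MeasurableSpace (Finset (Fin n)) := ⊤
  exact measurable_to_countable' fun A => hB.measurable t A

theorem ae_card_eq [IsProbabilityMeasure Pr] (hB : IsUniformBatches Pr b B) (hbn : b ≤ n)
    (t : ℕ) : ∀ᵐ ω ∂Pr, (B t ω).card = b := by
  have h1 : MeasurableSet {ω | (B t ω).card = b} := by
    have : {ω | (B t ω).card = b}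
        = ⋃ A ∈ Finset.powersetCard b (Finset.univ : Finset (Fin n)), {ω | B t ω = A} := by
      ext ω; simp
    rw [this]
    exact Finset.measurableSet_biUnion _ fun A _ => hB.measurable t A
  have h2 : Pr {ω | (B t ω).card = b} = 1 := by
    have : {ω | (B t ω).card = b}
        = ⋃ A ∈ Finset.powersetCard b (Finset.univ : Finset (Fin n)), {ω | B t ω = A} := by
      ext ω; simp
    rw [this, measure_biUnion_finset]
    · rw [Finset.sum_congr rfl fun A hA => hB.uniform t A (Finset.mem_powersetCard.1 hA).2]
      simp only [Finset.sum_const, Finset.card_powersetCard, Finset.card_univ, Fintype.card_fin,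
        nsmul_eq_mul]
      exact ENNReal.mul_inv_cancel (by exact_mod_cast (Nat.choose_pos hbn).ne') (by simp)
    · intro A _ A' _ hAA
      rw [Function.onFun, Set.disjoint_left]
      intro ω h h'
      exact hAA (h.symm.trans h')
    · exact fun A _ => hB.measurable t A
  exact (prob_compl_eq_zero_iff h1).2 h2

end IsUniformBatches

namespace FairTask

variable {X : Type*} {n m k d : ℕ} {P : FairTask X n m k d}

/-- The iterate at time `t` as a function of the batches before `t`. -/
theorem exists_sgda_eq (lam r R ηx ηW : ℝ) (z₀ : SGDAState k m d) (t : ℕ) :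
    ∃ g : (Finset.range t → Finset (Fin n)) → SGDAState k m d, ∀ B : ℕ → Finset (Fin n),
      P.sgda lam r R ηx ηW z₀ B t = g fun i => B i := by
  induction t with
  | zero => exact ⟨fun _ => z₀, fun B => rfl⟩
  | succ t ih =>
    obtain ⟨g, hg⟩ := ih
    refine ⟨fun h => P.sgdaStep lam r R ηx ηW (h ⟨t, by simp⟩)
      (g fun i => h ⟨i, by have := i.2; simp only [Finset.mem_range] at this ⊢; omega⟩), ?_⟩
    intro B
    rw [sgda, hg]

variable {Ω : Type*} [MeasurableSpace Ω] {b : ℕ} {Pr : Measure Ω} [IsProbabilityMeasure Pr]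
  {B : ℕ → Ω → Finset (Fin n)}

/-- Every function of an iterate is integrable, because the batches take finitely many values. -/
theorem integrable_comp_sgda (hB : IsUniformBatches Pr b B) (lam r R ηx ηW : ℝ)
    (z₀ : SGDAState k m d) (t : ℕ) (φ : SGDAState k m d → ℝ) :
    Integrable (fun ω => φ (P.sgda lam r R ηx ηW z₀ (fun u => B u ω) t)) Pr := by
  let _ : MeasurableSpace (Finset (Fin n)) := ⊤
  have : DiscreteMeasurableSpace (Finset (Fin n)) := ⟨fun _ => trivial⟩
  obtain ⟨g, hg⟩ := exists_sgda_eq (P := P) lam r R ηx ηW z₀ t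
  simp only [hg]
  have hH : Measurable fun ω => (fun i : Finset.range t => B i ω) :=
    measurable_pi_lambda _ fun i => hB.measurable_batch i
  have : IsFiniteMeasure (Measure.map (fun ω => (fun i : Finset.range t => B i ω)) Pr) :=
    Measure.isFiniteMeasure_map _ _
  exact (Integrable.of_finite (f := fun h => φ (g h))).comp_measurable hH

/-- The expectation of a function of the next iterate is the expectation of its average over the
batches, because the batch is independent of the current iterate. -/
theorem integral_sgda_succ (hB : IsUniformBatches Pr b B) (hbn : b ≤ n) (lam r R ηx ηW : ℝ)
    (z₀ : SGDAState k m d) (t : ℕ) (φ : SGDAState k m d → ℝ) :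
    ∫ ω, φ (P.sgda lam r R ηx ηW z₀ (fun u => B u ω) (t + 1)) ∂Pr
      = ∫ ω, batchAvg b (fun A => φ (P.sgdaStep lam r R ηx ηW A
          (P.sgda lam r R ηx ηW z₀ (fun u => B u ω) t))) ∂Pr := by
  let _ : MeasurableSpace (Finset (Fin n)) := ⊤
  have : DiscreteMeasurableSpace (Finset (Fin n)) := ⟨fun _ => trivial⟩
  set z : Ω → SGDAState k m d := fun ω => P.sgda lam r R ηx ηW z₀ (fun u => B u ω) t with hz
  have h1 : (fun ω => φ (P.sgda lam r R ηx ηW z₀ (fun u => B u ω) (t + 1)))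
      =ᵐ[Pr] fun ω => ∑ A ∈ Finset.powersetCard b Finset.univ,
        {ω | B t ω = A}.indicator (fun _ => (1 : ℝ)) ω * φ (P.sgdaStep lam r R ηx ηW A (z ω)) := by
    filter_upwards [hB.ae_card_eq hbn t] with ω hω
    rw [Finset.sum_eq_single (B t ω)]
    · simp [sgda, hz]
    · intro A _ hA
      simp [Set.indicator, hA.symm]
    · intro h
      exact absurd (Finset.mem_powersetCard.2 ⟨Finset.subset_univ _, hω⟩) h
  have hint : ∀ A, Integrable (fun ω => φ (P.sgdaStep lam r R ηx ηW A (z ω))) Pr := fun A =>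
    integrable_comp_sgda hB lam r R ηx ηW z₀ t fun w => φ (P.sgdaStep lam r R ηx ηW A w)
  have hmul : ∀ A ∈ Finset.powersetCard b (Finset.univ : Finset (Fin n)),
      ∫ ω, {ω | B t ω = A}.indicator (fun _ => (1 : ℝ)) ω * φ (P.sgdaStep lam r R ηx ηW A (z ω)) ∂Pr
        = ((n.choose b : ℕ) : ℝ)⁻¹ * ∫ ω, φ (P.sgdaStep lam r R ηx ηW A (z ω)) ∂Pr := by
    intro A hA
    obtain ⟨g, hg⟩ := exists_sgda_eq (P := P) lam r R ηx ηW z₀ t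
    have hind := hB.indep.indepFun_finset (Finset.range t) {t} (by simp) fun i =>
      hB.measurable_batch i
    have hind2 := hind.symm.comp
      (φ := fun h => if h ⟨t, by simp⟩ = A then (1 : ℝ) else 0)
      (ψ := fun h => φ (P.sgdaStep lam r R ηx ηW A (g h)))
      (Measurable.of_discrete) (Measurable.of_discrete)
    have h2 := hind2.integral_fun_mul_eq_mul_integral ?_ ?_
    · have e1 : ∀ ω, (if B t ω = A then (1 : ℝ) else 0)
          = {ω | B t ω = A}.indicator (fun _ => (1 : ℝ)) ω := fun ω => by
        simp [Set.indicator]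
      simp only [Function.comp, e1] at h2
      simp only [hz, hg]
      rw [h2, integral_indicator_const _ (hB.measurable t A)]
      rw [measureReal_def, hB.uniform t A (Finset.mem_powersetCard.1 hA).2]
      simp
    · exact ((Measurable.of_discrete (f := fun h : ({t} : Finset ℕ) → Finset (Fin n) =>
        if h ⟨t, by simp⟩ = A then (1 : ℝ) else 0)).comp
        (measurable_pi_lambda _ fun i => hB.measurable_batch i)).aestronglyMeasurable
    · exact ((Measurable.of_discrete (f := fun h : Finset.range t → Finset (Fin n) =>
        φ (P.sgdaStep lam r R ηx ηW A (g h)))).comp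
        (measurable_pi_lambda _ fun i => hB.measurable_batch i)).aestronglyMeasurable
  rw [integral_congr_ae h1, integral_finsetSum]
  · rw [Finset.sum_congr rfl hmul]
    simp only [batchAvg]
    rw [integral_finsetSum _ fun A _ => (hint A).const_mul _]
    exact Finset.sum_congr rfl fun A _ => (integral_const_mul _ _).symm
  · intro A _
    refine (hint A).bdd_mul (c := 1) ?_ (Filter.Eventually.of_forall fun ω => ?_)
    · exact (measurable_const.indicator (hB.measurable t A)).aestronglyMeasurable
    · simp only [Set.indicator]; split_ifs <;> simp

end FairTask

namespace FairTask

variable {X : Type*} {n m k d : ℕ} {P : FairTask X n m k d}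
variable {c lo hi C μ lam r R R' ηx ηW : ℝ}
variable {Ω : Type*} [MeasurableSpace Ω] {b : ℕ} {Pr : Measure Ω} [IsProbabilityMeasure Pr]
  {B : ℕ → Ω → Finset (Fin n)}

/-! ### Convergence -/

/-- Almost surely all iterates satisfy the constraints; `α` grows at most linearly in time, and
does not move at all if `lam r = 0`. -/
theorem ae_admissible_sgda (hc : StepConstants c lo C μ lam r R R') (hb : P.DriftBounds c R' μ)
    (hη : 0 ≤ ηx) (hη1 : ηx * (lam * r) * c ≤ lo) (hB : IsUniformBatches Pr b B) (hb1 : 1 ≤ b)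
    (hbn : b ≤ n) {z₀ : SGDAState k m d} (hlo : lo ≤ z₀.α) (hW : ‖z₀.W‖ ≤ R') :
    ∀ᵐ ω ∂Pr, ∀ t : ℕ, Admissible lo (z₀.α + t * (ηx * (lam * r) * C)) R'
        (P.sgda lam r R ηx ηW z₀ (fun u => B u ω) t)
      ∧ (lam * r = 0 → (P.sgda lam r R ηx ηW z₀ (fun u => B u ω) t).α = z₀.α) := by
  filter_upwards [ae_all_iff.2 (hB.ae_card_eq hbn)] with ω hω t
  induction t with
  | zero => exact ⟨⟨hlo, by simp [sgda], hW⟩, fun _ => rfl⟩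
  | succ t ih =>
    have hne : (B t ω).Nonempty := Finset.card_pos.1 (by rw [hω t]; omega)
    refine ⟨?_, fun h0 => ?_⟩
    · have h := admissible_sgdaStep (ηW := ηW) hc hb hη hη1 hne ih.1
      rw [sgda]
      refine ⟨h.lo_le, h.le_hi.trans (le_of_eq ?_), h.norm_le⟩
      push_cast
      ring
    · rw [sgda, sgdaStep_α, h0, ih.2 h0]
      ring

/-- Telescoping the expected decrease of the Lyapunov function. -/
theorem sum_integral_stationarity_le {K A C₃ C₄ C₅ ν s₀ ε v : ℝ}
    (hc : StepConstants c lo C μ lam r R R') (hb : P.DriftBounds c R' μ)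
    (hF : ∀ i j, Differentiable ℝ (P.outputAt i j)) (hd : ∀ θ, ‖P.dualOpt θ‖ ≤ R)
    (hst : StepSizes c lo hi C μ lam r K A C₃ C₄ C₅ ν s₀ ε ηx ηW)
    (hB : IsUniformBatches Pr b B) (hb1 : 1 ≤ b) (hbn : b ≤ n)
    {z₀ : SGDAState k m d} (hlo : lo ≤ z₀.α) (hW : ‖z₀.W‖ ≤ R')
    (hα2 : ∀ α, lo ≤ α → lam * r * α ^ 2 ≤ C₃ * (lam * (1 + r * α)) ^ 2)
    (ha3 : ∀ α, lo ≤ α → (lam * r = 0 → α = z₀.α) →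
      (1 + r * α) ^ 3 ≤ C₄ + C₅ * (lam * r * α ^ 3))
    (hv : ∀ θ, v ≤ P.risk θ) (N : ℕ) (hN : z₀.α + N * (ηx * (lam * r) * C) ≤ hi) :
    ηx / 2 * ∑ t ∈ Finset.range N,
        ∫ ω, P.stationarity lam r (P.sgda lam r R ηx ηW z₀ (fun u => B u ω) t) ∂Pr
      ≤ P.lyapunov lam r (K * ηx / ηW) (s₀ * ε ^ 2) z₀ - v
        + N * (ηx * ε ^ 2 * (524 * s₀ * C ^ 5)) := by
  have hl := hc.lam_nonneg
  have hr := hc.r_nonneg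
  have hC0 : 0 ≤ C := by linarith [hc.one_le, hc.le_C]
  have hη := hst.ηx_pos
  have hae := ae_admissible_sgda (ηW := ηW) hc hb hη.le hst.ηx_lo hB hb1 hbn hlo hW
  set V : ℕ → ℝ := fun t => ∫ ω, P.lyapunov lam r (K * ηx / ηW) (s₀ * ε ^ 2)
    (P.sgda lam r R ηx ηW z₀ (fun u => B u ω) t) ∂Pr with hV
  set D : ℕ → ℝ := fun t =>
    ∫ ω, P.stationarity lam r (P.sgda lam r R ηx ηW z₀ (fun u => B u ω) t) ∂Pr with hD
  have hstep : ∀ t < N, V (t + 1) ≤ V t - ηx / 2 * D t + ηx * ε ^ 2 * (524 * s₀ * C ^ 5) := by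
    intro t ht
    have hint := integrable_comp_sgda (P := P) hB lam r R ηx ηW z₀ t
    have h1 : V t - ηx / 2 * D t + ηx * ε ^ 2 * (524 * s₀ * C ^ 5)
        = ∫ ω, (P.lyapunov lam r (K * ηx / ηW) (s₀ * ε ^ 2)
            (P.sgda lam r R ηx ηW z₀ (fun u => B u ω) t)
          - ηx / 2 * P.stationarity lam r (P.sgda lam r R ηx ηW z₀ (fun u => B u ω) t)
          + ηx * ε ^ 2 * (524 * s₀ * C ^ 5)) ∂Pr := by
      rw [integral_add (hint fun z => P.lyapunov lam r (K * ηx / ηW) (s₀ * ε ^ 2) z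
          - ηx / 2 * P.stationarity lam r z) (integrable_const _),
        integral_sub (hint fun z => P.lyapunov lam r (K * ηx / ηW) (s₀ * ε ^ 2) z)
          (hint fun z => ηx / 2 * P.stationarity lam r z), integral_const_mul]
      simp [hV, hD]
    rw [h1, hV]
    simp only
    rw [integral_sgda_succ hB hbn]
    refine integral_mono_ae ?_ ?_ ?_
    · exact hint fun z => batchAvg b fun A => P.lyapunov lam r (K * ηx / ηW) (s₀ * ε ^ 2)
        (P.sgdaStep lam r R ηx ηW A z)
    · exact hint fun z => P.lyapunov lam r (K * ηx / ηW) (s₀ * ε ^ 2) z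
        - ηx / 2 * P.stationarity lam r z + ηx * ε ^ 2 * (524 * s₀ * C ^ 5)
    · filter_upwards [hae] with ω hω
      obtain ⟨hz, hz0⟩ := hω t
      have htN : (t : ℝ) ≤ N := by exact_mod_cast ht.le
      refine batchAvg_lyapunov_le hc hb hF hd hst hb1 hbn ⟨hz.lo_le, hz.le_hi.trans ?_, hz.norm_le⟩
        (hα2 _ hz.lo_le) (ha3 _ hz.lo_le hz0)
      refine le_trans ?_ hN
      gcongr
  have htel : ∀ t ≤ N, ηx / 2 * ∑ u ∈ Finset.range t, D u
      ≤ V 0 - V t + t * (ηx * ε ^ 2 * (524 * s₀ * C ^ 5)) := by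
    intro t
    induction t with
    | zero => simp
    | succ t ih =>
      intro ht
      rw [Finset.sum_range_succ, mul_add]
      push_cast
      linarith [ih (by omega), hstep t (by omega)]
  have hV0 : V 0 = P.lyapunov lam r (K * ηx / ηW) (s₀ * ε ^ 2) z₀ := by
    simp [hV, sgda]
  have hVN : v ≤ V N := by
    have : v = ∫ _ω, v ∂Pr := by simp
    rw [this]
    refine integral_mono_ae (integrable_const _) (integrable_comp_sgda hB _ _ _ _ _ _ _ _) ?_
    filter_upwards [hae] with ω hω
    have hα := hc.lo_pos.trans_le (hω N).1.lo_le
    set z := P.sgda lam r R ηx ηW z₀ (fun u => B u ω) N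
    have hq : 0 ≤ P.sqNorm z.θ := by linarith [hb.one_le_sqNorm z.θ]
    have h1 := hst.K_nonneg
    have h2 := hst.s₀_nonneg
    have h3 := hst.ηW_pos
    have h4 : 0 ≤ lam * (1 + r * z.α) * P.sqNorm z.θ := by positivity
    have h5 : 0 ≤ lam * r / z.α := by positivity
    have h6 : 0 ≤ K * ηx / ηW * (lam * (1 + r * z.α) * ‖z.W - P.dualOpt z.θ‖ ^ 2) := by positivity
    have h7 : 0 ≤ s₀ * ε ^ 2 * z.α ^ 4 := by positivity
    simp only [lyapunov]
    linarith [hv z.θ]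
  linarith [htel N le_rfl]

/-- The Lyapunov function at the initial point, above a lower bound of the risk. -/
theorem lyapunov_sub_le {κ s v Δ : ℝ} (hc : StepConstants c lo C μ lam r R R')
    (hb : P.DriftBounds c R' μ) (hd : ∀ θ, ‖P.dualOpt θ‖ ≤ R) (hn : 0 < n)
    {z : SGDAState k m d} (hα : 0 < z.α) (hW : ‖z.W‖ ≤ R') (hκ1 : κ ≤ 1)
    (hs1 : s ≤ 1) (hv : P.risk z.θ - v ≤ Δ) :
    P.lyapunov lam r κ s z - v
      ≤ Δ + 2 * (lam * (1 + r * z.α) * c) + lam * r / z.α + z.α ^ 4 := by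
  have hl := hc.lam_nonneg
  have hr := hc.r_nonneg
  have : NeZero n := ⟨hn.ne'⟩
  have hq : P.sqNorm z.θ ≤ c := by
    have h1 := hb.le_meanPsi z.θ (P.dualOpt z.θ)
    rw [sub_self, norm_zero] at h1
    have h2 : |P.meanPsi z.θ (P.dualOpt z.θ)| ≤ c := by
      rw [← Real.norm_eq_abs]
      exact norm_batchMean_le Finset.univ_nonempty fun i =>
        hb.abs_psi_le i _ _ ((hd z.θ).trans hc.radius_le)
    linarith [(abs_le.1 h2).2]
  have hδ := hb.norm_sub_dualOpt_sq_le z.θ z.W hW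
  have h1 : lam * (1 + r * z.α) * P.sqNorm z.θ ≤ lam * (1 + r * z.α) * c := by gcongr
  have h2 : κ * (lam * (1 + r * z.α) * ‖z.W - P.dualOpt z.θ‖ ^ 2)
      ≤ 1 * (lam * (1 + r * z.α) * c) := by gcongr
  have h3 : s * z.α ^ 4 ≤ 1 * z.α ^ 4 := by gcongr
  unfold lyapunov
  linarith

end FairTask

/-! ### Choice of the step sizes -/

namespace FairTask

/-- Step sizes `ηx = c₂ ε ^ 3` and `ηW = c₁ ε ^ 2` meet the requirements of the analysis, if the
ratio `c₂ / c₁` is small and `c₁` is small. -/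
theorem exists_stepSizes {c lo C μ lam r K A C₃ C₄ C₅ ν s₀ : ℝ} (hc : 0 ≤ c) (hlo : 0 < lo)
    (hC : 0 ≤ C) (hμ : 0 < μ) (hl : 0 ≤ lam) (hr : 0 ≤ r) (hK : 0 ≤ K) (hA : 0 ≤ A)
    (hs₀ : 0 ≤ s₀) (hν : 0 < ν) (hKA : C ^ 3 + 4 * A * C₃ ≤ 2 * μ * K) (hC₄ : ν * C₄ ≤ s₀)
    (hC₅ : ν * C₅ ≤ 2 * s₀) :
    ∃ c₁ c₂ : ℝ, 0 < c₁ ∧ 0 < c₂ ∧ c₂ ≤ 1 ∧ ∀ ε : ℝ, 0 < ε → ε ≤ 1 →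
      K * (c₂ * ε ^ 3) / (c₁ * ε ^ 2) ≤ 1 ∧ ∀ hi, s₀ * ε ^ 2 * hi ≤ A →
        StepSizes c lo hi C μ lam r K A C₃ C₄ C₅ ν s₀ ε (c₂ * ε ^ 3) (c₁ * ε ^ 2) := by
  obtain ⟨H, hH⟩ : ∃ H, H = 1 + 4 * C ^ 11 + 11 * K * C ^ 9 := ⟨_, rfl⟩
  have hH0 : 0 < H := by rw [hH]; positivity
  obtain ⟨q, hq⟩ : ∃ q, q = min 1 (ν / (3 * H)) := ⟨_, rfl⟩
  have hq0 : 0 < q := by rw [hq]; positivity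
  have hq1 : q ≤ 1 := by rw [hq]; exact min_le_left _ _
  have hqν : H * q ≤ ν / 3 := by
    calc H * q ≤ H * (ν / (3 * H)) := by rw [hq]; gcongr; exact min_le_right _ _
      _ = ν / 3 := by field_simp
  obtain ⟨S, hS⟩ : ∃ S, S = 1 + 3 * C * r ^ 2 / μ + lam * r * c / lo + lam * r * C + K :=
    ⟨_, rfl⟩
  have s1 : 0 ≤ 3 * C * r ^ 2 / μ := by positivity
  have s2 : 0 ≤ lam * r * c / lo := by positivity
  have s3 : 0 ≤ lam * r * C := by positivity
  have hS1 : 1 ≤ S := by linarith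
  have hS0 : 0 < S := by linarith
  obtain ⟨τ, hτ⟩ : ∃ τ, τ = q / S := ⟨_, rfl⟩
  have hτ0 : 0 < τ := by rw [hτ]; positivity
  have hτq : τ ≤ q := by rw [hτ]; exact div_le_self hq0.le hS1
  have hSτ : S * τ ≤ 1 := by rw [hτ]; field_simp; exact hq1
  have hle : ∀ x, x ≤ S → x * τ ≤ 1 := fun x hx =>
    (mul_le_mul_of_nonneg_right hx hτ0.le).trans hSτ
  have t1 := hle (3 * C * r ^ 2 / μ) (by linarith)
  have t2 := hle (lam * r * c / lo) (by linarith)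
  have t3 := hle (lam * r * C) (by linarith)
  have t4 := hle K (by linarith)
  have t5 := hle 1 hS1
  refine ⟨q, q * τ, hq0, by positivity, by nlinarith, fun ε hε hε1 => ?_⟩
  have hε2 : ε ^ 2 ≤ 1 := pow_le_one₀ hε.le hε1
  have hε3 : ε ^ 3 ≤ ε ^ 2 := pow_le_pow_of_le_one hε.le hε1 (by norm_num)
  have hx : q * τ * ε ^ 3 ≤ τ := by
    calc q * τ * ε ^ 3 ≤ 1 * τ * 1 := by gcongr; linarith
      _ = τ := by ring
  refine ⟨?_, fun hi hhi => ?_⟩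
  · have : K * (q * τ * ε ^ 3) / (q * ε ^ 2) = K * τ * ε := by field_simp
    rw [this]
    nlinarith [mul_nonneg hK hτ0.le]
  refine ⟨by positivity, by positivity, ?_, by nlinarith, ?_, ?_, hK, hA, hs₀, hν.le, hhi, hKA,
    ?_, ?_, hC₄, hC₅⟩
  · calc q * τ * ε ^ 3 ≤ q * 1 * ε ^ 2 := by gcongr; linarith
      _ = q * ε ^ 2 := by ring
  · have e : lam * r * c * τ ≤ lo := by
      have : lam * r * c * τ = lam * r * c / lo * τ * lo := by field_simp
      rw [this]
      exact mul_le_of_le_one_left hlo.le t2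
    calc q * τ * ε ^ 3 * (lam * r) * c ≤ τ * (lam * r) * c := by gcongr
      _ ≤ lo := by linarith
  · calc q * τ * ε ^ 3 * (lam * r * C) ≤ τ * (lam * r * C) := by gcongr
      _ ≤ 1 := by linarith
  · have e : 3 * C * r ^ 2 * τ ≤ μ := by
      have : 3 * C * r ^ 2 * τ = 3 * C * r ^ 2 / μ * τ * μ := by field_simp
      rw [this]
      exact mul_le_of_le_one_left hμ.le t1
    calc 3 * C * r ^ 2 * (q * τ * ε ^ 3) = 3 * C * r ^ 2 * τ * (q * ε ^ 3) := by ring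
      _ ≤ μ * (q * ε ^ 2) := by gcongr
  · have e : (q * τ * ε ^ 3) ^ 2 / (q * ε ^ 2) ^ 2 = τ ^ 2 * ε ^ 2 := by field_simp
    have hτ2 : τ ^ 2 ≤ q := by
      rw [sq]
      exact (mul_le_of_le_one_left hτ0.le (by linarith)).trans hτq
    rw [e]
    calc 4 * C ^ 11 * (q * τ * ε ^ 3) + 11 * K * C ^ 9 * (τ ^ 2 * ε ^ 2 + q * ε ^ 2)
        ≤ 4 * C ^ 11 * (q * 1 * ε ^ 2) + 11 * K * C ^ 9 * (q * ε ^ 2 + q * ε ^ 2) := by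
          gcongr
          linarith
      _ = (H * q * 3 - (3 + 8 * C ^ 11 + 11 * K * C ^ 9) * q) * ε ^ 2 := by rw [hH]; ring
      _ ≤ ν * ε ^ 2 := by
          have h1 : 0 ≤ (3 + 8 * C ^ 11 + 11 * K * C ^ 9) * q := by positivity
          gcongr
          linarith

/-- The constants of the analysis can be chosen as functions of `c`, `α₀` and the parameters. -/
theorem exists_stepConstants {c μ lam r R R' α₀ : ℝ} (hc : 1 ≤ c) (hμ : 0 < μ) (hl : 0 ≤ lam)
    (hr : 0 ≤ r) (hR : 0 ≤ R) (hRR : R ≤ R') (hα₀ : 0 < α₀) :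
    ∃ lo C : ℝ, lo ≤ α₀ ∧ StepConstants c lo C μ lam r R R' := by
  obtain ⟨lo, hlo⟩ : ∃ lo, lo = min α₀ (1 / (2 * c)) := ⟨_, rfl⟩
  have h0 : 0 < lo := by rw [hlo]; positivity
  have h1 : lo ≤ 1 / (2 * c) := by rw [hlo]; exact min_le_right _ _
  have p1 : 0 ≤ c * (1 + lam) := by positivity
  have p2 : 0 ≤ 1 / lo ^ 2 := by positivity
  have p3 : 0 ≤ lo⁻¹ := by positivity
  have p4 : 0 ≤ μ⁻¹ := by positivity
  refine ⟨lo, c * (1 + lam) + (c + 1 / lo ^ 2) + lo⁻¹ + lam + r + μ⁻¹,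
    by rw [hlo]; exact min_le_left _ _, hc, hμ, h0, hl, hr, hR, hRR, ?_, ?_, ?_, ?_, ?_, ?_, ?_⟩
  · calc c * (4 * lo ^ 2) ≤ c * (4 * (1 / (2 * c)) ^ 2) := by gcongr
      _ = 1 / c := by field_simp; norm_num
      _ ≤ 1 := by rw [div_le_one (by linarith)]; exact hc
  all_goals linarith

/-! ### The rate of convergence -/

variable {X : Type*} {n m k d : ℕ} {P : FairTask X n m k d}
variable {Ω : Type*} [MeasurableSpace Ω] {b : ℕ} {Pr : Measure Ω} [IsProbabilityMeasure Pr]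
  {B : ℕ → Ω → Finset (Fin n)}

/-- With no data points, positive marginals force `m = 0`, and the objective is constant. -/
theorem differentiable_robustObjective_of_empty {P : FairTask X 0 m k d} {μ lam r : ℝ}
    (hμ : 0 < μ) (hY : ∀ θ j, μ ≤ P.probY θ j) :
    Differentiable ℝ (P.robustObjective lam r) := by
  have hm : IsEmpty (Fin m) := ⟨fun j => by
    have := hY 0 j
    simp only [probY, Finset.univ_eq_empty, Finset.sum_empty, mul_zero] at this
    linarith⟩
  have h : P.robustObjective lam r = fun _ => P.robustObjective lam r 0 := by
    funext θ
    have hQ : P.Q θ = P.Q 0 := Subsingleton.elim _ _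
    simp [robustObjective, risk, hQ]
  rw [h]
  exact differentiable_const _

/-- An average bound on the stationarity measure gives one on the norm of the gradient. -/
theorem average_norm_gradient_le {lam r R ηx ηW ε M : ℝ} {z₀ : SGDAState k m d} {T : ℕ}
    (hB : IsUniformBatches Pr b B) (hT : 1 ≤ T) (hε : 0 < ε) (hM : 0 < M)
    (hae : ∀ᵐ ω ∂Pr, ∀ t : ℕ, 0 < (P.sgda lam r R ηx ηW z₀ (fun u => B u ω) t).α)
    (hG : ∀ z : SGDAState k m d, 0 < z.α →
      ‖gradient (P.robustObjective lam r) z.θ‖ ^ 2 ≤ M * P.stationarity lam r z)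
    (hsum : ∑ t ∈ Finset.range (T + 1),
        ∫ ω, P.stationarity lam r (P.sgda lam r R ηx ηW z₀ (fun u => B u ω) t) ∂Pr
      ≤ T * (ε ^ 2 / M)) :
    (T : ℝ)⁻¹ * ∑ t ∈ Finset.Icc 1 T, (∫ ω, ‖gradient (P.robustObjective lam r)
      (P.sgda lam r R ηx ηW z₀ (fun u => B u ω) t).θ‖ ∂Pr) ≤ ε := by
  have hT0 : (0 : ℝ) < T := by exact_mod_cast hT
  -- `x ≤ ε / 2 + x ^ 2 / (2 ε)` replaces the Jensen inequality
  have h1 : ∀ t : ℕ, (∫ ω, ‖gradient (P.robustObjective lam r)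
      (P.sgda lam r R ηx ηW z₀ (fun u => B u ω) t).θ‖ ∂Pr)
      ≤ ε / 2 + M / (2 * ε) *
        ∫ ω, P.stationarity lam r (P.sgda lam r R ηx ηW z₀ (fun u => B u ω) t) ∂Pr := by
    intro t
    have hint := integrable_comp_sgda (P := P) hB lam r R ηx ηW z₀ t
    have e : ε / 2 + M / (2 * ε) *
        ∫ ω, P.stationarity lam r (P.sgda lam r R ηx ηW z₀ (fun u => B u ω) t) ∂Pr
        = ∫ ω, (ε / 2 + M / (2 * ε) *
          P.stationarity lam r (P.sgda lam r R ηx ηW z₀ (fun u => B u ω) t)) ∂Pr := by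
      rw [integral_add (integrable_const _) (hint fun z => M / (2 * ε) * P.stationarity lam r z),
        integral_const_mul]
      simp
    rw [e]
    refine integral_mono_ae (hint fun z => ‖gradient (P.robustObjective lam r) z.θ‖)
      (hint fun z => ε / 2 + M / (2 * ε) * P.stationarity lam r z) ?_
    filter_upwards [hae] with ω hω
    have h2 := hG _ (hω t)
    set x := ‖gradient (P.robustObjective lam r)
      (P.sgda lam r R ηx ηW z₀ (fun u => B u ω) t).θ‖
    have h3 : ε / 2 + M / (2 * ε) *
        P.stationarity lam r (P.sgda lam r R ηx ηW z₀ (fun u => B u ω) t)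
        = (ε ^ 2 + M * P.stationarity lam r (P.sgda lam r R ηx ηW z₀ (fun u => B u ω) t))
          / (2 * ε) := by field_simp
    rw [h3, le_div_iff₀ (by positivity)]
    nlinarith [sq_nonneg (x - ε)]
  have h2 : ∑ t ∈ Finset.Icc 1 T,
        ∫ ω, P.stationarity lam r (P.sgda lam r R ηx ηW z₀ (fun u => B u ω) t) ∂Pr
      ≤ T * (ε ^ 2 / M) := by
    refine le_trans (Finset.sum_le_sum_of_subset_of_nonneg ?_ ?_) hsum
    · intro t ht
      simp only [Finset.mem_Icc, Finset.mem_range] at ht ⊢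
      omega
    · exact fun t _ _ => integral_nonneg fun ω => stationarity_nonneg _ _ _
  rw [inv_mul_le_iff₀ hT0]
  refine (Finset.sum_le_sum fun t _ => h1 t).trans ?_
  rw [Finset.sum_add_distrib, ← Finset.mul_sum, Finset.sum_const, Nat.card_Icc,
    Nat.add_sub_cancel, nsmul_eq_mul]
  have h3 : M / (2 * ε) * ∑ t ∈ Finset.Icc 1 T,
        ∫ ω, P.stationarity lam r (P.sgda lam r R ηx ηW z₀ (fun u => B u ω) t) ∂Pr
      ≤ M / (2 * ε) * (T * (ε ^ 2 / M)) := by gcongr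
  have h4 : M / (2 * ε) * (T * (ε ^ 2 / M)) = T * (ε / 2) := by field_simp
  linarith

/-- The convergence estimate for one problem: the gradient is small on average over the first `T`
iterates, if `T` is large compared to the initial value `V` of the Lyapunov function. -/
theorem average_norm_gradient_sgda_le {c lo hi C μ lam r R R' K A C₃ C₄ C₅ ν s₀ ε ηx ηW v V M : ℝ}
    (hc : StepConstants c lo C μ lam r R R') (hb : P.DriftBounds c R' μ) (hn : 0 < n)
    (hF : ∀ i j, Differentiable ℝ (P.outputAt i j)) (hd : ∀ θ, ‖P.dualOpt θ‖ ≤ R)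
    (hst : StepSizes c lo hi C μ lam r K A C₃ C₄ C₅ ν s₀ ε ηx ηW)
    (hB : IsUniformBatches Pr b B) (hb1 : 1 ≤ b) (hbn : b ≤ n)
    {z₀ : SGDAState k m d} (hlo : lo ≤ z₀.α) (hW : ‖z₀.W‖ ≤ R')
    (hα2 : ∀ α, lo ≤ α → lam * r * α ^ 2 ≤ C₃ * (lam * (1 + r * α)) ^ 2)
    (ha3 : ∀ α, lo ≤ α → (lam * r = 0 → α = z₀.α) →
      (1 + r * α) ^ 3 ≤ C₄ + C₅ * (lam * r * α ^ 3))
    (hv : ∀ θ, v ≤ P.risk θ) (hε : 0 < ε)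
    (hM : M = 2 * (1 + (2 * c + (c + lam * (1 + r) * c) * (2 / (lam * r))) ^ 2))
    (hs₀ : 524 * s₀ * C ^ 5 = 1 / (8 * M)) {T : ℕ} (hT : 1 ≤ T)
    (hN : z₀.α + ((T + 1 : ℕ) : ℝ) * (ηx * (lam * r) * C) ≤ hi)
    (hV : P.lyapunov lam r (K * ηx / ηW) (s₀ * ε ^ 2) z₀ - v ≤ V)
    (hVT : V ≤ ηx / 2 * (T * (ε ^ 2 / (2 * M)))) :
    (T : ℝ)⁻¹ * ∑ t ∈ Finset.Icc 1 T, (∫ ω, ‖gradient (P.robustObjective lam r)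
      (P.sgda lam r R ηx ηW z₀ (fun u => B u ω) t).θ‖ ∂Pr) ≤ ε := by
  have hη := hst.ηx_pos
  have hM0 : 0 < M := by rw [hM]; positivity
  have hsum := sum_integral_stationarity_le hc hb hF hd hst hB hb1 hbn hlo hW hα2 ha3 hv (T + 1) hN
  refine average_norm_gradient_le hB hT hε hM0 ?_ (fun z hz => ?_) ?_
  · filter_upwards [ae_admissible_sgda (ηW := ηW) hc hb hη.le hst.ηx_lo hB hb1 hbn hlo hW]
      with ω hω t
    exact hc.lo_pos.trans_le (hω t).1.lo_le
  · rw [hM]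
    exact hb.sq_norm_gradient_robustObjective_le (by linarith [hc.one_le]) hn
      (fun θ => (hd θ).trans hc.radius_le) hc.lam_nonneg hc.r_nonneg hz
  · rw [hs₀] at hsum
    have h1 : ((T + 1 : ℕ) : ℝ) ≤ 2 * T := by
      push_cast
      have : (1 : ℝ) ≤ T := by exact_mod_cast hT
      linarith
    have h3 : ((T + 1 : ℕ) : ℝ) * (ηx * ε ^ 2 * (1 / (8 * M)))
        ≤ ηx / 2 * (T * (ε ^ 2 / (2 * M))) := by
      calc ((T + 1 : ℕ) : ℝ) * (ηx * ε ^ 2 * (1 / (8 * M)))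
          ≤ 2 * T * (ηx * ε ^ 2 * (1 / (8 * M))) := by gcongr
        _ = _ := by field_simp; ring
    have h4 : ηx / 2 * (T * (ε ^ 2 / (2 * M))) + ηx / 2 * (T * (ε ^ 2 / (2 * M)))
        = ηx / 2 * (T * (ε ^ 2 / M)) := by field_simp; ring
    refine le_of_mul_le_mul_left ?_ (by positivity : 0 < ηx / 2)
    linarith

end FairTask

/-- If `lam r = 0`, both sides vanish. -/
theorem mul_sq_le_inv_mul_sq {lam r α : ℝ} (hl : 0 ≤ lam) (hr : 0 ≤ r) (hα : 0 ≤ α) :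
    lam * r * α ^ 2 ≤ (lam * r)⁻¹ * (lam * (1 + r * α)) ^ 2 := by
  rcases (mul_nonneg hl hr).eq_or_lt with h0 | h0
  · rw [← h0]; simp
  · rw [← div_eq_inv_mul, le_div_iff₀ h0]
    calc lam * r * α ^ 2 * (lam * r) = (lam * (r * α)) ^ 2 := by ring
      _ ≤ _ := by gcongr; linarith

/-- If `lam r = 0`, then `α` does not move, and the first term on the right suffices. -/
theorem one_add_mul_cube_le {lam r α α₀ : ℝ} (hl : 0 ≤ lam) (hr : 0 ≤ r) (hα : 0 ≤ α)
    (hα₀ : 0 ≤ α₀) (h : lam * r = 0 → α = α₀) :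
    (1 + r * α) ^ 3 ≤ 4 + (1 + r * α₀) ^ 3 + 4 * r ^ 3 / (lam * r) * (lam * r * α ^ 3) := by
  rcases (mul_nonneg hl hr).eq_or_lt with h0 | h0
  · rw [h h0.symm, ← h0]; linarith
  · have e : 4 * r ^ 3 / (lam * r) * (lam * r * α ^ 3) = 4 * (r * α) ^ 3 := by
      rw [div_mul_eq_mul_div, div_eq_iff h0.ne']; ring
    have h1 : 0 ≤ (1 + r * α₀) ^ 3 := by positivity
    have h2 : 0 ≤ r * α := by positivity
    rw [e]
    nlinarith [mul_nonneg (by linarith : 0 ≤ 1 + r * α) (sq_nonneg (r * α - 1))]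

/-- The number of iterations for the step size `c₂ ε ^ 3`. -/
theorem exists_horizon {K₁ c₂ ε : ℝ} (hK : 0 < K₁) (hc : 0 < c₂) (hc1 : c₂ ≤ 1) (hε : 0 < ε)
    (hε1 : ε ≤ 1) : ∃ T : ℕ, 1 ≤ T ∧ (T : ℝ) ≤ (K₁ / c₂ + 1) / ε ^ 5 ∧ K₁ ≤ T * (c₂ * ε ^ 5) ∧
      ((T + 1 : ℕ) : ℝ) * (c₂ * ε ^ 3) ≤ (K₁ + 2) / ε ^ 2 := by
  have hx : 0 < c₂ * ε ^ 5 := by positivity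
  have hε5 : ε ^ 5 ≤ 1 := pow_le_one₀ hε.le hε1
  have hThi := (Nat.ceil_lt_add_one (div_pos hK hx).le).le
  refine ⟨⌈K₁ / (c₂ * ε ^ 5)⌉₊, Nat.ceil_pos.2 (by positivity), ?_, ?_, ?_⟩
  · refine hThi.trans ?_
    rw [add_div, div_div]
    gcongr
    exact one_le_one_div (by positivity) hε5
  · exact (div_le_iff₀ hx).1 (Nat.le_ceil _)
  · have h2 : c₂ * ε ^ 5 ≤ 1 := mul_le_one₀ hc1 (by positivity) hε5
    rw [le_div_iff₀ (by positivity)]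
    push_cast
    calc ((⌈K₁ / (c₂ * ε ^ 5)⌉₊ : ℝ) + 1) * (c₂ * ε ^ 3) * ε ^ 2
        = ((⌈K₁ / (c₂ * ε ^ 5)⌉₊ : ℝ) + 1) * (c₂ * ε ^ 5) := by ring
      _ ≤ (K₁ / (c₂ * ε ^ 5) + 1 + 1) * (c₂ * ε ^ 5) := by gcongr
      _ = K₁ + 2 * (c₂ * ε ^ 5) := by field_simp; ring
      _ ≤ K₁ + 2 := by linarith

/-- The weight of `α ^ 4` in the Lyapunov function, before the factor `ε ^ 2`. -/
theorem exists_quartic_weight {M C : ℝ} (hM : 2 ≤ M) (hC : 1 ≤ C) :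
    ∃ s₀ : ℝ, 0 < s₀ ∧ s₀ ≤ 1 ∧ 524 * s₀ * C ^ 5 = 1 / (8 * M) := by
  have h5 : 1 ≤ C ^ 5 := one_le_pow₀ hC
  have h0 : 0 < C ^ 5 := by linarith
  refine ⟨1 / (8 * M * 524 * C ^ 5), by positivity, ?_, by field_simp⟩
  rw [div_le_one (by positivity)]
  exact one_le_mul_of_one_le_of_one_le (by linarith) h5

theorem exists_le_of_average_le {T : ℕ} (hT : 1 ≤ T) {f : ℕ → ℝ} {ε : ℝ}
    (h : (T : ℝ)⁻¹ * ∑ t ∈ Finset.Icc 1 T, f t ≤ ε) : ∃ t ∈ Finset.Icc 1 T, f t ≤ ε := by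
  by_contra! hcon
  have hT0 : (0 : ℝ) < T := by exact_mod_cast hT
  have h1 : ∑ t ∈ Finset.Icc 1 T, ε < ∑ t ∈ Finset.Icc 1 T, f t :=
    Finset.sum_lt_sum_of_nonempty (Finset.nonempty_Icc.2 hT) hcon
  rw [Finset.sum_const, Nat.card_Icc, Nat.add_sub_cancel, nsmul_eq_mul] at h1
  rw [inv_mul_le_iff₀ hT0] at h
  linarith

end

theorem mainTheorem4 (m k : ℕ) (L β : ℝ≥0) (μ p lam r Δ α₀ : ℝ) (W₀ : DualVar k m)
    (hμ : 0 < μ) (hp : 0 < p) (hlam : 0 ≤ lam) (hr : 0 ≤ r) (hα₀ : 0 < α₀) :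
    -- the constant of the rate depends on none of the data, `n`, `d`, the batch size, `ε`
    ∃ C : ℝ, 0 < C ∧ ∀ ε : ℝ, 0 < ε → ε ≤ 1 →
      ∃ ηx ηW : ℝ, 0 < ηx ∧ 0 < ηW ∧ ∃ T : ℕ, 1 ≤ T ∧ (T : ℝ) ≤ C / ε ^ 5 ∧
      ∀ (X : Type*) (n d : ℕ) (P : FairTask X n m k d) (θ₀ : ModelParam d),
        -- the output is a probability vector
        (∀ i j θ, 0 ≤ P.outputAt i j θ) → (∀ i θ, ∑ j, P.outputAt i j θ = 1) →
        -- Lipschitz and smooth loss and output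
        (∀ i, LipschitzWith L (P.lossAt i)) →
        (∀ i, Differentiable ℝ (P.lossAt i)) →
        (∀ i, LipschitzWith β (gradient (P.lossAt i))) →
        (∀ i j, LipschitzWith L (P.outputAt i j)) →
        (∀ i j, Differentiable ℝ (P.outputAt i j)) →
        (∀ i j, LipschitzWith β (gradient (P.outputAt i j))) →
        -- positive marginals
        (∀ a, p ≤ P.probS a) → (∀ θ j, μ ≤ P.probY θ j) →
        -- the empirical risk is bounded below
        (∀ θ, P.risk θ₀ - P.risk θ ≤ Δ) →
        Differentiable ℝ (P.robustObjective lam r) ∧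
        ∀ b : ℕ, 1 ≤ b → b ≤ n →
        ∀ (Ω : Type*) [MeasurableSpace Ω] (Pr : Measure Ω) [IsProbabilityMeasure Pr]
          (B : ℕ → Ω → Finset (Fin n)), IsUniformBatches Pr b B →
        let z : ℕ → Ω → SGDAState k m d := fun t ω =>
          P.sgda lam r (2 / (μ * √p)) ηx ηW ⟨θ₀, α₀, W₀⟩ (fun u => B u ω) t
        (∀ t ≤ T, ∀ᵐ ω ∂Pr, 0 < (z t ω).α) ∧
        (T : ℝ)⁻¹ * ∑ t ∈ Finset.Icc 1 T,
            (∫ ω, ‖gradient (P.robustObjective lam r) (z t ω).θ‖ ∂Pr) ≤ ε ∧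
        ∃ t ∈ Finset.Icc 1 T,
            (∫ ω, ‖gradient (P.robustObjective lam r) (z t ω).θ‖ ∂Pr) ≤ ε := by
  have hsp : 0 < √p := Real.sqrt_pos.2 hp
  obtain ⟨R, hR⟩ : ∃ R, R = 2 / (μ * √p) := ⟨_, rfl⟩
  have hR0 : 0 ≤ R := by rw [hR]; positivity
  have hdR : 1 / (μ * √p) ≤ R := by rw [hR]; gcongr; norm_num
  -- `W₀` may lie outside the ball that the iteration projects to
  obtain ⟨R', hR'⟩ : ∃ R', R' = max R ‖W₀‖ := ⟨_, rfl⟩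
  have hRR : R ≤ R' := by rw [hR']; exact le_max_left _ _
  have hWR : ‖W₀‖ ≤ R' := by rw [hR']; exact le_max_right _ _
  obtain ⟨c, hc1, hcP⟩ := FairTask.exists_driftBounds m k L β hμ hp (hdR.trans hRR)
  obtain ⟨lo, C, hloα, hst⟩ := FairTask.exists_stepConstants hc1 hμ hlam hr hR0 hRR hα₀
  have hc0 : 0 ≤ c := by linarith
  have hC1 : 1 ≤ C := hc1.trans hst.le_C
  have hC0 : 0 < C := by linarith
  -- the factor between the squared gradient norm and the stationarity measure
  obtain ⟨M, hM⟩ : ∃ M, M = 2 * (1 + (2 * c + (c + lam * (1 + r) * c) * (2 / (lam * r))) ^ 2) :=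
    ⟨_, rfl⟩
  have hM2 : 2 ≤ M := by
    rw [hM]
    linarith [sq_nonneg (2 * c + (c + lam * (1 + r) * c) * (2 / (lam * r)))]
  have hM0 : 0 < M := by linarith
  -- with this weight, the bias of the dynamics of `α` contributes `ε ^ 2 / (8 M)` per unit of time
  obtain ⟨s₀, hs0, hs1, hs₀⟩ := exists_quartic_weight hM2 hC1
  -- a bound of the initial value of the Lyapunov function
  obtain ⟨V, hV⟩ : ∃ V, V = |Δ| + 2 * (lam * (1 + r * α₀) * c) + lam * r / α₀ + α₀ ^ 4 :=
    ⟨_, rfl⟩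
  have hV0 : 0 < V := by rw [hV]; positivity
  -- `c₂ ε ^ 5 T ≥ K₁` makes the contribution of the initial value at most half of the target
  obtain ⟨K₁, hK₁⟩ : ∃ K₁, K₁ = 4 * M * V := ⟨_, rfl⟩
  have hK₁0 : 0 < K₁ := by rw [hK₁]; positivity
  -- a bound of `s₀ ε ^ 2 α` along the whole run
  obtain ⟨A, hA⟩ : ∃ A, A = α₀ + (K₁ + 2) * (lam * r * C) := ⟨_, rfl⟩
  have hA0 : 0 ≤ A := by rw [hA]; positivity
  -- if `lam r = 0`, the divisions by zero give `C₃ = C₅ = 0`, which is the right value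
  obtain ⟨C₃, hC₃⟩ : ∃ C₃, C₃ = (lam * r)⁻¹ := ⟨_, rfl⟩
  obtain ⟨C₄, hC₄⟩ : ∃ C₄, C₄ = 4 + (1 + r * α₀) ^ 3 := ⟨_, rfl⟩
  obtain ⟨C₅, hC₅⟩ : ∃ C₅, C₅ = 4 * r ^ 3 / (lam * r) := ⟨_, rfl⟩
  have hC₃0 : 0 ≤ C₃ := by rw [hC₃]; positivity
  have hC₄0 : 0 < C₄ := by rw [hC₄]; positivity
  have hC₅0 : 0 ≤ C₅ := by rw [hC₅]; positivity
  have hα2 : ∀ α, lo ≤ α → lam * r * α ^ 2 ≤ C₃ * (lam * (1 + r * α)) ^ 2 := fun α hα => by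
    rw [hC₃]
    exact mul_sq_le_inv_mul_sq hlam hr (hst.lo_pos.le.trans hα)
  have ha3 : ∀ α, lo ≤ α → (lam * r = 0 → α = α₀) →
      (1 + r * α) ^ 3 ≤ C₄ + C₅ * (lam * r * α ^ 3) := fun α hα h0 => by
    rw [hC₄, hC₅]
    exact one_add_mul_cube_le hlam hr (hst.lo_pos.le.trans hα) hα₀.le h0
  obtain ⟨ν, hν⟩ : ∃ ν, ν = s₀ / (C₄ + C₅) := ⟨_, rfl⟩
  have hν0 : 0 < ν := by rw [hν]; positivity
  have hνs : ν * (C₄ + C₅) = s₀ := by rw [hν]; field_simp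
  obtain ⟨K, hK⟩ : ∃ K, K = (C ^ 3 + 4 * A * C₃) / (2 * μ) := ⟨_, rfl⟩
  have hK0 : 0 ≤ K := by rw [hK]; positivity
  obtain ⟨c₁, c₂, hc₁, hc₂, hc₂1, hsteps⟩ := FairTask.exists_stepSizes (C₃ := C₃) (C₄ := C₄)
    (C₅ := C₅) hc0 hst.lo_pos hC0.le hμ hlam hr hK0 hA0 hs0.le hν0
    (by rw [hK, mul_div_cancel₀ _ (by positivity)])
    (by linarith [mul_nonneg hν0.le hC₅0]) (by linarith [mul_nonneg hν0.le hC₄0.le])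
  refine ⟨K₁ / c₂ + 1, by positivity, fun ε hε hε1 => ?_⟩
  obtain ⟨hκ, hss⟩ := hsteps ε hε hε1
  obtain ⟨T, hT1, hThi, hTlo, hTN⟩ := exists_horizon hK₁0 hc₂ hc₂1 hε hε1
  refine ⟨c₂ * ε ^ 3, c₁ * ε ^ 2, by positivity, by positivity, T, hT1, hThi, ?_⟩
  intro X n d P θ₀ f1 f2 f3 f4 f5 f6 f7 f8 f9 f10 hΔ
  have hreg : P.IsRegular L β μ p := ⟨f1, f2, f3, f4, f5, f6, f7, f8, f9, f10⟩
  rcases Nat.eq_zero_or_pos n with rfl | hn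
  · exact ⟨FairTask.differentiable_robustObjective_of_empty hμ f10,
      fun b h1 h2 => absurd h1 (by omega)⟩
  have hb := hcP X n d P hn hreg
  have hd : ∀ θ, ‖P.dualOpt θ‖ ≤ R := fun θ => (hreg.norm_dualOpt_le hn hμ hp θ).trans hdR
  refine ⟨fun θ => (hb.hasGradientAt_robustObjective hr θ).differentiableAt, ?_⟩
  intro b hb1 hbn Ω _ Pr _ B hB z
  -- `α` stays below `hi` up to time `T + 1`
  obtain ⟨hi, hhi⟩ : ∃ hi, hi = α₀ + (K₁ + 2) / ε ^ 2 * (lam * r * C) := ⟨_, rfl⟩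
  have hS := hss hi (by
    have e : s₀ * ε ^ 2 * hi = s₀ * (ε ^ 2 * α₀ + (K₁ + 2) * (lam * r * C)) := by
      rw [hhi]; field_simp
    rw [e, hA]
    have hε2 : ε ^ 2 ≤ 1 := pow_le_one₀ hε.le hε1
    calc s₀ * (ε ^ 2 * α₀ + (K₁ + 2) * (lam * r * C))
        ≤ 1 * (1 * α₀ + (K₁ + 2) * (lam * r * C)) := by gcongr
      _ = _ := by ring)
  have hN : α₀ + ((T + 1 : ℕ) : ℝ) * (c₂ * ε ^ 3 * (lam * r) * C) ≤ hi := by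
    rw [hhi]
    calc α₀ + ((T + 1 : ℕ) : ℝ) * (c₂ * ε ^ 3 * (lam * r) * C)
        = α₀ + ((T + 1 : ℕ) : ℝ) * (c₂ * ε ^ 3) * (lam * r * C) := by ring
      _ ≤ _ := by gcongr
  have hae := FairTask.ae_admissible_sgda (ηW := c₁ * ε ^ 2) hst hb (by positivity) hS.ηx_lo hB
    hb1 hbn (z₀ := ⟨θ₀, α₀, W₀⟩) hloα hWR
  have hpos : ∀ᵐ ω ∂Pr, ∀ t : ℕ, 0 < (P.sgda lam r R (c₂ * ε ^ 3) (c₁ * ε ^ 2) ⟨θ₀, α₀, W₀⟩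
      (fun u => B u ω) t).α := by
    filter_upwards [hae] with ω hω t
    exact hst.lo_pos.trans_le (hω t).1.lo_le
  have hL0 := FairTask.lyapunov_sub_le (v := P.risk θ₀ - Δ) (Δ := |Δ|) (s := s₀ * ε ^ 2) hst hb hd
    hn (z := ⟨θ₀, α₀, W₀⟩) hα₀ hWR hκ
    (mul_le_one₀ hs1 (by positivity) (pow_le_one₀ hε.le hε1)) (by simp [le_abs_self])
  have hVT : V ≤ c₂ * ε ^ 3 / 2 * (T * (ε ^ 2 / (2 * M))) := by
    rw [hK₁] at hTlo
    have : c₂ * ε ^ 3 / 2 * (T * (ε ^ 2 / (2 * M))) = T * (c₂ * ε ^ 5) / (4 * M) := by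
      field_simp; ring
    rw [this, le_div_iff₀ (by positivity)]
    linarith
  rw [← hV] at hL0
  have havg := FairTask.average_norm_gradient_sgda_le hst hb hn f7 hd hS hB hb1 hbn
    (z₀ := ⟨θ₀, α₀, W₀⟩) hloα hWR hα2 ha3 (v := P.risk θ₀ - Δ) (fun θ => by linarith [hΔ θ]) hε hM
    hs₀ hT1 hN hL0 hVT
  have hz : ∀ t ω, z t ω = P.sgda lam r R (c₂ * ε ^ 3) (c₁ * ε ^ 2) ⟨θ₀, α₀, W₀⟩
      (fun u => B u ω) t := fun t ω => by rw [hR]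
  simp only [hz]
  refine ⟨fun t _ => ?_, havg, exists_le_of_average_le hT1 havg⟩
  filter_upwards [hpos] with ω hω
  exact hω t
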